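/- **Setting.** For integers $p\ge 3$, $N\ge 1$ and parameters $\beta\ge 0$, $h\in\mathbb R$, the $p$-tensor Curie–Weiss model is the probability measure on $\{-1,1\}^N$ $$\mathbb P_{\beta,h,p}(x)=\frac{1}{2^N Z_N(\beta,h,p)}\exp\Big\{\frac{\beta}{N^{p-1}}\sum_{1\le i_1,\dots,i_p\le N}x_{i_1}\cdots x_{i_p}+h\sum_{i=1}^N x_i\Big\},$$ where $Z_N(\beta,h,p)$ is the normalizing constant (the formula makes sense for all $\beta\in\mathbb R$). Let $X\sim\mathbb P_{\beta,h,p}$ and, with $h$ known, let $\hat\beta_N=\hat\beta_N(X)\in[-\infty,\infty]$ be a maximum likelihood estimate of $\beta$, i.e. a maximizer of $b\mapsto\mathbb P_{b,h,p}(X)$ over $b\in\mathbb R$, or $\pm\infty$ if the likelihood tends to its supremum as $b\to\pm\infty$. Convergence in distribution $\xrightarrow{D}$ is weak convergence of laws on $[-\infty,\infty]$. For $x\in[-1,1]$ let $H(x)=H_{\beta,h,p}(x)=\beta x^p+hx-\tfrac12\{(1+x)\log(1+x)+(1-x)\log(1-x)\}$. The point $(\beta,h)$ is *$p$-critical* if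 $H$ has more than one global maximizer on $[-1,1]$. Let $\tilde\beta_p=\sup\{\beta\ge0:\sup_{x\in[-1,1]}H_{\beta,0,p}(x)=0\}$. Let $N^{+}(0,\sigma^2)$ and $N^{-}(0,\sigma^2)$ be the laws of $|Y|$ and $-|Y|$ for $Y\sim N(0,\sigma^2)$. Let $Z\sim N(0,1)$ and $\gamma_p=\mathbb P(Z^p\le\mathbb E Z^p)$. Let $\delta_a$ be the point mass at $a$. **Theorem 2.7** ($\hat\beta_N$ at $p$-critical points). Let $p\ge3$ and let $(\beta,h)\in[0,\infty)\times\mathbb R$ be $p$-critical. Then $H$ has $K\in\{2,3\}$ global maximizers $m_1<\dots<m_K$; they lie in $(-1,1)$ and satisfy $H''(m_k)<0$. Put $$p_k=\frac{[(m_k^2-1)H''(m_k)]^{-1/2}}{\sum_{i=1}^K[(m_i^2-1)H''(m_i)]^{-1/2}},\qquad \sigma_k^2=-\frac{H''(m_k)}{p^2m_k^{2p-2}}\quad(m_k\ne0).$$ The following hold as $N\to\infty$; every $\sigma_k^2$ that occurs below is well defined and positive. 1. Let $p$ be odd. Then $K=2$. - If $(\beta,h)\ne(\tilde\beta_p,0)$,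 then $\sqrt N(\hat\beta_N-\beta)\xrightarrow{D}\frac{p_1}{2}N^-(0,\sigma_1^2)+\frac{1-p_1}{2}N^+(0,\sigma_2^2)+\frac12\delta_0$. - If $(\beta,h)=(\tilde\beta_p,0)$, then $\sqrt N(\hat\beta_N-\beta)\xrightarrow{D}\frac{p_1}{2}\delta_{-\infty}+\frac{1-p_1}{2}N^+(0,\sigma_2^2)+\frac12\delta_0$. 2. Let $p$ be even. - If $h>0$, then $K=2$ and $\sqrt N(\hat\beta_N-\beta)\xrightarrow{D}\frac{p_1}{2}N^-(0,\sigma_1^2)+\frac{1-p_1}{2}N^+(0,\sigma_2^2)+\frac12\delta_0$. - If $h<0$, then $K=2$ and $\sqrt N(\hat\beta_N-\beta)\xrightarrow{D}\frac{p_1}{2}N^+(0,\sigma_1^2)+\frac{1-p_1}{2}N^-(0,\sigma_2^2)+\frac12\delta_0$. - If $h=0$ and $\beta>\tilde\beta_p$, then the maximizers are $-m_*$ and $m_*$ for some $m_*>0$, and $\sqrt N(\hat\beta_N-\beta)\xrightarrow{D}N\big(0,-\frac{H''(m_*)}{p^2m_*^{2p-2}}\big)$. - If $h=0$ and $\beta=\tilde\beta_p$,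 then the maximizers are $-m_*$, $0$ and $m_*$ for some $m_*>0$, and $\sqrt N(\hat\beta_N-\beta)\xrightarrow{D}p_2\gamma_p\,\delta_{-\infty}+p_1N^+\big(0,-\frac{H''(m_*)}{p^2m_*^{2p-2}}\big)+(1-p_1-p_2\gamma_p)\,\delta_0$. In particular, $\hat\beta_N$ is not $\sqrt N$-consistent at $(\beta,h)=(\tilde\beta_p,0)$: it is not true that for every $\delta>0$ there is $M$ with $\mathbb P_{\beta,h,p}(\sqrt N|\hat\beta_N-\beta|\le M)>1-\delta$ for all large $N$. -/

import Mathlib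

open Filter Topology MeasureTheory ProbabilityTheory Set

noncomputable section

namespace CurieWeiss

/-! ### The p-tensor Curie-Weiss model -/

/-- The configuration space `{-1, 1}^N`. -/
abbrev Config (N : ℕ) : Type := Fin N → ℤˣ

/-- The real value `1` or `-1` of a spin. -/
def spin (s : ℤˣ) : ℝ := ((s : ℤ) : ℝ)

/-- The unnormalized weight
`exp (β / N^(p-1) * ∑_{1 ≤ i₁, …, i_p ≤ N} x_{i₁} ⋯ x_{i_p} + h * ∑_i x_i)`. -/
def gibbsWeight (p N : ℕ) (β h : ℝ) (x : Config N) : ℝ :=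
  Real.exp (β / (N : ℝ) ^ (p - 1) * ∑ i : Fin p → Fin N, ∏ k, spin (x (i k))
    + h * ∑ i, spin (x i))

/-- The partition function `Z_N(β, h, p)`. -/
def partitionFunction (p N : ℕ) (β h : ℝ) : ℝ :=
  1 / 2 ^ N * ∑ x : Config N, gibbsWeight p N β h x

/-- The probability (likelihood) of the configuration `x` under the parameters `(β, h)`. -/
def likelihood (p N : ℕ) (β h : ℝ) (x : Config N) : ℝ :=
  gibbsWeight p N β h x / (2 ^ N * partitionFunction p N β h)

theorem likelihood_nonneg (p N : ℕ) (β h : ℝ) (x : Config N) : 0 ≤ likelihood p N β h x := by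
  unfold likelihood partitionFunction gibbsWeight
  positivity

theorem sum_likelihood (p N : ℕ) (β h : ℝ) : ∑ x, likelihood p N β h x = 1 := by
  have hpos : 0 < ∑ x : Config N, gibbsWeight p N β h x :=
    Finset.sum_pos (fun x _ => Real.exp_pos _) Finset.univ_nonempty
  unfold likelihood partitionFunction
  rw [← Finset.sum_div, ← mul_assoc, mul_one_div_cancel (by positivity), one_mul,
    div_self hpos.ne']

/-- The Gibbs measure `ℙ_{β,h,p}` on `{-1, 1}^N`. -/
def gibbs (p N : ℕ) (β h : ℝ) : PMF (Config N) :=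
  PMF.ofFintype (fun x => ENNReal.ofReal (likelihood p N β h x)) (by
    rw [← ENNReal.ofReal_sum_of_nonneg (fun x _ => likelihood_nonneg p N β h x),
      sum_likelihood, ENNReal.ofReal_one])

/-! ### Maximum likelihood estimation of `β` when `h` is known -/

/-- `b ∈ [-∞, ∞]` is a maximum likelihood estimate of `β` (with `h` known) for the sample `x`:
either `b` is real and maximizes the likelihood over all of `ℝ`, or `b = ±∞` and the likelihood
tends to its supremum as the parameter tends to `b`. -/
def IsMLE (p N : ℕ) (h : ℝ) (x : Config N) (b : EReal) : Prop :=
  (∃ β : ℝ, b = (β : EReal) ∧ ∀ β' : ℝ, likelihood p N β' h x ≤ likelihood p N β h x) ∨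
  (b = ⊤ ∧ Tendsto (fun β : ℝ => likelihood p N β h x) atTop
    (𝓝 (⨆ β : ℝ, likelihood p N β h x))) ∨
  (b = ⊥ ∧ Tendsto (fun β : ℝ => likelihood p N β h x) atBot
    (𝓝 (⨆ β : ℝ, likelihood p N β h x)))

/-- The law of `√N (T_N(X) - β)` on `[-∞, ∞]`, for `X` distributed as `ℙ_{β,h,p}`. -/
def scaledErrorLaw (p : ℕ) (β h : ℝ) (T : (N : ℕ) → Config N → EReal) (N : ℕ) :
    ProbabilityMeasure EReal :=
  ⟨((gibbs p N β h).map
      (fun x => ((Real.sqrt N : ℝ) : EReal) * (T N x - (β : EReal)))).toMeasure,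
    inferInstance⟩

/-- Convergence in distribution of laws on `[-∞, ∞]` to `ν`: `ν` is a probability measure and the
laws converge to it weakly. -/
def ConvergesInLaw (μ : ℕ → ProbabilityMeasure EReal) (ν : Measure EReal) : Prop :=
  ∃ ν' : ProbabilityMeasure EReal, (ν' : Measure EReal) = ν ∧ Tendsto μ atTop (𝓝 ν')

/-- `√N`-consistency of the estimators `T N` at `(β, h)`: for every `δ > 0` there is `M` such that
`ℙ_{β,h,p}(√N |T_N - β| ≤ M) > 1 - δ` for all large `N`. -/
def IsSqrtConsistent (p : ℕ) (β h : ℝ) (T : (N : ℕ) → Config N → EReal) : Prop :=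
  ∀ δ : ℝ, 0 < δ → ∃ M : ℝ, ∀ᶠ N : ℕ in atTop,
    1 - δ < (scaledErrorLaw p β h T N : Measure EReal).real (Icc ((-M : ℝ) : EReal) (M : EReal))

/-! ### The function `H` and the critical points -/

/-- The binary entropy function `I`. -/
def entropy (x : ℝ) : ℝ :=
  1 / 2 * ((1 + x) * Real.log (1 + x) + (1 - x) * Real.log (1 - x))

/-- The function `H_{β,h,p}`; only its values on `[-1, 1]` matter. -/
def H (p : ℕ) (β h x : ℝ) : ℝ := β * x ^ p + h * x - entropy x

/-- The second derivative of `H_{β,h,p}`. -/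
def H2 (p : ℕ) (β h x : ℝ) : ℝ := iteratedDeriv 2 (H p β h) x

/-- The set of global maximizers of `H_{β,h,p}` on `[-1, 1]`. -/
def maximizers (p : ℕ) (β h : ℝ) : Set ℝ :=
  {m | m ∈ Icc (-1 : ℝ) 1 ∧ IsMaxOn (H p β h) (Icc (-1) 1) m}

/-- `(β, h)` is `p`-critical: `H_{β,h,p}` has more than one global maximizer. -/
def IsCritical (p : ℕ) (β h : ℝ) : Prop := (maximizers p β h).Nontrivial

/-- The threshold `β̃_p = sup {β ≥ 0 : sup_{[-1,1]} H_{β,0,p} = 0}`. -/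
def betaTilde (p : ℕ) : ℝ :=
  sSup {β : ℝ | 0 ≤ β ∧ sSup (H p β 0 '' Icc (-1) 1) = 0}

/-- The weight attached to a maximizer `m`:
`[(m² - 1) H''(m)]^{-1/2}` divided by the sum of these quantities over all maximizers. -/
def mixWeight (p : ℕ) (β h m : ℝ) : ℝ :=
  ((m ^ 2 - 1) * H2 p β h m) ^ (-(1 / 2) : ℝ) /
    ∑ᶠ m' ∈ maximizers p β h, ((m' ^ 2 - 1) * H2 p β h m') ^ (-(1 / 2) : ℝ)

/-- The limiting variance `-H''(m) / (p² m^{2p-2})`. -/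
def limVar (p : ℕ) (β h m : ℝ) : ℝ := -H2 p β h m / ((p : ℝ) ^ 2 * m ^ (2 * p - 2))

/-! ### Components of the limiting mixtures, as measures on `[-∞, ∞]` -/

/-- The normal distribution `N(0, v)`. -/
def normalE (v : ℝ) : Measure EReal :=
  (gaussianReal 0 v.toNNReal).map (fun z : ℝ => (z : EReal))

/-- The positive half-normal distribution `N⁺(0, v)`, the law of `|Z|` with `Z ~ N(0, v)`. -/
def halfNormalPos (v : ℝ) : Measure EReal :=
  (gaussianReal 0 v.toNNReal).map (fun z : ℝ => ((|z| : ℝ) : EReal))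

/-- The negative half-normal distribution `N⁻(0, v)`, the law of `-|Z|` with `Z ~ N(0, v)`. -/
def halfNormalNeg (v : ℝ) : Measure EReal :=
  (gaussianReal 0 v.toNNReal).map (fun z : ℝ => ((-|z| : ℝ) : EReal))

/-- The mixture `a • μ + b • ν + c • ρ` with real (nonnegative) weights. -/
def mixture (a : ℝ) (μ : Measure EReal) (b : ℝ) (ν : Measure EReal) (c : ℝ) (ρ : Measure EReal) :
    Measure EReal :=
  ENNReal.ofReal a • μ + ENNReal.ofReal b • ν + ENNReal.ofReal c • ρ

/-- `γ_p = ℙ(Z^p ≤ 𝔼 Z^p)` for a standard normal `Z`. -/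
def gammaP (p : ℕ) : ℝ :=
  (gaussianReal 0 1).real {z : ℝ | z ^ p ≤ ∫ w, w ^ p ∂(gaussianReal 0 1)}

end CurieWeiss

end

noncomputable section

namespace CurieWeiss

/-! ### Weak convergence on the extended reals from convergence of distribution functions -/

/-! For fixed `h` the model is a one-parameter exponential family with sufficient statistic `N * x ^
p`, where `x` is the average spin. For `N ≥ 2` the reciprocal of the likelihood is a strictly convex
function of the parameter, so an estimate, finite or not, is at most `b` exactly when the derivative
of that function at `b` is nonnegative, that is, when the observed `x ^ p` does not exceed its mean
under the parameter `b` (`le_iff_of_isMLE`). Hence the distribution function of the scaled error at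
`t` is the probability under `β` that `x ^ p` is at most its mean under `β + t / √N`, and everything
becomes a question about binomial sums.

Laplace's method evaluates these sums (`tendsto_entropySum`): each maximizer `m` of `H` carries mass
proportional to `((m² - 1) H''(m))^(-1/2)`, with Gaussian fluctuations of variance `-1 / H''(m)` on
the scale `1 / √N`. Moving the parameter from `β` to `β + t / √N` inserts the factor `exp (t √N x ^
p)`. This factor is of order one inside a fluctuation window, but between windows with different
values of `m ^ p` it differs exponentially in `√N`. So the mean under `β + t / √N` sees only the
maximizers at which `t * m ^ p` is largest, whereas the probability under `β` sees all of them.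
`NondegenerateMaximizers.tendsto_cdf` makes this comparison: a maximizer that the tilt does not
select contributes its full weight if `t > 0` and nothing if `t < 0`.

If the selected maximizers are nonzero, `x ^ p` fluctuates on the scale `1 / √N` and a Gaussian
computation gives the distribution function of `N(0, σ²)`. When the sign of `t` changes, the
selected maximizer changes too, which produces the half-normal parts and the atom at `0`. If `0` is
selected, as happens for `t < 0` at the threshold, `x ^ p` lives on the scale `N^(-p/2)`, the tilt
disappears in the limit, and the distribution function tends to the weight of `0` times `γ_p` for
every `t < 0`. This is mass escaping to `-∞`, and it destroys consistency.

The structure of the maximizers rests on one fact: `H'' = 0` reads `β p (p - 1) (x^(p-2) - x^p) =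
1`, which has at most two solutions in `(0, 1)` (`derivH2_zeros`). Rolle's theorem then limits the
number of critical points and excludes degenerate maximizers. -/

theorem exists_real_ne_zero_between {a b : EReal} (hab : a < b) :
    ∃ t : ℝ, t ≠ 0 ∧ a < t ∧ (t : EReal) < b := by
  obtain ⟨s, hs1, hs2⟩ := EReal.lt_iff_exists_real_btwn.1 hab
  by_cases h0 : s = 0
  · obtain ⟨r, hr1, hr2⟩ := EReal.lt_iff_exists_real_btwn.1 hs1
    refine ⟨r, ?_, hr1, hr2.trans hs2⟩
    rintro rfl
    simp [h0] at hr2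
  · exact ⟨s, h0, hs1, hs2⟩

/-- Laws on `[-∞, ∞]` whose distribution functions converge at every real `t ≠ 0` converge
weakly. -/
theorem tendsto_of_tendsto_Iic {μ : ℕ → ProbabilityMeasure EReal} {ν : ProbabilityMeasure EReal}
    (hcdf : ∀ t : ℝ, t ≠ 0 → Tendsto (fun N => (μ N : Measure EReal).real (Iic (t : EReal))) atTop
      (𝓝 ((ν : Measure EReal).real (Iic (t : EReal))))) :
    Tendsto μ atTop (𝓝 ν) := by
  -- The endpoints avoid `0` and `⊥`, where the limit laws may have atoms. `⊤` is harmless because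
  -- `Iic ⊤` is the whole space.
  set D : Set EReal := {b | b = ⊤ ∨ ∃ t : ℝ, t ≠ 0 ∧ b = t} with hD
  have hmin : ∀ a ∈ D, ∀ b ∈ D, min a b ∈ D := by
    intro a ha b hb
    rcases min_choice a b with h | h <;> rw [h] <;> assumption
  have hmax : ∀ a ∈ D, ∀ b ∈ D, max a b ∈ D := by
    intro a ha b hb
    rcases max_choice a b with h | h <;> rw [h] <;> assumption
  have hIic : ∀ b ∈ D, Tendsto (fun N => (μ N : Measure EReal).real (Iic b)) atTop
      (𝓝 ((ν : Measure EReal).real (Iic b))) := by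
    rintro b (rfl | ⟨t, ht, rfl⟩)
    · simp
    · exact hcdf t ht
  -- The half-open intervals supply neighbourhoods of every point except `⊥`, for which the sets
  -- `Iic b` are needed.
  set S : Set (Set EReal) := {s | ∃ b ∈ D, s = Iic b ∨ ∃ a ∈ D, s = Ioc a b} with hS
  have hpi : IsPiSystem S := by
    rintro s ⟨b, hb, rfl | ⟨a, ha, rfl⟩⟩ s' ⟨b', hb', rfl | ⟨a', ha', rfl⟩⟩ -
    · exact ⟨min b b', hmin _ hb _ hb', Or.inl (by rw [Iic_inter_Iic])⟩
    · refine ⟨min b b', hmin _ hb _ hb', Or.inr ⟨a', ha', ?_⟩⟩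
      ext x; simp; tauto
    · refine ⟨min b b', hmin _ hb _ hb', Or.inr ⟨a, ha, ?_⟩⟩
      ext x; simp
    · refine ⟨min b b', hmin _ hb _ hb', Or.inr ⟨max a a', hmax _ ha _ ha', ?_⟩⟩
      rw [Ioc_inter_Ioc]
  refine hpi.tendsto_probabilityMeasure_of_tendsto_of_mem ?_ ?_ ?_
  · rintro s ⟨b, hb, rfl | ⟨a, ha, rfl⟩⟩
    · exact measurableSet_Iic
    · exact measurableSet_Ioc
  · intro u hu x hx
    have hnhds := hu.mem_nhds hx
    have hupper : x ≠ ⊤ → ∃ b ∈ D, x < b ∧ Ico x b ⊆ u := by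
      intro hxt
      obtain ⟨b, hb, hbu⟩ := exists_Ico_subset_of_mem_nhds hnhds ⟨⊤, lt_top_iff_ne_top.2 hxt⟩
      obtain ⟨t, ht0, ht1, ht2⟩ := exists_real_ne_zero_between hb
      exact ⟨t, Or.inr ⟨t, ht0, rfl⟩, ht1, (Ico_subset_Ico_right ht2.le).trans hbu⟩
    have hlower : x ≠ ⊥ → ∃ a ∈ D, a < x ∧ Ioc a x ⊆ u := by
      intro hxt
      obtain ⟨b, hb, hbu⟩ := exists_Ioc_subset_of_mem_nhds hnhds ⟨⊥, bot_lt_iff_ne_bot.2 hxt⟩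
      obtain ⟨t, ht0, ht1, ht2⟩ := exists_real_ne_zero_between hb
      exact ⟨t, Or.inr ⟨t, ht0, rfl⟩, ht2, (Ioc_subset_Ioc_left ht1.le).trans hbu⟩
    have hupper' : ∃ b ∈ D, Iic b ∈ 𝓝 x ∧ Icc x b ⊆ u := by
      by_cases hxt : x = ⊤
      · exact ⟨⊤, Or.inl rfl, by simp, by simpa [hxt] using hx⟩
      · obtain ⟨b, hb, hxb, hbu⟩ := hupper hxt
        obtain ⟨t, ht0, ht1, ht2⟩ := exists_real_ne_zero_between hxb
        exact ⟨t, Or.inr ⟨t, ht0, rfl⟩, Iic_mem_nhds ht1,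
          fun y hy => hbu ⟨hy.1, hy.2.trans_lt ht2⟩⟩
    obtain ⟨b, hb, hbn, hbu⟩ := hupper'
    by_cases hxb : x = ⊥
    · refine ⟨Iic b, ⟨b, hb, Or.inl rfl⟩, hbn, fun y hy => hbu ⟨by simp [hxb], hy⟩⟩
    · obtain ⟨a, ha, hax, hau⟩ := hlower hxb
      refine ⟨Ioc a b, ⟨b, hb, Or.inr ⟨a, ha, rfl⟩⟩, ?_, ?_⟩
      · rw [← Ioi_inter_Iic]
        exact inter_mem (Ioi_mem_nhds hax) hbn
      · intro y hy
        rcases le_total y x with h | h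
        · exact hau ⟨hy.1, h⟩
        · exact hbu ⟨h, hy.2⟩
  · intro s hs
    suffices h : Tendsto (fun N => (μ N : Measure EReal).real s) atTop
        (𝓝 ((ν : Measure EReal).real s)) by
      rw [← NNReal.tendsto_coe]
      exact h
    obtain ⟨b, hb, rfl | ⟨a, ha, rfl⟩⟩ := hs
    · exact hIic b hb
    · rcases le_total a b with hab | hab
      · have key : ∀ ρ : ProbabilityMeasure EReal, (ρ : Measure EReal).real (Ioc a b) =
            (ρ : Measure EReal).real (Iic b) - (ρ : Measure EReal).real (Iic a) := by
          intro ρ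
          rw [← measureReal_sdiff (Iic_subset_Iic.2 hab) measurableSet_Iic, Iic_sdiff_Iic]
        simp_rw [key]
        exact (hIic b hb).sub (hIic a ha)
      · simp [Ioc_eq_empty_of_le hab]

/-! ### The maximum likelihood estimate in a one-parameter exponential family -/

/-- Divided by the term of `x`, the normalizing sum becomes `q b = ∑ a y * exp (b * c y)` with `c y
= T y - T x`, and the likelihood is `1 / q`. Since `T` is not constant, `q` is strictly convex, so
its minimizer, possibly at infinity, is at most `b` exactly when `q' b ≥ 0`. -/
theorem le_iff_of_isMLE_exponential {Ω : Type*} [Fintype Ω] (T w : Ω → ℝ) (hw : ∀ y, 0 < w y)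
    (lik : ℝ → ℝ) (x : Ω)
    (hlik : ∀ b, lik b = w x * Real.exp (b * T x) / ∑ y, w y * Real.exp (b * T y))
    (hT : ∃ y, T y ≠ T x) (m : EReal)
    (hm : (∃ β : ℝ, m = (β : EReal) ∧ ∀ β' : ℝ, lik β' ≤ lik β) ∨
      (m = ⊤ ∧ Tendsto lik atTop (𝓝 (⨆ β : ℝ, lik β))) ∨
      (m = ⊥ ∧ Tendsto lik atBot (𝓝 (⨆ β : ℝ, lik β)))) (b : ℝ) :
    m ≤ b ↔ 0 ≤ ∑ y, (T y - T x) * (w y * Real.exp (b * T y)) := by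
  set c : Ω → ℝ := fun y => T y - T x with hc
  set a : Ω → ℝ := fun y => w y / w x with ha
  have ha0 : ∀ y, 0 < a y := fun y => div_pos (hw y) (hw x)
  set q : ℝ → ℝ := fun b => ∑ y, a y * Real.exp (b * c y) with hq
  set d : ℝ → ℝ := fun b => ∑ y, a y * (Real.exp (b * c y) * c y) with hd
  have hexp : ∀ b y, w y * Real.exp (b * T y) = w x * Real.exp (b * T x) *
      (a y * Real.exp (b * c y)) := by
    intro b y
    have : Real.exp (b * T y) = Real.exp (b * T x) * Real.exp (b * c y) := by
      rw [← Real.exp_add]; congr 1; simp only [hc]; ring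
    rw [this]
    simp only [ha]
    field_simp [(hw x).ne']
  have hq0 : ∀ b, 0 < q b := fun b =>
    Finset.sum_pos (fun y _ => mul_pos (ha0 y) (Real.exp_pos _)) ⟨x, Finset.mem_univ _⟩
  have hlq : ∀ b, lik b = 1 / q b := by
    intro b
    rw [hlik]
    have : ∑ y, w y * Real.exp (b * T y) = w x * Real.exp (b * T x) * q b := by
      rw [hq, Finset.mul_sum]; exact Finset.sum_congr rfl fun y _ => hexp b y
    rw [this]
    have := hw x
    have := Real.exp_pos (b * T x)
    have := hq0 b
    field_simp
  have hdb : (0 ≤ ∑ y, (T y - T x) * (w y * Real.exp (b * T y))) ↔ 0 ≤ d b := by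
    have : ∑ y, (T y - T x) * (w y * Real.exp (b * T y)) = w x * Real.exp (b * T x) * d b := by
      rw [hd, Finset.mul_sum]
      refine Finset.sum_congr rfl fun y _ => ?_
      rw [hexp b y]; ring
    rw [this]
    exact mul_nonneg_iff_of_pos_left (mul_pos (hw x) (Real.exp_pos _))
  rw [hdb]
  -- Strict convexity in tangent-line form, termwise from `1 + z ≤ exp z`; the term with `c y ≠ 0`
  -- makes it strict.
  have hconv : ∀ b b', b' ≠ b → q b + d b * (b' - b) < q b' := by
    intro b b' hbb
    have hterm : ∀ y, a y * Real.exp (b * c y) + a y * (Real.exp (b * c y) * c y) * (b' - b) =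
        a y * Real.exp (b * c y) * ((b' - b) * c y + 1) := fun y => by ring
    have hterm' : ∀ y, a y * Real.exp (b' * c y) =
        a y * Real.exp (b * c y) * Real.exp ((b' - b) * c y) := by
      intro y; rw [mul_assoc, ← Real.exp_add]; congr 2; ring
    simp only [hq, hd]
    rw [Finset.sum_mul, ← Finset.sum_add_distrib]
    refine Finset.sum_lt_sum (fun y _ => ?_) ?_
    · rw [hterm, hterm']
      exact mul_le_mul_of_nonneg_left (Real.add_one_le_exp _)
        (mul_pos (ha0 y) (Real.exp_pos _)).le
    · obtain ⟨y, hy⟩ := hT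
      refine ⟨y, Finset.mem_univ _, ?_⟩
      rw [hterm, hterm']
      exact mul_lt_mul_of_pos_left
        (Real.add_one_lt_exp (mul_ne_zero (sub_ne_zero.2 hbb) (sub_ne_zero.2 hy)))
        (mul_pos (ha0 y) (Real.exp_pos _))
  have hdmono : Monotone d := by
    intro b b' hbb
    refine Finset.sum_le_sum fun y _ => mul_le_mul_of_nonneg_left ?_ (ha0 y).le
    rcases le_total 0 (c y) with h | h
    · exact mul_le_mul_of_nonneg_right
        (Real.exp_le_exp.2 (mul_le_mul_of_nonneg_right hbb h)) h
    · exact mul_le_mul_of_nonpos_right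
        (Real.exp_le_exp.2 (mul_le_mul_of_nonpos_right hbb h)) h
  have hderiv : ∀ b, HasDerivAt q (d b) b := by
    intro b
    refine HasDerivAt.fun_sum fun y _ => ?_
    have := ((hasDerivAt_id b).mul_const (c y)).exp.const_mul (a y)
    simpa using this
  -- Without boundedness the real supremum in the definition of the estimate would be the default
  -- value `0`.
  have hbdd : BddAbove (range lik) := by
    refine ⟨1, ?_⟩
    rintro _ ⟨b, rfl⟩
    rw [hlq, div_le_one (hq0 b)]
    have : a x * Real.exp (b * c x) ≤ q b :=
      Finset.single_le_sum (f := fun y => a y * Real.exp (b * c y))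
        (fun y _ => (mul_pos (ha0 y) (Real.exp_pos _)).le) (Finset.mem_univ x)
    simpa [ha, hc, (hw x).ne'] using this
  rcases hm with ⟨β, rfl, hβ⟩ | ⟨rfl, hlim⟩ | ⟨rfl, hlim⟩
  · have hmin : ∀ b', q β ≤ q b' := by
      intro b'
      have := hβ b'
      rw [hlq, hlq] at this
      exact (one_div_le_one_div (hq0 _) (hq0 _)).1 this
    rw [EReal.coe_le_coe_iff]
    constructor
    · intro h
      have h0 : d β = 0 :=
        IsLocalMin.hasDerivAt_eq_zero (f := q) (a := β) (Filter.Eventually.of_forall hmin) (hderiv β)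
      exact h0 ▸ hdmono h
    · intro h
      by_contra! hlt
      have h1 := hconv b β hlt.ne'
      have h2 := mul_nonneg h (sub_pos.2 hlt).le
      linarith [hmin b]
  -- If `q' b ≥ 0`, then `q` increases beyond `b`, so the limit at `+∞`, which is the supremum,
  -- would be at most `lik (b + 1) < lik b`. The case of `-∞` is the mirror image.
  · refine iff_of_false (by simp) fun h => ?_
    have hlt : q b < q (b + 1) := by
      have := hconv b (b + 1) (by simp)
      linarith [mul_nonneg h (by linarith : (0 : ℝ) ≤ b + 1 - b)]
    have hle : ∀ᶠ b' in atTop, lik b' ≤ lik (b + 1) := by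
      filter_upwards [eventually_gt_atTop (b + 1)] with b' hb'
      rw [hlq, hlq, one_div_le_one_div (hq0 _) (hq0 _)]
      have h1 := hconv (b + 1) b' hb'.ne'
      have h2 : 0 ≤ d (b + 1) := h.trans (hdmono (by linarith))
      linarith [mul_nonneg h2 (sub_pos.2 hb').le]
    have h1 := le_of_tendsto hlim hle
    have h2 : lik (b + 1) < lik b := by
      rw [hlq, hlq]; exact one_div_lt_one_div_of_lt (hq0 _) hlt
    linarith [le_ciSup hbdd b]
  · refine iff_of_true (by simp) ?_
    by_contra! h
    have hlt : q b < q (b - 1) := by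
      have := hconv b (b - 1) (by simp)
      nlinarith
    have hle : ∀ᶠ b' in atBot, lik b' ≤ lik (b - 1) := by
      filter_upwards [eventually_lt_atBot (b - 1)] with b' hb'
      rw [hlq, hlq, one_div_le_one_div (hq0 _) (hq0 _)]
      have h1 := hconv (b - 1) b' hb'.ne
      have h2 : d (b - 1) ≤ 0 := (hdmono (by linarith)).trans h.le
      linarith [mul_nonneg_of_nonpos_of_nonpos h2 (sub_neg.2 hb').le]
    have h1 := le_of_tendsto hlim hle
    have h2 : lik (b - 1) < lik b := by
      rw [hlq, hlq]; exact one_div_lt_one_div_of_lt (hq0 _) hlt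
    linarith [le_ciSup hbdd b]

/-! ### Reduction to the magnetization -/

/-- The average spin of a configuration. -/
def magnetization {N : ℕ} (x : Config N) : ℝ := (∑ i, spin (x i)) / N

/-- The sum over `p`-tuples factors as `(∑ x_i) ^ p`, so the configuration enters only through its
average spin. -/
theorem gibbsWeight_eq {p N : ℕ} (hp : p ≠ 0) (hN : N ≠ 0) (β h : ℝ) (x : Config N) :
    gibbsWeight p N β h x =
      Real.exp (N * (β * magnetization x ^ p + h * magnetization x)) := by
  unfold gibbsWeight magnetization
  congr 1
  have h1 : ∑ i : Fin p → Fin N, ∏ k, spin (x (i k)) = (∑ i, spin (x i)) ^ p :=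
    (Fintype.sum_pow (fun i => spin (x i)) p).symm
  obtain ⟨n, rfl⟩ := Nat.exists_eq_succ_of_ne_zero hp
  rw [h1]
  have : (N : ℝ) ≠ 0 := by exact_mod_cast hN
  rw [Nat.succ_eq_add_one, Nat.add_sub_cancel]
  rw [div_pow]
  field_simp
  ring

theorem sum_spin_eq (N : ℕ) (s : Finset (Fin N)) :
    ∑ i, spin (if i ∈ s then 1 else -1) = 2 * (s.card : ℝ) - N := by
  have : ∀ i, spin (if i ∈ s then 1 else -1) = 2 * (if i ∈ s then (1 : ℝ) else 0) - 1 := by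
    intro i
    split_ifs <;> norm_num [spin]
  simp_rw [this]
  rw [Finset.sum_sub_distrib, ← Finset.mul_sum]
  simp

/-- Sums over configurations of functions of the magnetization are binomial sums. -/
theorem sum_config_eq (N : ℕ) (f : ℝ → ℝ) :
    ∑ x : Config N, f (magnetization x) =
      ∑ k ∈ Finset.range (N + 1), (N.choose k : ℝ) * f ((2 * k - N) / N) := by
  classical
  let e : Finset (Fin N) → Config N := fun s i => if i ∈ s then 1 else -1
  have he : Function.Bijective e := by
    constructor
    · intro s t hst
      ext i
      have := congrFun hst i
      simp only [e] at this
      by_cases h1 : i ∈ s <;> by_cases h2 : i ∈ t <;> simp [h1, h2] at this ⊢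
    · intro x
      refine ⟨Finset.univ.filter (fun i => x i = 1), ?_⟩
      funext i
      rcases Int.units_eq_one_or (x i) with h | h <;> simp [e, h]
  rw [← he.sum_comp]
  have h1 : ∀ s : Finset (Fin N),
      f (magnetization (e s)) = (fun k : ℕ => f ((2 * k - N) / N)) s.card := by
    intro s
    simp only [magnetization, e]
    rw [sum_spin_eq]
  simp_rw [h1]
  rw [← Finset.powerset_univ,
    Finset.sum_powerset_apply_card (fun k : ℕ => f ((2 * k - N) / N))]
  simp

/-- The unnormalized expectation of `φ` of the magnetization, as a binomial sum. -/
def binSum (p : ℕ) (β h : ℝ) (N : ℕ) (φ : ℝ → ℝ) : ℝ :=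
  ∑ k ∈ Finset.range (N + 1), (N.choose k : ℝ) *
    (Real.exp (N * (β * ((2 * k - N) / N : ℝ) ^ p + h * ((2 * k - N) / N))) * φ ((2 * k - N) / N))

theorem sum_gibbsWeight_mul {p N : ℕ} (hp : p ≠ 0) (hN : N ≠ 0) (β h : ℝ) (φ : ℝ → ℝ) :
    ∑ x : Config N, gibbsWeight p N β h x * φ (magnetization x) = binSum p β h N φ := by
  simp_rw [gibbsWeight_eq hp hN]
  exact sum_config_eq N (fun m => Real.exp (N * (β * m ^ p + h * m)) * φ m)

theorem likelihood_eq {p N : ℕ} (hp : p ≠ 0) (hN : N ≠ 0) (β h : ℝ) (x : Config N) :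
    likelihood p N β h x = gibbsWeight p N β h x / binSum p β h N (fun _ => 1) := by
  unfold likelihood partitionFunction
  rw [← mul_assoc, mul_one_div_cancel (by positivity), one_mul, ← sum_gibbsWeight_mul hp hN]
  simp

theorem le_iff_of_isMLE {p N : ℕ} (hp : p ≠ 0) (hN : 2 ≤ N) {h : ℝ} {x : Config N} {m : EReal}
    (hm : IsMLE p N h x m) (b : ℝ) :
    m ≤ b ↔ magnetization x ^ p * binSum p b h N (fun _ => 1) ≤ binSum p b h N (fun y => y ^ p) := by
  have hN0 : N ≠ 0 := by omega
  have hNpos : (0 : ℝ) < N := by exact_mod_cast Nat.pos_of_ne_zero hN0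
  have hsplit : ∀ b (y : Config N), gibbsWeight p N b h y =
      Real.exp (N * h * magnetization y) * Real.exp (b * (N * magnetization y ^ p)) := by
    intro b y
    rw [gibbsWeight_eq hp hN0, ← Real.exp_add]
    congr 1; ring
  -- All spins up gives magnetization `1`; exactly one spin up gives absolute value below `1`, which
  -- requires `N ≥ 2`.
  have hnonconst : ∃ y : Config N, (N : ℝ) * magnetization y ^ p ≠ N * magnetization x ^ p := by
    have h1 : magnetization (fun _ : Fin N => (1 : ℤˣ)) = 1 := by
      simp [magnetization, spin, hN0]
    have h2 : |magnetization (fun i : Fin N => if i ∈ ({⟨0, by omega⟩} : Finset (Fin N)) then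
        (1 : ℤˣ) else -1)| < 1 := by
      have hN' : (2 : ℝ) ≤ N := by exact_mod_cast hN
      unfold magnetization
      rw [sum_spin_eq, Finset.card_singleton, abs_div, Nat.abs_cast, div_lt_one hNpos, abs_lt]
      constructor <;> push_cast <;> linarith
    by_contra! hall
    have h3 := hall (fun _ => 1)
    have h4 := hall (fun i : Fin N => if i ∈ ({⟨0, by omega⟩} : Finset (Fin N)) then
        (1 : ℤˣ) else -1)
    rw [← h3, h1, one_pow] at h4
    have h5 := mul_left_cancel₀ hNpos.ne' h4
    have h6 := pow_lt_one₀ (abs_nonneg _) h2 hp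
    rw [← abs_pow, h5] at h6
    simp at h6
  have key := le_iff_of_isMLE_exponential (fun y : Config N => N * magnetization y ^ p)
    (fun y => Real.exp (N * h * magnetization y)) (fun y => Real.exp_pos _)
    (fun β => likelihood p N β h x) x (fun b => by
      rw [likelihood_eq hp hN0, hsplit, ← sum_gibbsWeight_mul hp hN0]
      simp_rw [hsplit, mul_one]) hnonconst m hm b
  rw [key]
  simp_rw [← hsplit]
  have h1 : ∑ y : Config N, ((N : ℝ) * magnetization y ^ p - N * magnetization x ^ p) *
      gibbsWeight p N b h y = N * (binSum p b h N (fun y => y ^ p) -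
        magnetization x ^ p * binSum p b h N (fun _ => 1)) := by
    rw [← sum_gibbsWeight_mul hp hN0, ← sum_gibbsWeight_mul hp hN0, Finset.mul_sum,
      ← Finset.sum_sub_distrib, Finset.mul_sum]
    exact Finset.sum_congr rfl fun y _ => by ring
  rw [h1, mul_nonneg_iff_of_pos_left hNpos, sub_nonneg]

theorem scaled_error_le_iff {s : ℝ} (hs : 0 < s) (m : EReal) (β t : ℝ) :
    (s : EReal) * (m - (β : EReal)) ≤ (t : EReal) ↔ m ≤ ((β + t / s : ℝ) : EReal) := by
  induction m with
  | bot => simp [EReal.coe_mul_bot_of_pos hs]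
  | top =>
    rw [EReal.top_sub_coe, EReal.coe_mul_top_of_pos hs, top_le_iff, top_le_iff]
    exact iff_of_false (EReal.coe_ne_top _) (EReal.coe_ne_top _)
  | coe r =>
    rw [← EReal.coe_sub, ← EReal.coe_mul, EReal.coe_le_coe_iff, EReal.coe_le_coe_iff,
      ← sub_le_iff_le_add', le_div_iff₀ hs, mul_comm]

/-- The distribution function of the scaled error of the maximum likelihood estimate. -/
theorem scaledErrorLaw_real_Iic {p N : ℕ} (hp : p ≠ 0) (hN : 2 ≤ N) {β h : ℝ}
    {T : (N : ℕ) → Config N → EReal} (hT : ∀ x : Config N, IsMLE p N h x (T N x)) (t : ℝ) :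
    (scaledErrorLaw p β h T N : Measure EReal).real (Iic (t : EReal)) =
      binSum p β h N (fun x => if x ^ p * binSum p (β + t / Real.sqrt N) h N (fun _ => 1) ≤
        binSum p (β + t / Real.sqrt N) h N (fun y => y ^ p) then 1 else 0) /
      binSum p β h N (fun _ => 1) := by
  classical
  have hN0 : N ≠ 0 := by omega
  have hs : 0 < Real.sqrt N := Real.sqrt_pos.2 (by exact_mod_cast Nat.pos_of_ne_zero hN0)
  have h1 : (scaledErrorLaw p β h T N : Measure EReal) (Iic (t : EReal)) =
      ENNReal.ofReal (∑ x : Config N, if T N x ≤ ((β + t / Real.sqrt N : ℝ) : EReal) then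
        likelihood p N β h x else 0) := by
    change ((gibbs p N β h).map _).toMeasure _ = _
    rw [PMF.toMeasure_apply_eq_toOuterMeasure_apply _ measurableSet_Iic,
      PMF.toOuterMeasure_map_apply, PMF.toOuterMeasure_apply_fintype, ENNReal.ofReal_sum_of_nonneg]
    · refine Finset.sum_congr rfl fun x _ => ?_
      rw [indicator_apply]
      simp only [mem_preimage, mem_Iic, scaled_error_le_iff hs]
      split_ifs with h
      · rfl
      · simp
    · intro x _
      split_ifs
      · exact likelihood_nonneg _ _ _ _ _
      · exact le_rfl
  rw [Measure.real, h1, ENNReal.toReal_ofReal, ← sum_gibbsWeight_mul hp hN0, Finset.sum_div]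
  · refine Finset.sum_congr rfl fun x _ => ?_
    rw [likelihood_eq hp hN0]
    simp only [le_iff_of_isMLE hp hN (hT x)]
    split_ifs <;> simp
  · refine Finset.sum_nonneg fun x _ => ?_
    split_ifs
    · exact likelihood_nonneg _ _ _ _ _
    · exact le_rfl

/-! ### Binomial coefficients and the entropy -/

/-- The possible values of the magnetization. -/
def gridPoint (N k : ℕ) : ℝ := (2 * k - N) / N

theorem one_add_gridPoint {N : ℕ} (hN : N ≠ 0) (k : ℕ) : 1 + gridPoint N k = 2 * k / N := by
  have : (N : ℝ) ≠ 0 := by exact_mod_cast hN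
  unfold gridPoint; field_simp; ring

theorem one_sub_gridPoint {N : ℕ} (hN : N ≠ 0) (k : ℕ) :
    1 - gridPoint N k = 2 * (N - k) / N := by
  have : (N : ℝ) ≠ 0 := by exact_mod_cast hN
  unfold gridPoint; field_simp; ring

theorem gridPoint_mem_Icc {N k : ℕ} (hk : k ≤ N) : gridPoint N k ∈ Icc (-1 : ℝ) 1 := by
  rcases Nat.eq_zero_or_pos N with rfl | hN
  · simp [gridPoint]
  have hk' : (k : ℝ) ≤ N := by exact_mod_cast hk
  have h1 := one_add_gridPoint hN.ne' k
  have h2 := one_sub_gridPoint hN.ne' k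
  have h3 : 0 ≤ 2 * (k : ℝ) / N := by positivity
  have h4 : 0 ≤ 2 * ((N : ℝ) - k) / N := div_nonneg (by linarith) (by positivity)
  constructor <;> linarith

/-- The side condition covers the endpoints `±1` of the grid, where `0 * log 0 = 0` has to match `0
^ 0 = 1`. -/
theorem exp_natCast_mul_log {a : ℝ} (ha : 0 ≤ a) {n : ℕ} (h : a = 0 → n = 0) :
    Real.exp (n * Real.log a) = a ^ n := by
  rcases ha.eq_or_lt with h0 | h0
  · simp [h h0.symm]
  · rw [mul_comm, Real.exp_mul, Real.exp_log h0, Real.rpow_natCast]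

theorem exp_mul_entropy {N k : ℕ} (hN : N ≠ 0) (hk : k ≤ N) :
    Real.exp (N * entropy (gridPoint N k)) =
      (2 * k / N : ℝ) ^ k * (2 * (N - k) / N : ℝ) ^ (N - k) := by
  have hN' : (N : ℝ) ≠ 0 := by exact_mod_cast hN
  have hk' : (k : ℝ) ≤ N := by exact_mod_cast hk
  unfold entropy
  rw [one_add_gridPoint hN, one_sub_gridPoint hN]
  have : (N : ℝ) * (1 / 2 * (2 * (k : ℝ) / N * Real.log (2 * k / N) +
      2 * ((N : ℝ) - k) / N * Real.log (2 * (N - k) / N))) =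
      k * Real.log (2 * k / N) + ((N - k : ℕ) : ℝ) * Real.log (2 * (N - k) / N) := by
    rw [Nat.cast_sub hk]; field_simp
  rw [this, Real.exp_add, exp_natCast_mul_log (by positivity), exp_natCast_mul_log]
  · exact div_nonneg (by linarith) (by positivity)
  · intro h
    rw [div_eq_zero_iff, or_iff_left hN', mul_eq_zero, or_iff_right two_ne_zero] at h
    have : (N : ℝ) = k := by linarith
    have : N = k := by exact_mod_cast this
    omega
  · intro h
    rw [div_eq_zero_iff, or_iff_left hN', mul_eq_zero, or_iff_right two_ne_zero] at h
    exact_mod_cast h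

/-- With `x` the grid point, the left side is a single term of the binomial expansion of `((1 + x) +
(1 - x)) ^ N`, divided by `2 ^ N`. The bound is crude but valid up to the endpoints. -/
theorem choose_mul_exp_entropy_le {N k : ℕ} (hN : N ≠ 0) (hk : k ≤ N) :
    (N.choose k : ℝ) / 2 ^ N * Real.exp (N * entropy (gridPoint N k)) ≤ 1 := by
  have hN' : (N : ℝ) ≠ 0 := by exact_mod_cast hN
  have hk' : (k : ℝ) ≤ N := by exact_mod_cast hk
  have hb : 0 ≤ 2 * ((N : ℝ) - k) / N := div_nonneg (by linarith) (by positivity)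
  rw [exp_mul_entropy hN hk, div_mul_eq_mul_div, div_le_one (by positivity)]
  have h1 : (2 : ℝ) ^ N = (2 * (k : ℝ) / N + 2 * ((N : ℝ) - k) / N) ^ N := by
    congr 1; field_simp; ring
  rw [h1, add_pow, mul_comm]
  exact Finset.single_le_sum
    (f := fun j => (2 * (k : ℝ) / N) ^ j * (2 * ((N : ℝ) - k) / N) ^ (N - j) * (N.choose j : ℝ))
    (fun j _ => by positivity) (Finset.mem_range.2 (Nat.lt_succ_of_le hk))

theorem factorial_eq_stirlingSeq {n : ℕ} (hn : n ≠ 0) :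
    (n.factorial : ℝ) = Stirling.stirlingSeq n * (Real.sqrt (2 * n) * (n / Real.exp 1) ^ n) := by
  have : (0 : ℝ) < n := by exact_mod_cast Nat.pos_of_ne_zero hn
  unfold Stirling.stirlingSeq
  have : 0 < Real.sqrt (2 * n) := Real.sqrt_pos.2 (by positivity)
  field_simp

/-- Stirling's formula for binomial probabilities, in exact form. -/
theorem sqrt_mul_choose_mul_exp_entropy {N k : ℕ} (hk0 : k ≠ 0) (hk : k < N) :
    Real.sqrt N * ((N.choose k : ℝ) / 2 ^ N * Real.exp (N * entropy (gridPoint N k))) =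
      Stirling.stirlingSeq N / (Stirling.stirlingSeq k * Stirling.stirlingSeq (N - k)) *
        Real.sqrt (2 / (1 - gridPoint N k ^ 2)) := by
  have hN0 : N ≠ 0 := by omega
  have hl0 : N - k ≠ 0 := by omega
  have hN : (0 : ℝ) < N := by exact_mod_cast Nat.pos_of_ne_zero hN0
  have hk' : (0 : ℝ) < k := by exact_mod_cast Nat.pos_of_ne_zero hk0
  have hl' : (0 : ℝ) < (N - k : ℕ) := by exact_mod_cast Nat.pos_of_ne_zero hl0
  have hlc : ((N - k : ℕ) : ℝ) = N - k := by rw [Nat.cast_sub hk.le]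
  have hs : ∀ n, n ≠ 0 → 0 < Stirling.stirlingSeq n := fun n hn =>
    (Real.sqrt_pos.2 Real.pi_pos).trans_le (Stirling.sqrt_pi_le_stirlingSeq hn)
  rw [exp_mul_entropy hN0 hk.le, Nat.cast_choose ℝ hk.le, factorial_eq_stirlingSeq hN0,
    factorial_eq_stirlingSeq hk0, factorial_eq_stirlingSeq hl0]
  have h1 : 1 - gridPoint N k ^ 2 = 4 * k * (N - k : ℕ) / N ^ 2 := by
    have : 1 - gridPoint N k ^ 2 = (1 + gridPoint N k) * (1 - gridPoint N k) := by ring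
    rw [this, one_add_gridPoint hN0, one_sub_gridPoint hN0, hlc]
    field_simp; ring
  have h2 : Real.sqrt (2 / (1 - gridPoint N k ^ 2)) * (Real.sqrt (2 * k) *
      Real.sqrt (2 * (N - k : ℕ))) = Real.sqrt N * Real.sqrt (2 * N) := by
    rw [← Real.sqrt_mul (by positivity), ← Real.sqrt_mul (by rw [h1]; positivity),
      ← Real.sqrt_mul (by positivity), h1]
    congr 1
    field_simp; ring
  have h3 : (N : ℝ) ^ N = N ^ k * N ^ (N - k) := by rw [← pow_add]; congr 1; omega
  have h4 : (2 : ℝ) ^ N = 2 ^ k * 2 ^ (N - k) := by rw [← pow_add]; congr 1; omega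
  have h5 : Real.exp 1 ^ N = Real.exp 1 ^ k * Real.exp 1 ^ (N - k) := by
    rw [← pow_add]; congr 1; omega
  rw [← hlc]
  have hsN := hs N hN0
  have hsk := hs k hk0
  have hsl := hs _ hl0
  have hqk : 0 < Real.sqrt (2 * k) := Real.sqrt_pos.2 (by positivity)
  have hql : 0 < Real.sqrt (2 * (N - k : ℕ)) := Real.sqrt_pos.2 (by positivity)
  have he := Real.exp_pos 1
  have h6 : Real.sqrt (2 / (1 - gridPoint N k ^ 2)) = Real.sqrt N * Real.sqrt (2 * N) /
      (Real.sqrt (2 * k) * Real.sqrt (2 * (N - k : ℕ))) := by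
    rw [eq_div_iff (by positivity), h2]
  rw [h6]
  simp only [div_pow, mul_pow]
  rw [h3, h4, h5]
  generalize Real.sqrt (2 * k) = a at *
  generalize Real.sqrt (2 * (N - k : ℕ)) = b at *
  generalize Real.sqrt (2 * (N : ℝ)) = c at *
  field_simp

theorem stirlingSeq_le_one {n : ℕ} (hn : n ≠ 0) :
    Stirling.stirlingSeq n ≤ Stirling.stirlingSeq 1 := by
  obtain ⟨j, rfl⟩ := Nat.exists_eq_succ_of_ne_zero hn
  exact Stirling.stirlingSeq'_antitone (Nat.zero_le j)

/-- The Stirling sequence stays between `√π ≥ 1` and its first term, so the exact formula is bounded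
uniformly in `N` away from `±1`. This feeds the domination in Laplace's method. -/
theorem sqrt_mul_choose_mul_exp_entropy_le {N k : ℕ} {δ : ℝ} (hδ : 0 < δ)
    (hk0 : k ≠ 0) (hk : k < N) (hx : δ ≤ 1 - gridPoint N k ^ 2) :
    Real.sqrt N * ((N.choose k : ℝ) / 2 ^ N * Real.exp (N * entropy (gridPoint N k))) ≤
      Stirling.stirlingSeq 1 * Real.sqrt (2 / δ) := by
  rw [sqrt_mul_choose_mul_exp_entropy hk0 hk]
  have hpi : 1 ≤ Real.sqrt Real.pi := by
    rw [Real.one_le_sqrt]; linarith [Real.pi_gt_three]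
  have h1 := Stirling.sqrt_pi_le_stirlingSeq hk0
  have h2 := Stirling.sqrt_pi_le_stirlingSeq (n := N - k) (by omega)
  have h3 := stirlingSeq_le_one (n := N) (by omega)
  have h4 := Stirling.sqrt_pi_le_stirlingSeq (n := N) (by omega)
  refine mul_le_mul ?_ (Real.sqrt_le_sqrt (div_le_div_of_nonneg_left (by norm_num) hδ hx))
    (Real.sqrt_nonneg _) (by linarith)
  refine (div_le_self (by linarith) ?_).trans h3
  nlinarith

/-- Binomial probabilities near a point `m` of `(-1, 1)`. -/
theorem tendsto_sqrt_mul_choose {m : ℝ} (hm : m ∈ Ioo (-1 : ℝ) 1) {k : ℕ → ℕ}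
    (hk : Tendsto (fun N => gridPoint N (k N)) atTop (𝓝 m)) :
    (∀ᶠ N in atTop, k N ≠ 0 ∧ k N < N) ∧
    Tendsto (fun N : ℕ => Real.sqrt N * ((N.choose (k N) : ℝ) / 2 ^ N *
      Real.exp (N * entropy (gridPoint N (k N))))) atTop
      (𝓝 (1 / Real.sqrt Real.pi * Real.sqrt (2 / (1 - m ^ 2)))) := by
  have hpi : 0 < Real.sqrt Real.pi := Real.sqrt_pos.2 Real.pi_pos
  have hNat : Tendsto (fun N : ℕ => (N : ℝ)) atTop atTop := tendsto_natCast_atTop_atTop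
  have hk1 : Tendsto k atTop atTop := by
    rw [← tendsto_natCast_atTop_iff (R := ℝ)]
    have h1 : Tendsto (fun N : ℕ => (N : ℝ) * ((1 + gridPoint N (k N)) / 2)) atTop atTop :=
      hNat.atTop_mul_pos (by linarith [hm.1] : (0 : ℝ) < (1 + m) / 2)
        ((hk.const_add 1).div_const 2)
    refine h1.congr' ?_
    filter_upwards [eventually_ne_atTop 0] with N hN
    have : (N : ℝ) ≠ 0 := by exact_mod_cast hN
    rw [one_add_gridPoint hN]; field_simp
  have hk2 : Tendsto (fun N : ℕ => (N : ℝ) - k N) atTop atTop := by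
    have h1 : Tendsto (fun N : ℕ => (N : ℝ) * ((1 - gridPoint N (k N)) / 2)) atTop atTop :=
      hNat.atTop_mul_pos (by linarith [hm.2] : (0 : ℝ) < (1 - m) / 2)
        ((hk.const_sub 1).div_const 2)
    refine h1.congr' ?_
    filter_upwards [eventually_ne_atTop 0] with N hN
    have : (N : ℝ) ≠ 0 := by exact_mod_cast hN
    rw [one_sub_gridPoint hN]; field_simp
  have hev : ∀ᶠ N in atTop, k N ≠ 0 ∧ k N < N := by
    filter_upwards [hk1.eventually_ne_atTop 0, hk2.eventually_gt_atTop 0] with N h1 h2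
    exact ⟨h1, by exact_mod_cast sub_pos.1 h2⟩
  have hk3 : Tendsto (fun N : ℕ => N - k N) atTop atTop := by
    rw [← tendsto_natCast_atTop_iff (R := ℝ)]
    refine hk2.congr' ?_
    filter_upwards [hev] with N hN
    rw [Nat.cast_sub hN.2.le]
  refine ⟨hev, ?_⟩
  have hS := Stirling.tendsto_stirlingSeq_sqrt_pi
  have h1 := (hS.div ((hS.comp hk1).mul (hS.comp hk3)) (by positivity)).mul
    (((tendsto_const_nhds (x := (2 : ℝ))).div ((hk.pow 2).const_sub 1)
      (by nlinarith [hm.1, hm.2])).sqrt)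
  have h2 : Real.sqrt Real.pi / (Real.sqrt Real.pi * Real.sqrt Real.pi) =
      1 / Real.sqrt Real.pi := by field_simp
  rw [h2] at h1
  refine h1.congr' ?_
  filter_upwards [hev] with N hN
  exact (sqrt_mul_choose_mul_exp_entropy hN.1 hN.2).symm

/-! ### Sums as integrals of step functions -/

/-- The step function with value `F k` on `[k, k + 1)` for `k < n`. -/
def stepFun (n : ℕ) (F : ℕ → ℝ) (u : ℝ) : ℝ :=
  ∑ k ∈ Finset.range n, (Ico (k : ℝ) (k + 1)).indicator (fun _ => F k) u

theorem measurable_stepFun (n : ℕ) (F : ℕ → ℝ) : Measurable (stepFun n F) :=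
  Finset.measurable_fun_sum _ fun _ _ => measurable_const.indicator measurableSet_Ico

theorem integral_stepFun (n : ℕ) (F : ℕ → ℝ) : ∫ u, stepFun n F u = ∑ k ∈ Finset.range n, F k := by
  unfold stepFun
  rw [integral_finsetSum]
  · refine Finset.sum_congr rfl fun k _ => ?_
    rw [integral_indicator_const _ measurableSet_Ico]
    simp [Measure.real]
  · intro k _
    rw [integrable_indicator_iff measurableSet_Ico]
    exact integrableOn_const (by simp)

theorem stepFun_eq (n : ℕ) (F : ℕ → ℝ) (u : ℝ) :
    stepFun n F u = if 0 ≤ u ∧ ⌊u⌋₊ < n then F ⌊u⌋₊ else 0 := by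
  unfold stepFun
  have h1 : ∀ k : ℕ, (Ico (k : ℝ) (k + 1)).indicator (fun _ => F k) u =
      if 0 ≤ u then (if ⌊u⌋₊ = k then F k else 0) else 0 := by
    intro k
    rw [indicator_apply]
    by_cases hu : 0 ≤ u
    · simp only [hu, if_true, Nat.floor_eq_iff hu, mem_Ico]
    · rw [if_neg hu, if_neg]
      rintro ⟨h, -⟩
      exact hu ((Nat.cast_nonneg k).trans h)
  simp_rw [h1]
  by_cases hu : 0 ≤ u
  · simp [hu]
  · simp [hu]

/-- Writing the sum as an integral in a rescaled variable lets dominated convergence replace Riemann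
sum estimates. -/
theorem sum_eq_integral_stepFun (n : ℕ) (F : ℕ → ℝ) (c : ℝ) {s : ℝ} (hs : 0 < s) :
    ∑ k ∈ Finset.range n, F k = ∫ y, s * stepFun n F (c + s * y) := by
  rw [integral_const_mul]
  have h1 : ∫ y, stepFun n F (c + s * y) = |s⁻¹| • ∫ u, stepFun n F (c + u) :=
    Measure.integral_comp_mul_left (fun u => stepFun n F (c + u)) s
  rw [h1, integral_add_left_eq_self (stepFun n F) c, integral_stepFun, abs_of_pos (inv_pos.2 hs),
    smul_eq_mul, mul_inv_cancel_left₀ hs.ne']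

/-! ### Laplace's method for binomial sums -/

/-- The binomial sum `∑_k 2^{-N} C(N, k) e^{N (f(x_k) + I(x_k))} φ(x_k)` over the grid points. -/
def entropySum (f : ℝ → ℝ) (N : ℕ) (φ : ℝ → ℝ) : ℝ :=
  ∑ k ∈ Finset.range (N + 1), (N.choose k : ℝ) / 2 ^ N * Real.exp (N * entropy (gridPoint N k)) *
    (Real.exp (N * f (gridPoint N k)) * φ (gridPoint N k))

/-- This is the source of the mixture weights: the inverse grid spacing `1 / 2`, the Stirling
constant `√(2 / (π (1 - m²)))` and the Gaussian mass `√(2π / (-κ))` multiply to `((m² - 1)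
κ)^(-1/2)`. -/
theorem integral_gaussianReal_inv {κ : ℝ} (hκ : κ < 0) {m : ℝ} (hm : m ∈ Ioo (-1 : ℝ) 1)
    (G : ℝ → ℝ) :
    ∫ y, 1 / 2 * (1 / Real.sqrt Real.pi * Real.sqrt (2 / (1 - m ^ 2))) *
      (Real.exp (κ / 2 * y ^ 2) * G y) =
    ((m ^ 2 - 1) * κ) ^ (-(1 / 2) : ℝ) * ∫ y, G y ∂(gaussianReal 0 (1 / (-κ)).toNNReal) := by
  have hv : 0 < 1 / (-κ) := by
    have : 0 < -κ := by linarith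
    positivity
  have hm2 : 0 < 1 - m ^ 2 := by nlinarith [hm.1, hm.2]
  have hv' : (1 / (-κ)).toNNReal ≠ 0 := by
    rw [Ne, Real.toNNReal_eq_zero]; linarith
  rw [integral_gaussianReal_eq_integral_smul hv', ← integral_const_mul]
  congr 1
  funext y
  rw [gaussianPDFReal_def, Real.coe_toNNReal _ hv.le, smul_eq_mul]
  have hκ' : 0 < -κ := by linarith
  have h1 : -(y - 0) ^ 2 / (2 * (1 / -κ)) = κ / 2 * y ^ 2 := by field_simp; ring
  beta_reduce
  rw [h1, Real.rpow_neg (by nlinarith), ← Real.sqrt_eq_rpow]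
  have h2 : (m ^ 2 - 1) * κ = (1 - m ^ 2) * (-κ) := by ring
  have h3 : 1 / 2 * (1 / Real.sqrt Real.pi * Real.sqrt (2 / (1 - m ^ 2))) =
      (Real.sqrt ((m ^ 2 - 1) * κ))⁻¹ * (Real.sqrt (2 * Real.pi * (1 / -κ)))⁻¹ := by
    have hpi := Real.pi_pos
    rw [h2]
    clear h1 h2
    generalize -κ = c at *
    have h4 : (1 / 2 : ℝ) = Real.sqrt (1 / 4) := by
      rw [show (1 / 4 : ℝ) = (1 / 2) ^ 2 by norm_num, Real.sqrt_sq (by norm_num)]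
    have h5 : 1 / Real.sqrt Real.pi = Real.sqrt (1 / Real.pi) := by
      rw [Real.sqrt_div zero_le_one, Real.sqrt_one]
    rw [h4, h5, ← Real.sqrt_mul (by positivity), ← Real.sqrt_mul (by positivity), ← mul_inv,
      ← Real.sqrt_mul (by positivity), ← Real.sqrt_inv]
    congr 1
    field_simp
    norm_num
  rw [h3]
  ring

/-- In the variable `y = √N (x - m)` the sum over a window around `m` is an integral whose integrand
converges to a Gaussian times `G` and is dominated by a Gaussian, since exponential growth of `φ` in
`√N |x - m|` loses against the quadratic decay. Convergence of `φ` is required along all sequences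
tending to `y`, because grid points only approximate `m + y / √N`, and only for almost every `y`,
because indicators jump. -/
theorem tendsto_local_entropySum {f : ℝ → ℝ} {m κ : ℝ} (hm : m ∈ Ioo (-1 : ℝ) 1) (hκ : κ < 0)
    (hf : (fun x => f x - κ / 2 * (x - m) ^ 2) =o[𝓝 m] fun x => (x - m) ^ 2) :
    ∀ᶠ ε in 𝓝[>] (0 : ℝ), ∀ (φ : ℕ → ℝ → ℝ) (G : ℝ → ℝ) (C : ℝ),
      (∀ N, ∀ x ∈ Icc (-1 : ℝ) 1, |φ N x| ≤ C * Real.exp (C * (Real.sqrt N * |x - m|))) →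
      (∀ᵐ y, ∀ u : ℕ → ℝ, Tendsto u atTop (𝓝 y) →
        Tendsto (fun N => φ N (m + u N / Real.sqrt N)) atTop (𝓝 (G y))) →
      Tendsto (fun N => entropySum f N (fun x => if |x - m| < ε then φ N x else 0)) atTop
        (𝓝 (((m ^ 2 - 1) * κ) ^ (-(1 / 2) : ℝ) *
          ∫ y, G y ∂(gaussianReal 0 (1 / (-κ)).toNNReal))) := by
  have hm2 : 0 < 1 - m ^ 2 := by nlinarith [hm.1, hm.2]
  -- Half of the quadratic coefficient is given up to absorb the error term.
  have hquad : ∀ᶠ x in 𝓝 m, f x ≤ κ / 4 * (x - m) ^ 2 := by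
    filter_upwards [hf.bound (show (0 : ℝ) < -κ / 4 by linarith)] with x hx
    rw [Real.norm_eq_abs, Real.norm_eq_abs, abs_of_nonneg (sq_nonneg (x - m))] at hx
    linarith [(abs_le.1 hx).2]
  have hin : ∀ᶠ x in 𝓝 m, (1 - m ^ 2) / 2 ≤ 1 - x ^ 2 := by
    have : ContinuousAt (fun x : ℝ => 1 - x ^ 2) m := by fun_prop
    filter_upwards [this.eventually (lt_mem_nhds (show (1 - m ^ 2) / 2 < 1 - m ^ 2 by linarith))]
      with x hx using hx.le
  obtain ⟨ε₀, hε₀, hball⟩ := Metric.eventually_nhds_iff.1 (hquad.and hin)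
  filter_upwards [Ioo_mem_nhdsGT hε₀] with ε hε φ G C hφ hG
  have hC : 0 ≤ C := by
    have := (abs_nonneg _).trans (hφ 0 m ⟨hm.1.le, hm.2.le⟩)
    simpa using this
  rw [← integral_gaussianReal_inv hκ hm]
  set F : ℕ → ℕ → ℝ := fun N k =>
    (N.choose k : ℝ) / 2 ^ N * Real.exp (N * entropy (gridPoint N k)) *
      (Real.exp (N * f (gridPoint N k)) *
        (if |gridPoint N k - m| < ε then φ N (gridPoint N k) else 0)) with hF
  -- The affine map is the index `k = N (1 + x) / 2` evaluated at `x = m + y / √N`.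
  set J : ℕ → ℝ → ℝ := fun N y => Real.sqrt N / 2 *
    stepFun (N + 1) (F N) (N * (1 + m) / 2 + Real.sqrt N / 2 * y) with hJ
  have hsum : ∀ᶠ N : ℕ in atTop,
      ∫ y, J N y = entropySum f N (fun x => if |x - m| < ε then φ N x else 0) := by
    filter_upwards [eventually_gt_atTop 0] with N hN
    have : 0 < Real.sqrt N / 2 := half_pos (Real.sqrt_pos.2 (by exact_mod_cast hN))
    exact (sum_eq_integral_stepFun (N + 1) (F N) (N * (1 + m) / 2) this).symm
  refine Tendsto.congr' hsum ?_
  -- the grid point associated with `y`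
  set k : ℕ → ℝ → ℕ := fun N y => ⌊N * (1 + m) / 2 + Real.sqrt N / 2 * y⌋₊ with hk
  have hdist : ∀ N : ℕ, N ≠ 0 → ∀ y, 0 ≤ N * (1 + m) / 2 + Real.sqrt N / 2 * y →
      |Real.sqrt N * (gridPoint N (k N y) - m) - y| ≤ 2 / Real.sqrt N := by
    intro N hN y hu
    have hN' : (0 : ℝ) < N := by exact_mod_cast Nat.pos_of_ne_zero hN
    have hs : 0 < Real.sqrt N := Real.sqrt_pos.2 hN'
    have hss : Real.sqrt N * Real.sqrt N = N := Real.mul_self_sqrt hN'.le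
    have h1 := Nat.floor_le hu
    have h2 := Nat.lt_floor_add_one (N * (1 + m) / 2 + Real.sqrt N / 2 * y)
    have h3 : Real.sqrt N * (gridPoint N (k N y) - m) - y =
        (2 * (k N y - (N * (1 + m) / 2 + Real.sqrt N / 2 * y))) / Real.sqrt N := by
      rw [eq_div_iff hs.ne']
      unfold gridPoint
      have : (2 * (k N y : ℝ) - N) / N = (2 * (k N y : ℝ) - N) / (Real.sqrt N * Real.sqrt N) := by
        rw [hss]
      rw [this]
      field_simp
      rw [pow_two, hss]; ring
    rw [h3, abs_div, abs_of_pos hs]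
    refine div_le_div_of_nonneg_right ?_ hs.le
    rw [abs_le]
    simp only [hk]
    constructor <;> linarith
  set Cb : ℝ := Stirling.stirlingSeq 1 * Real.sqrt (2 / ((1 - m ^ 2) / 2)) with hCb
  have hCb0 : 0 ≤ Cb := mul_nonneg
    ((Real.sqrt_nonneg _).trans (Stirling.sqrt_pi_le_stirlingSeq one_ne_zero)) (Real.sqrt_nonneg _)
  set c : ℝ := -κ / 4 with hc
  have hc0 : 0 < c := by rw [hc]; linarith
  set K : ℝ := 1 / 2 * Cb * C * Real.exp (4 * c + 2 * C + C ^ 2 / c) with hK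
  -- Here `z` is the rescaled grid point, which differs from `y` by at most `2` due to rounding.
  -- Then `z² ≥ y²/2 - 4`, and `C |y| ≤ C²/c + c y²/4` uses up half of the remaining decay.
  have hexpo : ∀ y z : ℝ, |z - y| ≤ 2 → -c * z ^ 2 + C * |z| ≤
      (4 * c + 2 * C + C ^ 2 / c) + -(c / 4) * y ^ 2 := by
    intro y z hz
    have h1 : |z| ≤ |y| + 2 := by
      have := abs_sub_abs_le_abs_sub z y; linarith
    have h2 : y ^ 2 / 2 - 4 ≤ z ^ 2 := by
      have := abs_le.1 hz
      nlinarith [sq_nonneg (z + (z - y)), this.1, this.2]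
    have h3 : C * |y| ≤ C ^ 2 / c + c / 4 * y ^ 2 := by
      have : 0 ≤ (C / c - |y| / 2) ^ 2 * c := by positivity
      have h4 : (C / c - |y| / 2) ^ 2 * c = C ^ 2 / c - C * |y| + c / 4 * y ^ 2 := by
        have := sq_abs y
        field_simp
        nlinarith
      linarith
    have h4 : C * |z| ≤ C * (|y| + 2) := mul_le_mul_of_nonneg_left h1 hC
    nlinarith
  refine tendsto_integral_filter_of_dominated_convergence
    (fun y => K * Real.exp (-(c / 4) * y ^ 2)) ?_ ?_ ?_ ?_
  · refine Eventually.of_forall fun N => ?_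
    refine Measurable.aestronglyMeasurable ?_
    exact ((measurable_stepFun _ _).comp (by fun_prop)).const_mul _
  · filter_upwards [eventually_ge_atTop 1] with N hN1
    refine Eventually.of_forall fun y => ?_
    have hN0 : N ≠ 0 := by omega
    have hN' : (1 : ℝ) ≤ N := by exact_mod_cast hN1
    have hs1 : 1 ≤ Real.sqrt N := Real.one_le_sqrt.2 hN'
    have hss : Real.sqrt N * Real.sqrt N = N := Real.mul_self_sqrt (by linarith)
    have hK0 : 0 ≤ K * Real.exp (-(c / 4) * y ^ 2) := by positivity
    simp only [hJ]
    rw [stepFun_eq]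
    split_ifs with hu
    · simp only [hF]
      change ‖Real.sqrt N / 2 * ((N.choose (k N y) : ℝ) / 2 ^ N *
        Real.exp (N * entropy (gridPoint N (k N y))) * (Real.exp (N * f (gridPoint N (k N y))) *
        (if |gridPoint N (k N y) - m| < ε then φ N (gridPoint N (k N y)) else 0)))‖ ≤ _
      split_ifs with hx
      · have hkN : k N y ≤ N := Nat.lt_succ_iff.1 hu.2
        obtain ⟨hq, hi⟩ := hball (y := gridPoint N (k N y))
          (by rw [Real.dist_eq]; exact hx.trans hε.2)
        have h0 : k N y ≠ 0 := by
          intro h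
          have := one_add_gridPoint hN0 (k N y)
          rw [h] at this hi
          have h' : gridPoint N 0 = -1 := by simp at this; linarith
          rw [h'] at hi; linarith
        have hlt : k N y < N := by
          refine lt_of_le_of_ne hkN fun h => ?_
          have := one_sub_gridPoint hN0 (k N y)
          rw [h] at this hi
          have h' : gridPoint N N = 1 := by simp at this; linarith
          rw [h'] at hi; linarith
        have hB := sqrt_mul_choose_mul_exp_entropy_le (δ := (1 - m ^ 2) / 2) (by linarith) h0 hlt hi
        rw [← hCb] at hB
        have hd := (hdist N hN0 y hu.1).trans (div_le_self (by norm_num) hs1)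
        set x := gridPoint N (k N y) with hxdef
        set z := Real.sqrt N * (x - m) with hz
        have hzsq : (N : ℝ) * f x ≤ -c * z ^ 2 := by
          have h1 : z ^ 2 = N * (x - m) ^ 2 := by rw [hz, mul_pow, pow_two, hss]
          rw [h1, hc]
          have := mul_le_mul_of_nonneg_left hq (by linarith : (0 : ℝ) ≤ N)
          linarith
        have hφx := hφ N x (gridPoint_mem_Icc hkN)
        have hzabs : Real.sqrt N * |x - m| = |z| := by
          rw [hz, abs_mul, abs_of_nonneg (Real.sqrt_nonneg _)]
        rw [hzabs] at hφx
        have hB0 : 0 ≤ Real.sqrt N * ((N.choose (k N y) : ℝ) / 2 ^ N *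
            Real.exp (N * entropy x)) := by positivity
        calc _ = 1 / 2 * (Real.sqrt N * ((N.choose (k N y) : ℝ) / 2 ^ N *
                Real.exp (N * entropy x))) * (Real.exp (N * f x) * |φ N x|) := by
              rw [Real.norm_eq_abs, show Real.sqrt N / 2 * ((N.choose (k N y) : ℝ) / 2 ^ N *
                Real.exp (N * entropy x) * (Real.exp (N * f x) * φ N x)) = 1 / 2 * (Real.sqrt N *
                ((N.choose (k N y) : ℝ) / 2 ^ N * Real.exp (N * entropy x))) *
                Real.exp (N * f x) * φ N x by ring, abs_mul, abs_of_nonneg (by positivity)]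
              ring
          _ ≤ 1 / 2 * Cb * (Real.exp (-c * z ^ 2) * (C * Real.exp (C * |z|))) := by
              gcongr
          _ = 1 / 2 * Cb * C * Real.exp (-c * z ^ 2 + C * |z|) := by
              rw [Real.exp_add]; ring
          _ ≤ 1 / 2 * Cb * C * Real.exp ((4 * c + 2 * C + C ^ 2 / c) + -(c / 4) * y ^ 2) := by
              exact mul_le_mul_of_nonneg_left (Real.exp_le_exp.2 (hexpo y z hd)) (by positivity)
          _ = K * Real.exp (-(c / 4) * y ^ 2) := by
              rw [Real.exp_add, hK]; ring
      · simpa using hK0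
    · simpa using hK0
  · exact (integrable_exp_neg_mul_sq (by linarith)).const_mul _
  · filter_upwards [hG] with y hy
    have hNat : Tendsto (fun N : ℕ => (N : ℝ)) atTop atTop := tendsto_natCast_atTop_atTop
    have hsqrt : Tendsto (fun N : ℕ => Real.sqrt N) atTop atTop :=
      Real.tendsto_sqrt_atTop.comp hNat
    have hu : ∀ᶠ N : ℕ in atTop, 0 ≤ N * (1 + m) / 2 + Real.sqrt N / 2 * y := by
      have h1 : Tendsto (fun N : ℕ => Real.sqrt N * (Real.sqrt N * ((1 + m) / 2) + y / 2)) atTop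
          atTop := hsqrt.atTop_mul_atTop₀
            (tendsto_atTop_add_const_right _ _ (hsqrt.atTop_mul_const (by linarith [hm.1])))
      filter_upwards [h1.eventually_ge_atTop 0] with N hN
      have hss : Real.sqrt N * Real.sqrt N = N := Real.mul_self_sqrt (Nat.cast_nonneg N)
      calc (0 : ℝ) ≤ _ := hN
        _ = (Real.sqrt N * Real.sqrt N) * ((1 + m) / 2) + Real.sqrt N * (y / 2) := by ring
        _ = _ := by rw [hss]; ring
    set z : ℕ → ℝ := fun N => Real.sqrt N * (gridPoint N (k N y) - m) with hz
    have hzy : Tendsto z atTop (𝓝 y) := by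
      rw [tendsto_iff_norm_sub_tendsto_zero]
      refine squeeze_zero' (Eventually.of_forall fun N => norm_nonneg _) ?_
        (tendsto_const_nhds.div_atTop hsqrt : Tendsto (fun N : ℕ => 2 / Real.sqrt N) atTop (𝓝 0))
      filter_upwards [hu, eventually_ne_atTop 0] with N h1 h2
      exact hdist N h2 y h1
    have hxz : ∀ᶠ N in atTop, gridPoint N (k N y) = m + z N / Real.sqrt N := by
      filter_upwards [eventually_gt_atTop 0] with N hN
      have : 0 < Real.sqrt N := Real.sqrt_pos.2 (by exact_mod_cast hN)
      simp only [hz]; field_simp; ring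
    have hxm : Tendsto (fun N => gridPoint N (k N y)) atTop (𝓝 m) := by
      have h1 : Tendsto (fun N => m + z N / Real.sqrt N) atTop (𝓝 (m + 0)) :=
        (hzy.div_atTop hsqrt).const_add m
      rw [add_zero] at h1
      exact h1.congr' (hxz.mono fun N h => h.symm)
    obtain ⟨hk1, hB⟩ := tendsto_sqrt_mul_choose hm hxm
    have hexpf : Tendsto (fun N : ℕ => (N : ℝ) * f (gridPoint N (k N y))) atTop
        (𝓝 (κ / 2 * y ^ 2)) := by
      have h1 := hf.comp_tendsto hxm
      have h2 := (Asymptotics.isBigO_refl (fun N : ℕ => (N : ℝ)) atTop).mul_isLittleO h1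
      have h3 : ∀ N : ℕ, (N : ℝ) * (gridPoint N (k N y) - m) ^ 2 = z N ^ 2 := by
        intro N
        simp only [hz]
        rw [mul_pow, Real.sq_sqrt (Nat.cast_nonneg N)]
      have h4 : Tendsto (fun N : ℕ => (N : ℝ) * (f (gridPoint N (k N y)) -
          κ / 2 * (gridPoint N (k N y) - m) ^ 2)) atTop (𝓝 0) := by
        have h5 : Asymptotics.IsBigO atTop (fun N : ℕ => (N : ℝ) *
            ((fun x => (x - m) ^ 2) ∘ fun N => gridPoint N (k N y)) N) (fun _ => (1 : ℝ)) := by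
          simp only [Function.comp_apply, h3]
          exact (hzy.pow 2).isBigO_one ℝ
        exact (Asymptotics.isLittleO_one_iff ℝ).1 (h2.trans_isBigO h5)
      have h5 := h4.add ((hzy.pow 2).const_mul (κ / 2))
      rw [zero_add] at h5
      refine h5.congr fun N => ?_
      rw [← h3]; ring
    have hφz : Tendsto (fun N => φ N (gridPoint N (k N y))) atTop (𝓝 (G y)) :=
      (hy z hzy).congr' (hxz.mono fun N h => by simp only [h])
    have hlim := ((hB.const_mul (1 / 2)).mul
      (((Real.continuous_exp.tendsto _).comp hexpf).mul hφz))
    refine hlim.congr' ?_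
    filter_upwards [hu, hk1, hxm.eventually (Metric.ball_mem_nhds m hε.1)] with N h1 h2 h3
    simp only [hJ]
    rw [stepFun_eq, if_pos ⟨h1, by change k N y < N + 1; omega⟩]
    simp only [hF]
    change _ = Real.sqrt N / 2 * ((N.choose (k N y) : ℝ) / 2 ^ N *
        Real.exp (N * entropy (gridPoint N (k N y))) * (Real.exp (N * f (gridPoint N (k N y))) *
        (if |gridPoint N (k N y) - m| < ε then φ N (gridPoint N (k N y)) else 0)))
    rw [if_pos (by simpa [Real.dist_eq] using h3)]
    simp only [Function.comp_apply]
    ring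

/-- There are `N + 1` terms, each at most `C exp (C √N - δ N)`; completing the square gives `C √N ≤
C² / (2δ) + δ N / 2`, so exponential decay in `N` survives. -/
theorem tendsto_far_entropySum {f : ℝ → ℝ} {S : Set ℝ} {δ C : ℝ} (hδ : 0 < δ)
    (hf : ∀ x ∈ Icc (-1 : ℝ) 1, x ∈ S → f x ≤ -δ) {φ : ℕ → ℝ → ℝ}
    (hφS : ∀ N x, x ∉ S → φ N x = 0)
    (hφ : ∀ N, ∀ x ∈ Icc (-1 : ℝ) 1, |φ N x| ≤ C * Real.exp (C * Real.sqrt N)) :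
    Tendsto (fun N => entropySum f N (φ N)) atTop (𝓝 0) := by
  have hC : 0 ≤ C := by simpa using (abs_nonneg _).trans (hφ 0 0 (by simp))
  have hlim : Tendsto (fun N : ℕ => C * Real.exp (C ^ 2 / (2 * δ)) *
      (((N : ℝ) + 1) * Real.exp (-(δ / 2) * N))) atTop (𝓝 0) := by
    have hNat : Tendsto (fun N : ℕ => (N : ℝ)) atTop atTop := tendsto_natCast_atTop_atTop
    have h1 : Tendsto (fun x : ℝ => x * Real.exp (-(δ / 2) * x)) atTop (𝓝 0) := by
      have := tendsto_rpow_mul_exp_neg_mul_atTop_nhds_zero 1 (δ / 2) (half_pos hδ)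
      simpa using this
    have h2 : Tendsto (fun x : ℝ => Real.exp (-(δ / 2) * x)) atTop (𝓝 0) := by
      have := tendsto_rpow_mul_exp_neg_mul_atTop_nhds_zero 0 (δ / 2) (half_pos hδ)
      simpa using this
    have h3 := ((h1.add h2).comp hNat).const_mul (C * Real.exp (C ^ 2 / (2 * δ)))
    simp only [add_zero, mul_zero] at h3
    refine h3.congr fun N => ?_
    simp only [Function.comp_apply]; ring
  refine squeeze_zero_norm' ?_ hlim
  filter_upwards [eventually_ne_atTop 0] with N hN
  unfold entropySum
  refine (norm_sum_le _ _).trans ?_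
  have hterm : ∀ k ∈ Finset.range (N + 1), ‖(N.choose k : ℝ) / 2 ^ N *
      Real.exp (N * entropy (gridPoint N k)) *
      (Real.exp (N * f (gridPoint N k)) * φ N (gridPoint N k))‖ ≤
      C * Real.exp (C ^ 2 / (2 * δ)) * Real.exp (-(δ / 2) * N) := by
    intro k hk
    have hkN : k ≤ N := Nat.lt_succ_iff.1 (Finset.mem_range.1 hk)
    have hx := gridPoint_mem_Icc hkN
    have hle := choose_mul_exp_entropy_le hN hkN
    set x := gridPoint N k
    by_cases hxS : x ∈ S
    · have h0 : 0 ≤ (N.choose k : ℝ) / 2 ^ N * Real.exp (N * entropy x) := by positivity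
      have hsq : Real.sqrt N ^ 2 = N := Real.sq_sqrt (Nat.cast_nonneg N)
      have h4 : C * Real.sqrt N ≤ C ^ 2 / (2 * δ) + δ / 2 * N := by
        have h5 : 0 ≤ (C / δ - Real.sqrt N) ^ 2 * (δ / 2) := by positivity
        have h6 : (C / δ - Real.sqrt N) ^ 2 * (δ / 2) =
            C ^ 2 / (2 * δ) - C * Real.sqrt N + δ / 2 * Real.sqrt N ^ 2 := by field_simp; ring
        rw [h6, hsq] at h5; linarith
      rw [norm_mul, Real.norm_of_nonneg h0, norm_mul, Real.norm_of_nonneg (Real.exp_pos _).le,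
        Real.norm_eq_abs]
      calc _ ≤ 1 * (Real.exp (N * (-δ)) * (C * Real.exp (C * Real.sqrt N))) := by
            gcongr
            · exact hf x hx hxS
            · exact hφ N x hx
        _ = C * Real.exp (N * (-δ) + C * Real.sqrt N) := by rw [Real.exp_add]; ring
        _ ≤ C * Real.exp (C ^ 2 / (2 * δ) + -(δ / 2) * N) := by
            refine mul_le_mul_of_nonneg_left (Real.exp_le_exp.2 ?_) hC
            linarith
        _ = _ := by rw [Real.exp_add]; ring
    · rw [hφS N x hxS]
      simp only [mul_zero, norm_zero]
      positivity
  refine (Finset.sum_le_card_nsmul _ _ _ hterm).trans_eq ?_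
  rw [Finset.card_range, nsmul_eq_mul]
  push_cast; ring

theorem entropySum_add (f : ℝ → ℝ) (N : ℕ) (φ ψ : ℝ → ℝ) :
    entropySum f N (fun x => φ x + ψ x) = entropySum f N φ + entropySum f N ψ := by
  unfold entropySum
  rw [← Finset.sum_add_distrib]
  exact Finset.sum_congr rfl fun k _ => by ring

theorem entropySum_sum {ι : Type*} (f : ℝ → ℝ) (N : ℕ) (s : Finset ι) (φ : ι → ℝ → ℝ) :
    entropySum f N (fun x => ∑ i ∈ s, φ i x) = ∑ i ∈ s, entropySum f N (φ i) := by
  unfold entropySum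
  rw [Finset.sum_comm]
  exact Finset.sum_congr rfl fun k _ => by simp only [Finset.mul_sum]

/-- Laplace's method with finitely many nondegenerate maximizers of `f`, where the test functions
`φ N` have the limit `G m` on the scale `1 / √N` around the maximizer `m`. -/
theorem tendsto_entropySum {f κ : ℝ → ℝ} (hfc : Continuous f) (ms : Finset ℝ)
    (hne : ms.Nonempty) (hm : ∀ m ∈ ms, m ∈ Ioo (-1 : ℝ) 1) (hκ : ∀ m ∈ ms, κ m < 0)
    (hf : ∀ m ∈ ms, (fun x => f x - κ m / 2 * (x - m) ^ 2) =o[𝓝 m] fun x => (x - m) ^ 2)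
    (hneg : ∀ x ∈ Icc (-1 : ℝ) 1, x ∉ ms → f x < 0)
    (φ : ℕ → ℝ → ℝ) (G : ℝ → ℝ → ℝ)
    (hφ : ∀ m ∈ ms, ∃ C : ℝ, ∀ N, ∀ x ∈ Icc (-1 : ℝ) 1,
      |φ N x| ≤ C * Real.exp (C * (Real.sqrt N * |x - m|)))
    (hG : ∀ m ∈ ms, ∀ᵐ y, ∀ u : ℕ → ℝ, Tendsto u atTop (𝓝 y) →
        Tendsto (fun N => φ N (m + u N / Real.sqrt N)) atTop (𝓝 (G m y))) :
    Tendsto (fun N => entropySum f N (φ N)) atTop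
      (𝓝 (∑ m ∈ ms, ((m ^ 2 - 1) * κ m) ^ (-(1 / 2) : ℝ) *
          ∫ y, G m y ∂(gaussianReal 0 (1 / (-κ m)).toNNReal))) := by
  have hloc := (Finset.eventually_all ms).2 fun m h =>
    tendsto_local_entropySum (hm m h) (hκ m h) (hf m h)
  have hsep : ∀ᶠ ε in 𝓝[>] (0 : ℝ), ∀ m ∈ ms, ∀ m' ∈ ms, m ≠ m' → 2 * ε < |m - m'| := by
    refine (Finset.eventually_all ms).2 fun m _ => (Finset.eventually_all ms).2 fun m' _ => ?_
    by_cases h : m = m'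
    · exact Eventually.of_forall fun ε h' => absurd h h'
    · have hpos : 0 < |m - m'| / 2 := half_pos (abs_pos.2 (sub_ne_zero.2 h))
      filter_upwards [Ioo_mem_nhdsGT hpos] with ε hε _
      linarith [hε.2]
  -- One `ε` for which all local limits hold and the windows are disjoint. On the rest of `[-1, 1]`,
  -- compactness yields a uniform gap below `0`.
  obtain ⟨ε, hε, hεloc, hεsep⟩ := (eventually_mem_nhdsWithin.and (hloc.and hsep)).exists
  replace hε : 0 < ε := hε
  set S : Set ℝ := {x | ∀ m ∈ ms, ε ≤ |x - m|} with hS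
  have hScl : IsClosed S := by
    have : S = ⋂ m ∈ ms, {x | ε ≤ |x - m|} := by ext x; simp [hS]
    rw [this]
    exact isClosed_biInter fun m _ => isClosed_le continuous_const (by fun_prop)
  have hgap : ∃ δ > 0, ∀ x ∈ Icc (-1 : ℝ) 1, x ∈ S → f x ≤ -δ := by
    rcases (Icc (-1 : ℝ) 1 ∩ S).eq_empty_or_nonempty with h | h
    · refine ⟨1, one_pos, fun x hx hxS => ?_⟩
      exact absurd (show x ∈ Icc (-1 : ℝ) 1 ∩ S from ⟨hx, hxS⟩) (by simp [h])
    · obtain ⟨x₀, hx₀, hmax⟩ := (isCompact_Icc.inter_right hScl).exists_isMaxOn h hfc.continuousOn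
      have hx₀ms : x₀ ∉ ms := fun hx => by
        have := hx₀.2 x₀ hx
        simp at this; linarith
      refine ⟨-f x₀, by linarith [hneg x₀ hx₀.1 hx₀ms], fun x hx hxS => ?_⟩
      rw [neg_neg]
      exact hmax ⟨hx, hxS⟩
  obtain ⟨δ, hδ, hfS⟩ := hgap
  classical
  have hsplit : ∀ N, entropySum f N (φ N) =
      ∑ m ∈ ms, entropySum f N (fun x => if |x - m| < ε then φ N x else 0) +
        entropySum f N (fun x => if x ∈ S then φ N x else 0) := by
    intro N
    rw [← entropySum_sum, ← entropySum_add]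
    congr 1
    funext x
    by_cases hx : x ∈ S
    · rw [if_pos hx, Finset.sum_eq_zero, zero_add]
      intro m h
      rw [if_neg (not_lt.2 (hx m h))]
    · rw [if_neg hx, add_zero]
      simp only [hS, mem_ofPred_eq, not_forall, not_le] at hx
      obtain ⟨m, h, hlt⟩ := hx
      rw [Finset.sum_eq_single_of_mem m h, if_pos hlt]
      intro m' h' hmm
      rw [if_neg]
      intro hlt'
      have h1 := hεsep m' h' m h hmm
      have h2 := abs_sub_le m' x m
      rw [abs_sub_comm m' x] at h2
      linarith
  simp_rw [hsplit]
  rw [← add_zero (∑ m ∈ ms, _)]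
  refine (tendsto_finsetSum _ fun m h => ?_).add ?_
  · obtain ⟨C, hC⟩ := hφ m h
    exact hεloc m h φ (G m) C hC (hG m h)
  obtain ⟨m₀, h₀⟩ := hne
  obtain ⟨C, hφC⟩ := hφ m₀ h₀
  have hC : 0 ≤ C := by
    simpa using (abs_nonneg _).trans (hφC 0 m₀ ⟨(hm m₀ h₀).1.le, (hm m₀ h₀).2.le⟩)
  refine tendsto_far_entropySum (S := S) (C := 2 * C) hδ hfS (fun N x hx => if_neg hx) ?_
  intro N x hx
  have h1 : |x - m₀| ≤ 2 := by
    rw [abs_le]; constructor <;> linarith [hx.1, hx.2, (hm m₀ h₀).1, (hm m₀ h₀).2]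
  have h2 : C * (Real.sqrt N * |x - m₀|) ≤ 2 * C * Real.sqrt N := by
    have := mul_le_mul_of_nonneg_left h1 (mul_nonneg hC (Real.sqrt_nonneg N))
    linarith
  have h3 : C * Real.exp (C * (Real.sqrt N * |x - m₀|)) ≤
      2 * C * Real.exp (2 * C * Real.sqrt N) := by
    have := Real.exp_le_exp.2 h2
    have h4 := Real.exp_pos (2 * C * Real.sqrt N)
    nlinarith
  split_ifs
  · exact (hφC N x hx).trans h3
  · rw [abs_zero]; positivity

/-! ### Derivatives of `H` -/

/-- The first derivative of `H` on `(-1, 1)`. -/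
def derivH (p : ℕ) (β h x : ℝ) : ℝ :=
  β * (p * x ^ (p - 1)) + h - 1 / 2 * (Real.log (1 + x) - Real.log (1 - x))

/-- The second derivative of `H` on `(-1, 1)`. -/
def derivH2 (p : ℕ) (β x : ℝ) : ℝ :=
  β * (p * ((p - 1 : ℕ) * x ^ (p - 2))) - 1 / (1 - x ^ 2)

theorem continuous_entropy : Continuous entropy := by
  unfold entropy
  have h := Real.continuous_mul_log
  have h1 : Continuous fun x : ℝ => (1 + x) * Real.log (1 + x) :=
    h.comp (continuous_const.add continuous_id)
  have h2 : Continuous fun x : ℝ => (1 - x) * Real.log (1 - x) :=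
    h.comp (continuous_const.sub continuous_id)
  exact continuous_const.mul (h1.add h2)

theorem continuous_H (p : ℕ) (β h : ℝ) : Continuous (H p β h) := by
  unfold H
  have := continuous_entropy
  fun_prop

theorem entropy_neg (x : ℝ) : entropy (-x) = entropy x := by
  unfold entropy; rw [sub_neg_eq_add, ← sub_eq_add_neg]; ring

theorem entropy_zero : entropy 0 = 0 := by simp [entropy]

theorem entropy_one : entropy 1 = Real.log 2 := by
  unfold entropy; norm_num; ring

theorem entropy_nonneg {x : ℝ} (hx : x ∈ Icc (-1 : ℝ) 1) : 0 ≤ entropy x := by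
  have key : ∀ t : ℝ, 0 ≤ t → t - 1 ≤ t * Real.log t := by
    intro t ht
    rcases ht.eq_or_lt with rfl | ht
    · simp
    · have h1 := mul_le_mul_of_nonneg_left (Real.one_sub_inv_le_log_of_pos ht) ht.le
      rwa [mul_sub, mul_inv_cancel₀ ht.ne', mul_one] at h1
  unfold entropy
  have h1 := key (1 + x) (by linarith [hx.1])
  have h2 := key (1 - x) (by linarith [hx.2])
  linarith

theorem hasDerivAt_entropy {x : ℝ} (hx : x ∈ Ioo (-1 : ℝ) 1) :
    HasDerivAt entropy (1 / 2 * (Real.log (1 + x) - Real.log (1 - x))) x := by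
  have h1 : (1 + x) ≠ 0 := by linarith [hx.1]
  have h2 : (1 - x) ≠ 0 := by linarith [hx.2]
  have d1 := (Real.hasDerivAt_mul_log h1).comp x ((hasDerivAt_id x).const_add 1)
  have d2 := (Real.hasDerivAt_mul_log h2).comp x ((hasDerivAt_id x).const_sub 1)
  exact ((d1.add d2).const_mul (1 / 2)).congr_deriv (by ring)

theorem hasDerivAt_H (p : ℕ) (β h : ℝ) {x : ℝ} (hx : x ∈ Ioo (-1 : ℝ) 1) :
    HasDerivAt (H p β h) (derivH p β h x) x := by
  have d1 := ((hasDerivAt_pow p x).const_mul β).add ((hasDerivAt_id x).const_mul h)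
  exact (d1.sub (hasDerivAt_entropy hx)).congr_deriv (by simp [derivH])

theorem hasDerivAt_derivH (p : ℕ) (β h : ℝ) {x : ℝ} (hx : x ∈ Ioo (-1 : ℝ) 1) :
    HasDerivAt (derivH p β h) (derivH2 p β x) x := by
  have h1 : (1 + x) ≠ 0 := by linarith [hx.1]
  have h2 : (1 - x) ≠ 0 := by linarith [hx.2]
  have d0 := (((hasDerivAt_pow (p - 1) x).const_mul (p : ℝ)).const_mul β).add_const h
  have d1 := (Real.hasDerivAt_log h1).comp x ((hasDerivAt_id x).const_add 1)
  have d2 := (Real.hasDerivAt_log h2).comp x ((hasDerivAt_id x).const_sub 1)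
  refine (d0.sub ((d1.sub d2).const_mul (1 / 2))).congr_deriv ?_
  unfold derivH2
  have h3 : 1 - x ^ 2 = (1 + x) * (1 - x) := by ring
  rw [h3, show p - 1 - 1 = p - 2 by omega]
  field_simp
  ring

theorem H2_eq_derivH2 (p : ℕ) (β h : ℝ) {x : ℝ} (hx : x ∈ Ioo (-1 : ℝ) 1) :
    H2 p β h x = derivH2 p β x := by
  unfold H2
  rw [show (2 : ℕ) = 1 + 1 from rfl, iteratedDeriv_succ, iteratedDeriv_one]
  have : deriv (H p β h) =ᶠ[𝓝 x] derivH p β h := by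
    filter_upwards [isOpen_Ioo.mem_nhds hx] with y hy using (hasDerivAt_H p β h hy).deriv
  rw [this.deriv_eq, (hasDerivAt_derivH p β h hx).deriv]

/-- The second order expansion of `H` at a critical point. -/
theorem H_sub_isLittleO (p : ℕ) (β h : ℝ) {m : ℝ} (hm : m ∈ Ioo (-1 : ℝ) 1)
    (h0 : derivH p β h m = 0) :
    (fun x => H p β h x - H p β h m - derivH2 p β m / 2 * (x - m) ^ 2) =o[𝓝 m]
      fun x => (x - m) ^ 2 := by
  set κ := derivH2 p β m
  have hd : ∀ x ∈ Ioo (-1 : ℝ) 1, HasDerivWithinAt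
      (fun x => H p β h x - κ / 2 * (x - m) ^ 2) (derivH p β h x - κ * (x - m)) (Ioo (-1) 1) x := by
    intro x hx
    have h1 := (((hasDerivAt_id x).sub_const m).pow 2).const_mul (κ / 2)
    refine ((hasDerivAt_H p β h hx).sub h1).hasDerivWithinAt.congr_deriv ?_
    simp; ring
  -- This is differentiability of `H'` at `m`; passing to the primitive raises the exponent by one.
  have ho : (fun x => derivH p β h x - κ * (x - m)) =o[𝓝[Ioo (-1) 1] m] fun x => (x - m) ^ 1 := by
    have := (hasDerivAt_iff_isLittleO.1 (hasDerivAt_derivH p β h hm)).mono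
      (nhdsWithin_le_nhds (s := Ioo (-1 : ℝ) 1))
    simpa [h0, mul_comm] using this
  have := (convex_Ioo (-1 : ℝ) 1).isLittleO_pow_succ_real hm hd ho
  rw [isOpen_Ioo.nhdsWithin_eq hm] at this
  refine this.congr_left fun x => ?_
  simp; ring

/-! ### Maximizers of `H` -/

theorem H_neg (p : ℕ) (β h x : ℝ) : H p β h (-x) = H p ((-1) ^ p * β) (-h) x := by
  unfold H; rw [entropy_neg, neg_pow]; ring

theorem neg_mem_maximizers {p : ℕ} {β h m : ℝ} (hm : m ∈ maximizers p β h) :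
    -m ∈ maximizers p ((-1) ^ p * β) (-h) := by
  refine ⟨⟨by linarith [hm.1.2], by linarith [hm.1.1]⟩, fun x hx => ?_⟩
  have := hm.2 (show -x ∈ Icc (-1 : ℝ) 1 from ⟨by linarith [hx.2], by linarith [hx.1]⟩)
  simp only [mem_ofPred_eq] at this ⊢
  rw [← H_neg, ← H_neg, neg_neg]
  exact this

/-- The entropy has infinite slope at `1`, so `H` is strictly decreasing just before it. -/
theorem maximizer_ne_one {p : ℕ} {β h m : ℝ} (hm : m ∈ maximizers p β h) : m ≠ 1 := by
  rintro rfl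
  -- `B` bounds the polynomial part of `H'`. Beyond `x₀` the logarithm contributes less than `-(2B +
  -- 1) / 2`, so `H' < 0`.
  set B := |β| * p + |h| with hB
  have hB0 : 0 ≤ B := by positivity
  set x₀ := 1 - Real.exp (-(2 * B + 1)) with hx₀
  have h1 : Real.exp (-(2 * B + 1)) < 1 := by
    rw [Real.exp_lt_one_iff]; linarith
  have h2 := Real.exp_pos (-(2 * B + 1))
  have hanti : StrictAntiOn (H p β h) (Icc x₀ 1) := by
    refine strictAntiOn_of_deriv_neg (convex_Icc _ _) (continuous_H p β h).continuousOn ?_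
    intro x hx
    rw [interior_Icc] at hx
    have hx0 : 0 < x := by linarith [hx.1]
    rw [(hasDerivAt_H p β h ⟨by linarith, hx.2⟩).deriv]
    unfold derivH
    have h3 : Real.log (1 - x) < -(2 * B + 1) := by
      rw [Real.log_lt_iff_lt_exp (by linarith [hx.2])]; linarith [hx.1]
    have h4 : 0 ≤ Real.log (1 + x) := Real.log_nonneg (by linarith)
    have h5 : β * (p * x ^ (p - 1)) ≤ |β| * p := by
      have h6 : x ^ (p - 1) ≤ 1 := pow_le_one₀ hx0.le hx.2.le
      have h7 : (p : ℝ) * x ^ (p - 1) ≤ p := mul_le_of_le_one_right (Nat.cast_nonneg p) h6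
      calc _ ≤ |β| * (p * x ^ (p - 1)) :=
            mul_le_mul_of_nonneg_right (le_abs_self β) (by positivity)
        _ ≤ _ := mul_le_mul_of_nonneg_left h7 (abs_nonneg β)
    linarith [le_abs_self h]
  have h3 := hanti (left_mem_Icc.2 (by linarith)) (right_mem_Icc.2 (by linarith))
    (by linarith : x₀ < 1)
  have h4 := hm.2 (show x₀ ∈ Icc (-1 : ℝ) 1 from ⟨by linarith, by linarith⟩)
  exact absurd h3 (not_lt.2 h4)

theorem maximizers_subset_Ioo {p : ℕ} {β h m : ℝ} (hm : m ∈ maximizers p β h) :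
    m ∈ Ioo (-1 : ℝ) 1 := by
  refine ⟨lt_of_le_of_ne hm.1.1 fun h => ?_, lt_of_le_of_ne hm.1.2 (maximizer_ne_one hm)⟩
  exact maximizer_ne_one (neg_mem_maximizers hm) (by rw [← h, neg_neg])

theorem derivH_eq_zero {p : ℕ} {β h m : ℝ} (hm : m ∈ maximizers p β h) : derivH p β h m = 0 := by
  have hI := maximizers_subset_Ioo hm
  exact (hm.2.isLocalMax (Icc_mem_nhds hI.1 hI.2)).hasDerivAt_eq_zero (hasDerivAt_H p β h hI)

theorem derivH2_nonpos {p : ℕ} {β h m : ℝ} (hm : m ∈ maximizers p β h) : derivH2 p β m ≤ 0 := by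
  by_contra! hpos
  have hI := maximizers_subset_Ioo hm
  have h1 := (H_sub_isLittleO p β h hI (derivH_eq_zero hm)).bound
    (show 0 < derivH2 p β m / 4 by linarith)
  have h2 : ∀ᶠ x in 𝓝[>] m, H p β h m < H p β h x := by
    filter_upwards [nhdsWithin_le_nhds h1, self_mem_nhdsWithin] with x hx hxm
    have hxm' : 0 < x - m := sub_pos.2 hxm
    rw [Real.norm_eq_abs, Real.norm_eq_abs, abs_of_nonneg (sq_nonneg (x - m))] at hx
    have h3 := (abs_le.1 hx).1
    have h4 : 0 < derivH2 p β m * (x - m) ^ 2 := by positivity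
    linarith
  have h3 : ∀ᶠ x in 𝓝[>] m, H p β h x ≤ H p β h m :=
    nhdsWithin_le_nhds (hm.2.isLocalMax (Icc_mem_nhds hI.1 hI.2))
  obtain ⟨x, hx1, hx2⟩ := (h2.and h3).exists
  linarith

theorem exists_derivH_eq_zero {p : ℕ} {β h a b : ℝ} (ha : a ∈ maximizers p β h)
    (hb : b ∈ maximizers p β h) (hab : a < b) : ∃ ξ ∈ Ioo a b, derivH p β h ξ = 0 := by
  have h1 := maximizers_subset_Ioo ha
  have h2 := maximizers_subset_Ioo hb
  exact exists_hasDerivAt_eq_zero hab (continuous_H p β h).continuousOn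
    (le_antisymm (hb.2 ha.1) (ha.2 hb.1))
    fun x hx => hasDerivAt_H p β h ⟨h1.1.trans hx.1, hx.2.trans h2.2⟩

theorem exists_derivH2_eq_zero {p : ℕ} {β h a b : ℝ} (ha : -1 < a) (hb : b < 1) (hab : a < b)
    (h1 : derivH p β h a = 0) (h2 : derivH p β h b = 0) : ∃ ξ ∈ Ioo a b, derivH2 p β ξ = 0 := by
  refine exists_hasDerivAt_eq_zero hab (fun x hx => ?_) (h1.trans h2.symm)
    fun x hx => hasDerivAt_derivH p β h ⟨ha.trans hx.1, hx.2.trans hb⟩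
  exact (hasDerivAt_derivH p β h
    ⟨ha.trans_le hx.1, hx.2.trans_lt hb⟩).continuousAt.continuousWithinAt

/-- The second derivative of `H` has at most two zeros in `(0, 1)`. -/
theorem derivH2_zeros {p : ℕ} (hp : 3 ≤ p) {β a b c : ℝ} (ha : 0 < a) (hab : a < b) (hbc : b < c)
    (hc : c < 1) (h1 : derivH2 p β a = 0) (h2 : derivH2 p β b = 0) (h3 : derivH2 p β c = 0) :
    False := by
  obtain ⟨n, rfl⟩ := Nat.exists_eq_add_of_le' hp
  set A : ℝ := β * ((n + 3 : ℕ) * (n + 2 : ℕ)) with hA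
  -- Multiplying by `1 - x²` turns `H'' = 0` into `A * g x = 1`. Three solutions would give two
  -- positive zeros of `g'` by Rolle, but `g' = 0` forces `(n + 3) x² = n + 1`.
  set g : ℝ → ℝ := fun x => x ^ (n + 1) - x ^ (n + 3) with hg
  have hz : ∀ x, 0 < x → x < 1 → derivH2 (n + 3) β x = 0 → A * g x = 1 := by
    intro x hx0 hx1 hx
    unfold derivH2 at hx
    have h4 : 1 - x ^ 2 ≠ 0 := by nlinarith
    simp only [show n + 3 - 1 = n + 2 by omega, show n + 3 - 2 = n + 1 by omega]
      at hx
    field_simp at hx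
    simp only [hA, hg]
    linear_combination hx
  have e1 := hz a ha (by linarith) h1
  have e2 := hz b (by linarith) (by linarith) h2
  have e3 := hz c (by linarith) hc h3
  have hA0 : A ≠ 0 := by rintro h; rw [h, zero_mul] at e1; exact zero_ne_one e1
  have hgd : ∀ x, HasDerivAt g (((n + 1 : ℕ) : ℝ) * x ^ n - ((n + 3 : ℕ) : ℝ) * x ^ (n + 2)) x :=
    fun x => (hasDerivAt_pow (n + 1) x).sub (hasDerivAt_pow (n + 3) x)
  have hgc : Continuous g := by fun_prop
  obtain ⟨s, hs, hs0⟩ := exists_hasDerivAt_eq_zero hab hgc.continuousOn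
    (mul_left_cancel₀ hA0 (e1.trans e2.symm)) fun x _ => hgd x
  obtain ⟨t, ht, ht0⟩ := exists_hasDerivAt_eq_zero hbc hgc.continuousOn
    (mul_left_cancel₀ hA0 (e2.trans e3.symm)) fun x _ => hgd x
  have hsq : ∀ x, 0 < x → ((n + 1 : ℕ) : ℝ) * x ^ n - ((n + 3 : ℕ) : ℝ) * x ^ (n + 2) = 0 →
      ((n + 3 : ℕ) : ℝ) * x ^ 2 = (n + 1 : ℕ) := by
    intro x hx h
    have h4 : x ^ n ≠ 0 := by positivity
    have h5 : x ^ n * (((n + 3 : ℕ) : ℝ) * x ^ 2 - (n + 1 : ℕ)) = 0 := by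
      linear_combination -h
    rcases mul_eq_zero.1 h5 with h6 | h6
    · exact absurd h6 h4
    · linarith
  have hs1 : 0 < s := ha.trans hs.1
  have hst : s < t := hs.2.trans ht.1
  have h4 := (hsq s hs1 hs0).trans (hsq t (hs1.trans hst) ht0).symm
  have h5 : (0 : ℝ) < (n + 3 : ℕ) := by positivity
  have h6 := mul_left_cancel₀ h5.ne' h4
  nlinarith

theorem derivH2_zero {p : ℕ} (hp : 3 ≤ p) (β : ℝ) : derivH2 p β 0 = -1 := by
  unfold derivH2
  rw [zero_pow (by omega)]; norm_num

/-- For `x ≤ 0` the odd power `x ^ (p - 2)` is nonpositive, so both terms of `H''` pull in the same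
direction and `H'' < 0`. -/
theorem pos_of_derivH2_eq_zero_of_odd {p : ℕ} (hp : 3 ≤ p) (hodd : Odd p) {β x : ℝ} (hβ : 0 ≤ β)
    (hx : x ∈ Ioo (-1 : ℝ) 1) (h0 : derivH2 p β x = 0) : 0 < x := by
  by_contra! hneg
  have h1 : Odd (p - 2) := by
    obtain ⟨k, rfl⟩ := hodd
    exact ⟨k - 1, by omega⟩
  have h2 : x ^ (p - 2) ≤ 0 := h1.pow_nonpos_iff.2 hneg
  have h3 : 0 < 1 / (1 - x ^ 2) := by
    have : 0 < 1 - x ^ 2 := by nlinarith [hx.1, hx.2]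
    positivity
  have h4 : β * (p * ((p - 1 : ℕ) * x ^ (p - 2))) ≤ 0 :=
    mul_nonpos_of_nonneg_of_nonpos hβ (mul_nonpos_of_nonneg_of_nonpos (Nat.cast_nonneg p)
      (mul_nonpos_of_nonneg_of_nonpos (Nat.cast_nonneg _) h2))
  unfold derivH2 at h0
  linarith

theorem pos_of_derivH2_eq_zero {p : ℕ} (hp : 3 ≤ p) {β x : ℝ} (hx : 0 ≤ x)
    (h0 : derivH2 p β x = 0) : 0 < x := by
  refine lt_of_le_of_ne hx ?_
  rintro rfl
  rw [derivH2_zero hp] at h0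
  norm_num at h0

/-- Three critical points of `H`, beyond the first of which all zeros of `H''` are positive. -/
theorem critical_triple {p : ℕ} (hp : 3 ≤ p) {β h a ξ b : ℝ} (ha : -1 < a) (haξ : a < ξ)
    (hξb : ξ < b) (hb : b < 1) (h1 : derivH p β h a = 0) (h2 : derivH p β h ξ = 0)
    (h3 : derivH p β h b = 0)
    (hpos : ∀ x ∈ Ioo (-1 : ℝ) 1, a ≤ x → derivH2 p β x = 0 → 0 < x) :
    derivH2 p β a ≠ 0 ∧ derivH2 p β b ≠ 0 ∧ ∀ c ∈ Ioo b 1, derivH p β h c ≠ 0 := by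
  -- Rolle between the three critical points already uses up the two positive zeros that `H''` may
  -- have. A zero at `a` or at `b`, or another critical point to the right of `b`, would produce a
  -- third.
  obtain ⟨η₁, hη₁, z1⟩ := exists_derivH2_eq_zero ha (hξb.trans hb) haξ h1 h2
  obtain ⟨η₂, hη₂, z2⟩ := exists_derivH2_eq_zero (ha.trans haξ) hb hξb h2 h3
  have hη : η₁ < η₂ := hη₁.2.trans hη₂.1
  have hη₂1 : η₂ < 1 := hη₂.2.trans hb
  have hη₁0 : 0 < η₁ := hpos η₁ ⟨ha.trans hη₁.1, hη.trans hη₂1⟩ hη₁.1.le z1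
  refine ⟨fun h => ?_, fun h => ?_, fun c hc h => ?_⟩
  · exact derivH2_zeros hp (hpos a ⟨ha, by linarith⟩ le_rfl h) hη₁.1 hη hη₂1 h z1 z2
  · exact derivH2_zeros hp hη₁0 hη hη₂.2 hb z1 z2 h
  · obtain ⟨η₃, hη₃, z3⟩ :=
      exists_derivH2_eq_zero (ha.trans (haξ.trans hξb)) hc.2 hc.1 h3 h
    exact derivH2_zeros hp hη₁0 hη (hη₂.2.trans hη₃.1) (hη₃.2.trans hc.2) z1 z2 z3

/-- Two maximizers exhaust the maximizers lying in a region where zeros of `H''` are positive. -/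
theorem exists_two_maximizers {p : ℕ} (hp : 3 ≤ p) {β h : ℝ} (hcrit : IsCritical p β h)
    (hpos : ∀ m ∈ maximizers p β h, ∀ x ∈ Ioo (-1 : ℝ) 1, m ≤ x → derivH2 p β x = 0 → 0 < x) :
    ∃ m₁ m₂, m₁ < m₂ ∧ maximizers p β h = {m₁, m₂} ∧ derivH2 p β m₁ < 0 ∧ derivH2 p β m₂ < 0 := by
  obtain ⟨a, ha, b, hb, hab⟩ := hcrit.exists_lt
  have key : ∀ a ∈ maximizers p β h, ∀ b ∈ maximizers p β h, a < b →
      derivH2 p β a ≠ 0 ∧ derivH2 p β b ≠ 0 ∧ ∀ c ∈ maximizers p β h, ¬ b < c := by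
    intro a ha b hb hab
    obtain ⟨ξ, hξ, z⟩ := exists_derivH_eq_zero ha hb hab
    obtain ⟨h1, h2, h3⟩ := critical_triple hp (maximizers_subset_Ioo ha).1 hξ.1 hξ.2
      (maximizers_subset_Ioo hb).2 (derivH_eq_zero ha) z (derivH_eq_zero hb) (hpos a ha)
    exact ⟨h1, h2, fun c hc hbc => h3 c ⟨hbc, (maximizers_subset_Ioo hc).2⟩ (derivH_eq_zero hc)⟩
  obtain ⟨h1, h2, h3⟩ := key a ha b hb hab
  refine ⟨a, b, hab, ?_, lt_of_le_of_ne (derivH2_nonpos ha) h1,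
    lt_of_le_of_ne (derivH2_nonpos hb) h2⟩
  ext c
  simp only [mem_insert_iff, mem_singleton_iff]
  constructor
  · intro hc
    by_contra! hne
    rcases lt_or_gt_of_ne hne.1 with h | h
    · exact (key c hc a ha h).2.2 b hb hab
    · rcases lt_or_gt_of_ne hne.2 with h' | h'
      · exact (key a ha c hc h).2.2 b hb h'
      · exact h3 c hc h'
  · rintro (rfl | rfl) <;> assumption

/-! ### The threshold `β̃_p` -/

theorem H_at_zero {p : ℕ} (hp : p ≠ 0) (β h : ℝ) : H p β h 0 = 0 := by
  simp [H, entropy_zero, zero_pow hp]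

theorem sSup_H_eq_zero_iff {p : ℕ} (hp : p ≠ 0) (β : ℝ) :
    sSup (H p β 0 '' Icc (-1) 1) = 0 ↔ (0 : ℝ) ∈ maximizers p β 0 := by
  have hbdd : BddAbove (H p β 0 '' Icc (-1) 1) :=
    (isCompact_Icc.image (continuous_H p β 0)).bddAbove
  constructor
  · intro h
    refine ⟨by simp, fun x hx => ?_⟩
    change H p β 0 x ≤ H p β 0 0
    rw [H_at_zero hp]
    exact (le_csSup hbdd (mem_image_of_mem (H p β 0) hx)).trans_eq h
  · intro h
    have : IsGreatest (H p β 0 '' Icc (-1) 1) (H p β 0 0) :=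
      ⟨mem_image_of_mem _ h.1, by rintro _ ⟨x, hx, rfl⟩; exact h.2 hx⟩
    rw [this.csSup_eq, H_at_zero hp]

theorem bddAbove_threshold_set {p : ℕ} (hp : p ≠ 0) :
    BddAbove {β : ℝ | 0 ≤ β ∧ sSup (H p β 0 '' Icc (-1) 1) = 0} := by
  refine ⟨Real.log 2, ?_⟩
  rintro β ⟨-, hβ⟩
  rw [sSup_H_eq_zero_iff hp] at hβ
  have h1 : H p β 0 1 ≤ H p β 0 0 := hβ.2 (by simp)
  rw [H_at_zero hp] at h1
  simp [H, entropy_one] at h1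
  linarith

/-- For each `x` the condition `H p β 0 x ≤ 0` is closed in `β`, so it passes to the supremum. -/
theorem zero_mem_maximizers_betaTilde {p : ℕ} (hp : p ≠ 0) :
    (0 : ℝ) ∈ maximizers p (betaTilde p) 0 := by
  have hne : {β : ℝ | 0 ≤ β ∧ sSup (H p β 0 '' Icc (-1) 1) = 0}.Nonempty := by
    refine ⟨0, le_rfl, (sSup_H_eq_zero_iff hp 0).2 ⟨by simp, fun x hx => ?_⟩⟩
    change H p 0 0 x ≤ H p 0 0 0
    rw [H_at_zero hp]
    simpa [H] using entropy_nonneg hx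
  have hcl := csSup_mem_closure hne (bddAbove_threshold_set hp)
  refine ⟨by simp, fun x hx => ?_⟩
  have hclosed : IsClosed {β : ℝ | H p β 0 x ≤ 0} :=
    isClosed_le (by unfold H; fun_prop) continuous_const
  have hsub : {β : ℝ | 0 ≤ β ∧ sSup (H p β 0 '' Icc (-1) 1) = 0} ⊆ {β : ℝ | H p β 0 x ≤ 0} := by
    rintro β ⟨-, hβ⟩
    rw [sSup_H_eq_zero_iff hp] at hβ
    have : H p β 0 x ≤ H p β 0 0 := hβ.2 hx
    rwa [H_at_zero hp] at this
  have := hclosed.closure_subset_iff.2 hsub hcl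
  change H p (betaTilde p) 0 x ≤ H p (betaTilde p) 0 0
  rw [H_at_zero hp]
  exact this

theorem zero_notMem_maximizers {p : ℕ} (hp : p ≠ 0) {β : ℝ} (hβ : 0 ≤ β) (h : betaTilde p < β) :
    (0 : ℝ) ∉ maximizers p β 0 := fun h0 =>
  (not_le.2 h) (le_csSup (bddAbove_threshold_set hp)
    (show β ∈ {β : ℝ | 0 ≤ β ∧ sSup (H p β 0 '' Icc (-1) 1) = 0} from
      ⟨hβ, (sSup_H_eq_zero_iff hp β).2 h0⟩))

/-- At the fixed point `m > 0` the value of `H` is strictly increasing in `β` and is already `0`, so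
any larger parameter leaves the set defining the threshold. -/
theorem eq_betaTilde {p : ℕ} (hp : p ≠ 0) {β m : ℝ} (hβ : 0 ≤ β)
    (h0 : (0 : ℝ) ∈ maximizers p β 0) (hm : m ∈ maximizers p β 0) (hm0 : 0 < m) :
    β = betaTilde p := by
  suffices hg : IsGreatest {β : ℝ | 0 ≤ β ∧ sSup (H p β 0 '' Icc (-1) 1) = 0} β from
    hg.csSup_eq.symm
  refine ⟨⟨hβ, (sSup_H_eq_zero_iff hp β).2 h0⟩, ?_⟩
  rintro β' ⟨-, hβ'⟩
  rw [sSup_H_eq_zero_iff hp] at hβ'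
  have h1 : H p β' 0 m ≤ H p β' 0 0 := hβ'.2 hm.1
  have h2 : H p β 0 0 ≤ H p β 0 m := hm.2 h0.1
  rw [H_at_zero hp] at h1 h2
  unfold H at h1 h2
  have h3 : 0 < m ^ p := by positivity
  nlinarith

/-! ### The maximizers at critical points -/

theorem derivH_zero {p : ℕ} (hp : 3 ≤ p) (β h : ℝ) : derivH p β h 0 = h := by
  unfold derivH
  rw [zero_pow (by omega)]; simp

theorem derivH2_neg {p : ℕ} (heven : Even p) (β x : ℝ) : derivH2 p β (-x) = derivH2 p β x := by
  have h : Even (p - 2) := by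
    obtain ⟨k, rfl⟩ := heven
    exact ⟨k - 1, by omega⟩
  unfold derivH2
  rw [h.neg_pow, neg_sq]

theorem maximizer_ne_zero {p : ℕ} (hp : 3 ≤ p) {β h m : ℝ} (hh : h ≠ 0)
    (hm : m ∈ maximizers p β h) : m ≠ 0 := by
  rintro rfl
  exact hh ((derivH_zero hp β h).symm.trans (derivH_eq_zero hm))

/-- If `h ≠ 0`, then `0` is not critical. If `h = 0`, reflecting a negative point increases `H`, so
`m₁ ≥ 0`; and `m₁ > 0` would give the four critical points `0 < m₁ < ξ < m₂`, one too many. So `m₁ =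
0`, which forces the threshold. -/
theorem maximizers_odd {p : ℕ} (hp : 3 ≤ p) (hodd : Odd p) {β h : ℝ} (hβ : 0 ≤ β)
    (hcrit : IsCritical p β h) :
    ∃ m₁ m₂, m₁ < m₂ ∧ maximizers p β h = {m₁, m₂} ∧ derivH2 p β m₁ < 0 ∧ derivH2 p β m₂ < 0 ∧
      ((β, h) ≠ (betaTilde p, 0) → m₁ ≠ 0 ∧ m₂ ≠ 0) ∧ ((β, h) = (betaTilde p, 0) → m₁ = 0) := by
  obtain ⟨m₁, m₂, hlt, hM, hd₁, hd₂⟩ := exists_two_maximizers hp hcrit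
    fun m _ x hx _ h0 => pos_of_derivH2_eq_zero_of_odd hp hodd hβ hx h0
  have hm₁ : m₁ ∈ maximizers p β h := by simp [hM]
  have hm₂ : m₂ ∈ maximizers p β h := by simp [hM]
  refine ⟨m₁, m₂, hlt, hM, hd₁, hd₂, ?_⟩
  suffices hzero : h = 0 → m₁ = 0 ∧ β = betaTilde p by
    refine ⟨fun hne => ?_, fun heq => (hzero (Prod.ext_iff.1 heq).2).1⟩
    have hh : h ≠ 0 := fun h0 => hne (by rw [(hzero h0).2, h0])
    exact ⟨maximizer_ne_zero hp hh hm₁, maximizer_ne_zero hp hh hm₂⟩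
  rintro rfl
  have hI₁ := maximizers_subset_Ioo hm₁
  have hI₂ := maximizers_subset_Ioo hm₂
  obtain ⟨ξ, hξ, z⟩ := exists_derivH_eq_zero hm₁ hm₂ hlt
  have hβpos : 0 < β := by
    refine lt_of_le_of_ne hβ ?_
    rintro rfl
    obtain ⟨η, hη, z'⟩ := exists_derivH2_eq_zero hI₁.1 (hξ.2.trans hI₂.2) hξ.1
      (derivH_eq_zero hm₁) z
    have : 0 < 1 - η ^ 2 := by nlinarith [hI₁.1, hI₂.2, hη.1, hη.2, hξ.2]
    simp [derivH2, this.ne'] at z'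
  have hnn : 0 ≤ m₁ := by
    by_contra! hneg
    have h1 : H p β 0 (-m₁) ≤ H p β 0 m₁ :=
      hm₁.2 ⟨by linarith [hI₁.2], by linarith [hI₁.1]⟩
    unfold H at h1
    rw [entropy_neg, hodd.neg_pow] at h1
    have h2 : m₁ ^ p < 0 := hodd.pow_neg_iff.2 hneg
    nlinarith
  have hm₁0 : m₁ = 0 := by
    by_contra hne
    have hpos : 0 < m₁ := lt_of_le_of_ne hnn (Ne.symm hne)
    have := (critical_triple hp (by norm_num) hpos hξ.1 (hξ.2.trans hI₂.2) (derivH_zero hp β 0)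
      (derivH_eq_zero hm₁) z fun x _ hx h0 => pos_of_derivH2_eq_zero hp hx h0).2.2
    exact this m₂ ⟨hξ.2, hI₂.2⟩ (derivH_eq_zero hm₂)
  refine ⟨hm₁0, ?_⟩
  rw [hm₁0] at hm₁ hlt
  exact eq_betaTilde (by omega) hβ hm₁ hm₂ hlt

/-- Reflecting a negative point raises `h x` and leaves the even part of `H` alone, so all
maximizers lie on the side where zeros of `H''` are controlled. -/
theorem maximizers_even_pos {p : ℕ} (hp : 3 ≤ p) (heven : Even p) {β h : ℝ} (hh : 0 < h)
    (hcrit : IsCritical p β h) :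
    ∃ m₁ m₂, 0 < m₁ ∧ m₁ < m₂ ∧ maximizers p β h = {m₁, m₂} ∧
      derivH2 p β m₁ < 0 ∧ derivH2 p β m₂ < 0 := by
  have hnn : ∀ m ∈ maximizers p β h, 0 < m := by
    intro m hm
    have hI := maximizers_subset_Ioo hm
    refine lt_of_le_of_ne ?_ (Ne.symm (maximizer_ne_zero hp hh.ne' hm))
    by_contra! hneg
    have h1 : H p β h (-m) ≤ H p β h m := hm.2 ⟨by linarith [hI.2], by linarith [hI.1]⟩
    unfold H at h1
    rw [entropy_neg, heven.neg_pow] at h1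
    nlinarith
  obtain ⟨m₁, m₂, hlt, hM, hd₁, hd₂⟩ := exists_two_maximizers hp hcrit
    fun m hm x _ hmx h0 => pos_of_derivH2_eq_zero hp ((hnn m hm).le.trans hmx) h0
  exact ⟨m₁, m₂, hnn m₁ (by simp [hM]), hlt, hM, hd₁, hd₂⟩

theorem neg_mem_maximizers_even {p : ℕ} (heven : Even p) {β h m : ℝ}
    (hm : m ∈ maximizers p β h) : -m ∈ maximizers p β (-h) := by
  simpa [heven.neg_one_pow] using neg_mem_maximizers hm

theorem maximizers_even_neg {p : ℕ} (hp : 3 ≤ p) (heven : Even p) {β h : ℝ} (hh : h < 0)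
    (hcrit : IsCritical p β h) :
    ∃ m₁ m₂, m₂ < 0 ∧ m₁ < m₂ ∧ maximizers p β h = {m₁, m₂} ∧
      derivH2 p β m₁ < 0 ∧ derivH2 p β m₂ < 0 := by
  have hcrit' : IsCritical p β (-h) := by
    obtain ⟨a, ha, b, hb, hab⟩ := hcrit
    exact ⟨-a, neg_mem_maximizers_even heven ha, -b, neg_mem_maximizers_even heven hb,
      fun h => hab (neg_injective h)⟩
  obtain ⟨m₁, m₂, hpos, hlt, hM, hd₁, hd₂⟩ :=
    maximizers_even_pos hp heven (neg_pos.2 hh) hcrit'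
  refine ⟨-m₂, -m₁, by linarith, by linarith, ?_, by rwa [derivH2_neg heven],
    by rwa [derivH2_neg heven]⟩
  have hmem : ∀ c, c ∈ maximizers p β h ↔ -c ∈ maximizers p β (-h) := fun c =>
    ⟨neg_mem_maximizers_even heven, fun hc => by
      simpa using neg_mem_maximizers_even heven hc⟩
  ext c
  rw [hmem, hM]
  simp only [mem_insert_iff, mem_singleton_iff, neg_eq_iff_eq_neg]
  tauto

/-- Maximizers come in pairs `±m`. Since `0` is critical, a second positive maximizer would give
four critical points in `[0, 1)`. -/
theorem maximizers_even_zero {p : ℕ} (hp : 3 ≤ p) (heven : Even p) {β : ℝ}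
    (hcrit : IsCritical p β 0) :
    ∃ m, 0 < m ∧ derivH2 p β m < 0 ∧
      ((0 : ℝ) ∉ maximizers p β 0 → maximizers p β 0 = {-m, m}) ∧
      ((0 : ℝ) ∈ maximizers p β 0 → maximizers p β 0 = {-m, 0, m}) := by
  have hsymm : ∀ c ∈ maximizers p β 0, -c ∈ maximizers p β 0 := fun c hc => by
    simpa using neg_mem_maximizers_even heven hc
  obtain ⟨m, hm, hpos⟩ : ∃ m ∈ maximizers p β 0, 0 < m := by
    obtain ⟨a, ha, b, hb, hab⟩ := hcrit
    have : ∀ c ∈ maximizers p β 0, c ≠ 0 → ∃ m ∈ maximizers p β 0, 0 < m := by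
      intro c hc hc0
      rcases lt_or_gt_of_ne hc0 with h | h
      · exact ⟨-c, hsymm c hc, by linarith⟩
      · exact ⟨c, hc, h⟩
    by_cases h : a = 0
    · exact this b hb (by rintro rfl; exact hab h)
    · exact this a ha h
  have hz := derivH_zero hp β 0
  have hposz : ∀ x ∈ Ioo (-1 : ℝ) 1, 0 ≤ x → derivH2 p β x = 0 → 0 < x :=
    fun x _ hx h0 => pos_of_derivH2_eq_zero hp hx h0
  have huniq : ∀ a ∈ maximizers p β 0, ∀ b ∈ maximizers p β 0, 0 < a → ¬ a < b := by
    intro a ha b hb ha0 hab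
    obtain ⟨ξ, hξ, z⟩ := exists_derivH_eq_zero ha hb hab
    have hI := maximizers_subset_Ioo hb
    exact (critical_triple hp (by norm_num) ha0 hξ.1 (hξ.2.trans hI.2) hz (derivH_eq_zero ha) z
      hposz).2.2 b ⟨hξ.2, hI.2⟩ (derivH_eq_zero hb)
  have hI := maximizers_subset_Ioo hm
  have hall : ∀ c ∈ maximizers p β 0, c = -m ∨ c = 0 ∨ c = m := by
    have hpc : ∀ c ∈ maximizers p β 0, 0 < c → c = m := fun c hc hc0 =>
      le_antisymm (not_lt.1 (huniq m hm c hc hpos)) (not_lt.1 (huniq c hc m hm hc0))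
    intro c hc
    rcases lt_trichotomy c 0 with h | h | h
    · left
      have := hpc (-c) (hsymm c hc) (by linarith)
      linarith
    · exact Or.inr (Or.inl h)
    · exact Or.inr (Or.inr (hpc c hc h))
  refine ⟨m, hpos, lt_of_le_of_ne (derivH2_nonpos hm) ?_, fun h0 => ?_, fun h0 => ?_⟩
  · -- `H` decreases near `0`, so it has a minimum in `(0, m)`
    obtain ⟨ξ, hξ, hmin⟩ := isCompact_Icc.exists_isMinOn (nonempty_Icc.2 hpos.le)
      (continuous_H p β 0).continuousOn
    have h0m : H p β 0 0 ≤ H p β 0 m := hm.2 (by simp)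
    have hlt0 : H p β 0 ξ < H p β 0 0 := by
      have h1 := (H_sub_isLittleO p β 0 (m := 0) (by simp) hz).bound
        (show (0 : ℝ) < 1 / 4 by norm_num)
      obtain ⟨x, hx, hx0⟩ :=
        ((h1.filter_mono (nhdsWithin_le_nhds (s := Ioi (0 : ℝ)))).and (Ioo_mem_nhdsGT hpos)).exists
      refine (hmin ⟨hx0.1.le, hx0.2.le⟩).trans_lt ?_
      rw [derivH2_zero hp, Real.norm_eq_abs, Real.norm_eq_abs, abs_of_nonneg (sq_nonneg (x - 0)),
        sub_zero] at hx
      have := (abs_le.1 hx).2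
      have := hx0.1
      nlinarith
    have hξ0 : 0 < ξ := lt_of_le_of_ne hξ.1 (by rintro rfl; exact lt_irrefl _ hlt0)
    have hξm : ξ < m := lt_of_le_of_ne hξ.2 (by rintro rfl; linarith)
    have hcr : derivH p β 0 ξ = 0 :=
      (hmin.isLocalMin (Icc_mem_nhds hξ0 hξm)).hasDerivAt_eq_zero
        (hasDerivAt_H p β 0 ⟨by linarith, by linarith [hI.2]⟩)
    exact (critical_triple hp (by norm_num) hξ0 hξm hI.2 hz hcr (derivH_eq_zero hm) hposz).2.1
  · ext c
    simp only [mem_insert_iff, mem_singleton_iff]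
    constructor
    · intro hc
      rcases hall c hc with h | h | h
      · exact Or.inl h
      · exact absurd (h ▸ hc) h0
      · exact Or.inr h
    · rintro (rfl | rfl)
      · exact hsymm m hm
      · exact hm
  · ext c
    simp only [mem_insert_iff, mem_singleton_iff]
    refine ⟨hall c, ?_⟩
    rintro (rfl | rfl | rfl)
    · exact hsymm m hm
    · exact h0
    · exact hm

/-! ### Asymptotics of expectations in the Curie-Weiss model -/

/-- The unnormalized mass of the maximizer `m`. -/
def lapWeight (p : ℕ) (β m : ℝ) : ℝ := ((m ^ 2 - 1) * derivH2 p β m) ^ (-(1 / 2) : ℝ)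

/-- The law of the Gaussian fluctuations of the magnetization around the maximizer `m`. -/
def fluctuation (p : ℕ) (β m : ℝ) : Measure ℝ :=
  gaussianReal 0 (1 / (-derivH2 p β m)).toNNReal

instance (p : ℕ) (β m : ℝ) : IsProbabilityMeasure (fluctuation p β m) := by
  unfold fluctuation; infer_instance

theorem lapWeight_pos {p : ℕ} {β m : ℝ} (hm : m ∈ Ioo (-1 : ℝ) 1) (hd : derivH2 p β m < 0) :
    0 < lapWeight p β m := by
  have : 0 < (m ^ 2 - 1) * derivH2 p β m :=
    mul_pos_of_neg_of_neg (by nlinarith [hm.1, hm.2]) hd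
  exact Real.rpow_pos_of_pos this _

theorem binSum_eq_entropySum (p : ℕ) (β h V : ℝ) (N : ℕ) (φ : ℝ → ℝ) :
    binSum p β h N φ =
      2 ^ N * Real.exp (N * V) * entropySum (fun x => H p β h x - V) N φ := by
  unfold binSum entropySum
  rw [Finset.mul_sum]
  refine Finset.sum_congr rfl fun k _ => ?_
  change (N.choose k : ℝ) * (Real.exp (N * (β * gridPoint N k ^ p + h * gridPoint N k)) *
    φ (gridPoint N k)) = _
  have : (N : ℝ) * (β * gridPoint N k ^ p + h * gridPoint N k) = N * V +
      N * entropy (gridPoint N k) + N * (H p β h (gridPoint N k) - V) := by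
    unfold H; ring
  rw [this, Real.exp_add, Real.exp_add]
  field_simp

theorem entropySum_mul_left (f : ℝ → ℝ) (N : ℕ) (c : ℝ) (φ : ℝ → ℝ) :
    entropySum f N (fun x => c * φ x) = c * entropySum f N φ := by
  unfold entropySum
  rw [Finset.mul_sum]
  exact Finset.sum_congr rfl fun k _ => by ring

/-- Centring at `M`, later the extremal value of `m ^ p`, keeps the tilt bounded at the selected
maximizers and exponentially small at the others. -/
theorem binSum_tilt (p : ℕ) (β h t M : ℝ) (N : ℕ) (φ : ℝ → ℝ) :
    binSum p (β + t / Real.sqrt N) h N φ = Real.exp (t * (Real.sqrt N * M)) *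
      binSum p β h N (fun x => Real.exp (t * (Real.sqrt N * (x ^ p - M))) * φ x) := by
  unfold binSum
  rw [Finset.mul_sum]
  refine Finset.sum_congr rfl fun k _ => ?_
  generalize ((2 * k - N) / N : ℝ) = x
  have hs : (N : ℝ) * (t / Real.sqrt N) = t * Real.sqrt N := by
    rw [mul_div_left_comm, Real.div_sqrt]
  have : (N : ℝ) * ((β + t / Real.sqrt N) * x ^ p + h * x) = t * (Real.sqrt N * M) +
      N * (β * x ^ p + h * x) + t * (Real.sqrt N * (x ^ p - M)) := by
    linear_combination x ^ p * hs
  rw [this, Real.exp_add, Real.exp_add]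
  ring

/-- The data attached to a parameter point: `ms` are the maximizers, all nondegenerate. -/
structure NondegenerateMaximizers (p : ℕ) (β h : ℝ) (ms : Finset ℝ) : Prop where
  mem_iff : ∀ m, m ∈ ms ↔ m ∈ maximizers p β h
  derivH2_neg : ∀ m ∈ ms, derivH2 p β m < 0
  nonempty : ms.Nonempty

namespace NondegenerateMaximizers

variable {p : ℕ} {β h : ℝ} {ms : Finset ℝ}

theorem mem_Ioo (hms : NondegenerateMaximizers p β h ms) {m : ℝ} (hm : m ∈ ms) :
    m ∈ Ioo (-1 : ℝ) 1 :=
  maximizers_subset_Ioo ((hms.mem_iff m).1 hm)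

theorem lapWeight_pos (hms : NondegenerateMaximizers p β h ms) {m : ℝ} (hm : m ∈ ms) :
    0 < lapWeight p β m :=
  CurieWeiss.lapWeight_pos (hms.mem_Ioo hm) (hms.derivH2_neg m hm)

theorem coe_eq (hms : NondegenerateMaximizers p β h ms) : maximizers p β h = ↑ms := by
  ext m; exact (hms.mem_iff m).symm

theorem mixWeight_eq (hms : NondegenerateMaximizers p β h ms) {m : ℝ} (hm : m ∈ ms) :
    mixWeight p β h m = lapWeight p β m / ∑ m' ∈ ms, lapWeight p β m' := by
  unfold mixWeight
  rw [hms.coe_eq, finsum_mem_coe_finset, H2_eq_derivH2 p β h (hms.mem_Ioo hm)]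
  congr 1
  refine Finset.sum_congr rfl fun m' hm' => ?_
  rw [H2_eq_derivH2 p β h (hms.mem_Ioo hm')]
  rfl

theorem sum_mixWeight (hms : NondegenerateMaximizers p β h ms) :
    ∑ m ∈ ms, mixWeight p β h m = 1 := by
  rw [Finset.sum_congr rfl fun m hm => hms.mixWeight_eq hm, ← Finset.sum_div]
  exact div_self (Finset.sum_pos (fun m hm => hms.lapWeight_pos hm) hms.nonempty).ne'

theorem tendsto_entropySum (hms : NondegenerateMaximizers p β h ms) {m₀ : ℝ} (h₀ : m₀ ∈ ms)
    (φ : ℕ → ℝ → ℝ) (G : ℝ → ℝ → ℝ)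
    (hφ : ∀ m ∈ ms, ∃ C : ℝ, ∀ N, ∀ x ∈ Icc (-1 : ℝ) 1,
      |φ N x| ≤ C * Real.exp (C * (Real.sqrt N * |x - m|)))
    (hG : ∀ m ∈ ms, ∀ᵐ y, ∀ u : ℕ → ℝ, Tendsto u atTop (𝓝 y) →
        Tendsto (fun N => φ N (m + u N / Real.sqrt N)) atTop (𝓝 (G m y))) :
    Tendsto (fun N => entropySum (fun x => H p β h x - H p β h m₀) N (φ N)) atTop
      (𝓝 (∑ m ∈ ms, lapWeight p β m * ∫ y, G m y ∂(fluctuation p β m))) := by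
  have hmax := ((hms.mem_iff m₀).1 h₀)
  have heq : ∀ m ∈ ms, H p β h m = H p β h m₀ := fun m hm =>
    le_antisymm (hmax.2 ((hms.mem_iff m).1 hm).1) (((hms.mem_iff m).1 hm).2 hmax.1)
  refine CurieWeiss.tendsto_entropySum (κ := derivH2 p β)
    ((continuous_H p β h).sub continuous_const) ms hms.nonempty (fun m hm => hms.mem_Ioo hm)
    hms.derivH2_neg ?_ ?_ φ G hφ hG
  · intro m hm
    rw [← heq m hm]
    exact H_sub_isLittleO p β h (hms.mem_Ioo hm) (derivH_eq_zero ((hms.mem_iff m).1 hm))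
  · intro x hx hxms
    change H p β h x - H p β h m₀ < 0
    rw [sub_neg]
    refine lt_of_le_of_ne (hmax.2 hx) fun he => hxms ((hms.mem_iff x).2 ⟨hx, fun y hy => ?_⟩)
    change H p β h y ≤ H p β h x
    rw [he]
    exact hmax.2 hy

end NondegenerateMaximizers

/-! ### Local behaviour of the statistic `x ^ p` -/

/-- The delta method, along sequences. The slope extended by the derivative avoids dividing by `u
N`, which may vanish. -/
theorem tendsto_sqrt_mul_pow_sub (p : ℕ) (m : ℝ) {y : ℝ} {u : ℕ → ℝ}
    (hu : Tendsto u atTop (𝓝 y)) :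
    Tendsto (fun N : ℕ => Real.sqrt N * ((m + u N / Real.sqrt N) ^ p - m ^ p)) atTop
      (𝓝 (p * m ^ (p - 1) * y)) := by
  have hsqrt : Tendsto (fun N : ℕ => Real.sqrt N) atTop atTop :=
    Real.tendsto_sqrt_atTop.comp tendsto_natCast_atTop_atTop
  set f : ℝ → ℝ := fun x => x ^ p
  have hf : HasDerivAt f (p * m ^ (p - 1)) m := hasDerivAt_pow p m
  have h1 : Tendsto (fun N : ℕ => m + u N / Real.sqrt N) atTop (𝓝 m) := by
    simpa using (hu.div_atTop hsqrt).const_add m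
  have h2 := (continuousAt_dslope_same.2 hf.differentiableAt).tendsto.comp h1
  rw [dslope_same, hf.deriv] at h2
  refine (h2.mul hu).congr' ?_
  filter_upwards [eventually_gt_atTop 0] with N hN
  have hs : 0 < Real.sqrt N := Real.sqrt_pos.2 (by exact_mod_cast hN)
  have h3 := sub_smul_dslope f m (m + u N / Real.sqrt N)
  rw [smul_eq_mul, add_sub_cancel_left] at h3
  simp only [Function.comp_apply]
  change _ = Real.sqrt N * (f (m + u N / Real.sqrt N) - f m)
  rw [← h3]
  field_simp

theorem abs_pow_sub_pow_le_of_mem_Icc (p : ℕ) {x m : ℝ} (hx : x ∈ Icc (-1 : ℝ) 1)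
    (hm : m ∈ Icc (-1 : ℝ) 1) : |x ^ p - m ^ p| ≤ p * |x - m| := by
  refine (abs_pow_sub_pow_le x m p).trans ?_
  have : max |x| |m| ^ (p - 1) ≤ 1 :=
    pow_le_one₀ (le_max_of_le_left (abs_nonneg x)) (max_le (abs_le.2 hx) (abs_le.2 hm))
  rw [mul_comm (p : ℝ)]
  exact mul_le_of_le_one_right (by positivity) this

/-- Merges prefactor and rate into the single constant in which the domination hypothesis of
Laplace's method is phrased. -/
theorem exists_exp_bound {ι : Type*} {g w : ι → ℝ} {A B : ℝ} (hA : 0 ≤ A)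
    (hw : ∀ i, 0 ≤ w i) (hg : ∀ i, g i ≤ A * Real.exp (B * w i)) :
    ∃ C, ∀ i, g i ≤ C * Real.exp (C * w i) := by
  refine ⟨max A B, fun i => (hg i).trans ?_⟩
  have := mul_le_mul_of_nonneg_right (le_max_right A B) (hw i)
  exact mul_le_mul (le_max_left A B) (Real.exp_le_exp.2 this) (Real.exp_pos _).le
    (hA.trans (le_max_left A B))

theorem pow_le_factorial_mul_exp {w : ℝ} (hw : 0 ≤ w) (q : ℕ) :
    w ^ q ≤ q.factorial * Real.exp w := by
  have h := Real.pow_div_factorial_le_exp w hw q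
  have : (0 : ℝ) < q.factorial := by positivity
  rwa [div_le_iff₀' this] at h

section Tilt

variable {p : ℕ} {t M m : ℝ}

/-- Since `x ^ p` is `p`-Lipschitz on `[-1, 1]`, the tilt at `x` is its value at `m` times a factor
exponential in the distance. -/
theorem tilt_le (hm : m ∈ Icc (-1 : ℝ) 1) {x : ℝ} (hx : x ∈ Icc (-1 : ℝ) 1) {s : ℝ}
    (hs : 0 ≤ s) :
    Real.exp (t * (s * (x ^ p - M))) ≤
      Real.exp (s * (t * (m ^ p - M))) * Real.exp (|t| * p * (s * |x - m|)) := by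
  rw [← Real.exp_add, Real.exp_le_exp]
  have h1 : t * (s * (x ^ p - m ^ p)) ≤ |t| * p * (s * |x - m|) := by
    refine (le_abs_self _).trans ?_
    rw [abs_mul, abs_mul, abs_of_nonneg hs]
    have := mul_le_mul_of_nonneg_left (abs_pow_sub_pow_le_of_mem_Icc p hx hm)
      (mul_nonneg (abs_nonneg t) hs)
    linarith
  linarith

/-- Domination of the tilted statistic away from the maximizers of `t * m ^ p`. -/
theorem exists_bound_of_neg (q : ℕ) (hm : m ∈ Icc (-1 : ℝ) 1) (hneg : t * (m ^ p - M) < 0) :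
    ∃ C : ℝ, ∀ N : ℕ, ∀ x ∈ Icc (-1 : ℝ) 1,
      |Real.sqrt N ^ q * (x ^ p - M) * Real.exp (t * (Real.sqrt N * (x ^ p - M)))| ≤
        C * Real.exp (C * (Real.sqrt N * |x - m|)) := by
  set g := -(t * (m ^ p - M)) with hg
  have hg0 : 0 < g := by rw [hg]; linarith
  have h := exists_exp_bound (ι := {i : ℕ × ℝ // i.2 ∈ Icc (-1 : ℝ) 1})
    (g := fun i => |Real.sqrt i.1.1 ^ q * (i.1.2 ^ p - M) *
      Real.exp (t * (Real.sqrt i.1.1 * (i.1.2 ^ p - M)))|)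
    (w := fun i => Real.sqrt i.1.1 * |i.1.2 - m|)
    (A := q.factorial / g ^ q * (1 + |M|)) (B := |t| * p) (by positivity)
    (fun i => by positivity) ?_
  · obtain ⟨C, hC⟩ := h
    exact ⟨C, fun N x hx => hC ⟨(N, x), hx⟩⟩
  · rintro ⟨⟨N, x⟩, hx⟩
    simp only at hx ⊢
    have hs := Real.sqrt_nonneg (N : ℝ)
    rw [abs_mul, abs_mul, abs_of_nonneg (pow_nonneg hs q), abs_of_pos (Real.exp_pos _)]
    have h1 : |x ^ p - M| ≤ 1 + |M| := by
      refine (abs_sub _ _).trans ?_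
      rw [abs_pow]
      have := pow_le_one₀ (n := p) (abs_nonneg x) (abs_le.2 hx)
      linarith
    -- The decay `exp (-√N g)` absorbs the polynomial factor through `w ^ q ≤ q! exp w` at `w = √N
    -- g`.
    have h2 : Real.sqrt N ^ q * Real.exp (Real.sqrt N * (t * (m ^ p - M))) ≤
        q.factorial / g ^ q := by
      have h3 := pow_le_factorial_mul_exp (mul_nonneg hs hg0.le) q
      rw [mul_pow] at h3
      rw [show Real.sqrt N * (t * (m ^ p - M)) = -(Real.sqrt N * g) by rw [hg]; ring,
        Real.exp_neg, ← div_eq_mul_inv, div_le_div_iff₀ (Real.exp_pos _) (by positivity)]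
      exact h3
    calc _ ≤ Real.sqrt N ^ q * (1 + |M|) * (Real.exp (Real.sqrt N * (t * (m ^ p - M))) *
          Real.exp (|t| * p * (Real.sqrt N * |x - m|))) :=
          mul_le_mul (mul_le_mul_of_nonneg_left h1 (by positivity)) (tilt_le hm hx hs)
            (Real.exp_pos _).le (by positivity)
      _ = Real.sqrt N ^ q * Real.exp (Real.sqrt N * (t * (m ^ p - M))) * ((1 + |M|) *
          Real.exp (|t| * p * (Real.sqrt N * |x - m|))) := by ring
      _ ≤ q.factorial / g ^ q * ((1 + |M|) * Real.exp (|t| * p * (Real.sqrt N * |x - m|))) :=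
          mul_le_mul_of_nonneg_right h2 (by positivity)
      _ = _ := by ring

theorem exists_bound_tilt (hm : m ∈ Icc (-1 : ℝ) 1) (hle : t * (m ^ p - M) ≤ 0) :
    ∃ C : ℝ, ∀ N : ℕ, ∀ x ∈ Icc (-1 : ℝ) 1,
      |Real.exp (t * (Real.sqrt N * (x ^ p - M)))| ≤
        C * Real.exp (C * (Real.sqrt N * |x - m|)) := by
  have h := exists_exp_bound (ι := {i : ℕ × ℝ // i.2 ∈ Icc (-1 : ℝ) 1})
    (g := fun i => |Real.exp (t * (Real.sqrt i.1.1 * (i.1.2 ^ p - M)))|)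
    (w := fun i => Real.sqrt i.1.1 * |i.1.2 - m|)
    (A := 1) (B := |t| * p) zero_le_one (fun i => by positivity) ?_
  · obtain ⟨C, hC⟩ := h
    exact ⟨C, fun N x hx => hC ⟨(N, x), hx⟩⟩
  · rintro ⟨⟨N, x⟩, hx⟩
    simp only at hx ⊢
    have hs := Real.sqrt_nonneg (N : ℝ)
    rw [abs_of_pos (Real.exp_pos _)]
    refine (tilt_le hm hx hs).trans (mul_le_mul_of_nonneg_right ?_ (Real.exp_pos _).le)
    rw [Real.exp_le_one_iff]
    exact mul_nonpos_of_nonneg_of_nonpos hs hle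

theorem exists_bound_mul_tilt {R : ℕ → ℝ → ℝ} (hm : m ∈ Icc (-1 : ℝ) 1) (hle : t * (m ^ p - M) ≤ 0)
    (hR : ∃ C : ℝ, ∀ N : ℕ, ∀ x ∈ Icc (-1 : ℝ) 1,
      |R N x| ≤ C * Real.exp (C * (Real.sqrt N * |x - m|))) :
    ∃ C : ℝ, ∀ N : ℕ, ∀ x ∈ Icc (-1 : ℝ) 1,
      |R N x * Real.exp (t * (Real.sqrt N * (x ^ p - M)))| ≤
        C * Real.exp (C * (Real.sqrt N * |x - m|)) := by
  obtain ⟨C, hC⟩ := hR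
  obtain ⟨C', hC'⟩ := exists_bound_tilt hm hle
  have hC0 : 0 ≤ C := by simpa using (abs_nonneg _).trans (hC 0 m hm)
  have hC0' : 0 ≤ C' := by simpa using (abs_nonneg _).trans (hC' 0 m hm)
  have h := exists_exp_bound (ι := {i : ℕ × ℝ // i.2 ∈ Icc (-1 : ℝ) 1})
    (g := fun i => |R i.1.1 i.1.2 * Real.exp (t * (Real.sqrt i.1.1 * (i.1.2 ^ p - M)))|)
    (w := fun i => Real.sqrt i.1.1 * |i.1.2 - m|)
    (A := C * C') (B := C + C') (by positivity) (fun i => by positivity) ?_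
  · obtain ⟨C, hC⟩ := h
    exact ⟨C, fun N x hx => hC ⟨(N, x), hx⟩⟩
  · rintro ⟨⟨N, x⟩, hx⟩
    simp only at hx ⊢
    rw [abs_mul]
    refine (mul_le_mul (hC N x hx) (hC' N x hx) (abs_nonneg _) (by positivity)).trans_eq ?_
    rw [add_mul, Real.exp_add]; ring

theorem tendsto_tilt_top (hm : m ^ p = M) {y : ℝ} {u : ℕ → ℝ} (hu : Tendsto u atTop (𝓝 y)) :
    Tendsto (fun N : ℕ => Real.exp (t * (Real.sqrt N * ((m + u N / Real.sqrt N) ^ p - M)))) atTop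
      (𝓝 (Real.exp (t * (p * m ^ (p - 1) * y)))) := by
  subst hm
  exact (Real.continuous_exp.tendsto _).comp ((tendsto_sqrt_mul_pow_sub p m hu).const_mul t)

theorem tendsto_mul_tilt_of_neg (q : ℕ) (hneg : t * (m ^ p - M) < 0) {y : ℝ} {u : ℕ → ℝ}
    (hu : Tendsto u atTop (𝓝 y)) :
    Tendsto (fun N : ℕ => Real.sqrt N ^ q *
      Real.exp (t * (Real.sqrt N * ((m + u N / Real.sqrt N) ^ p - M)))) atTop (𝓝 0) := by
  set g := -(t * (m ^ p - M)) with hg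
  have hg0 : 0 < g := by rw [hg]; linarith
  have hsqrt : Tendsto (fun N : ℕ => Real.sqrt N * g) atTop atTop :=
    (Real.tendsto_sqrt_atTop.comp tendsto_natCast_atTop_atTop).atTop_mul_const hg0
  have h1 := ((Real.tendsto_pow_mul_exp_neg_atTop_nhds_zero q).comp hsqrt).const_mul (1 / g ^ q)
  have h2 := h1.mul (tendsto_tilt_top (t := t) (p := p) (m := m) rfl hu)
  rw [mul_zero, zero_mul] at h2
  refine h2.congr fun N => ?_
  simp only [Function.comp_apply]
  have h3 : t * (Real.sqrt N * ((m + u N / Real.sqrt N) ^ p - M)) = -(Real.sqrt N * g) +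
      t * (Real.sqrt N * ((m + u N / Real.sqrt N) ^ p - m ^ p)) := by
    rw [hg]; ring
  rw [h3, Real.exp_add, mul_pow]
  field_simp

end Tilt

/-! ### The limiting distribution function of the scaled error -/

theorem entropySum_one_pos (f : ℝ → ℝ) (N : ℕ) (e : ℝ → ℝ) (he : ∀ x, 0 < e x) :
    0 < entropySum f N e := by
  unfold entropySum
  refine Finset.sum_pos (fun k hk => ?_) ⟨0, by simp⟩
  have : 0 < N.choose k := Nat.choose_pos (Nat.lt_succ_iff.1 (Finset.mem_range.1 hk))
  have := he (gridPoint N k)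
  positivity

/-- Both sides of the comparison are centred at `M` and magnified by `√N ^ q`, which turns the event
into one with a nondegenerate limit; the exponent `q` is left free to match the size of the
fluctuations of `x ^ p`. -/
theorem scaledErrorLaw_real_Iic_eq {p N : ℕ} (hp : p ≠ 0) (hN : 2 ≤ N) {β h : ℝ}
    {T : (N : ℕ) → Config N → EReal} (hT : ∀ x : Config N, IsMLE p N h x (T N x))
    (q : ℕ) (t M V : ℝ) :
    (scaledErrorLaw p β h T N : Measure EReal).real (Iic (t : EReal)) =
      entropySum (fun x => H p β h x - V) N (fun x => if Real.sqrt N ^ q * (x ^ p - M) ≤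
        entropySum (fun x => H p β h x - V) N (fun x => Real.sqrt N ^ q * (x ^ p - M) *
          Real.exp (t * (Real.sqrt N * (x ^ p - M)))) /
        entropySum (fun x => H p β h x - V) N (fun x =>
          Real.exp (t * (Real.sqrt N * (x ^ p - M)))) then 1 else 0) /
      entropySum (fun x => H p β h x - V) N (fun _ => 1) := by
  have hs : 0 < Real.sqrt N := Real.sqrt_pos.2 (by exact_mod_cast (by omega : 0 < N))
  set e : ℝ → ℝ := fun x => Real.exp (t * (Real.sqrt N * (x ^ p - M))) with he
  set f : ℝ → ℝ := fun x => H p β h x - V with hf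
  have hD : 0 < entropySum f N e := entropySum_one_pos f N e fun x => Real.exp_pos _
  rw [scaledErrorLaw_real_Iic hp hN hT t]
  have hnum : entropySum f N (fun x => Real.sqrt N ^ q * (x ^ p - M) * e x) =
      Real.sqrt N ^ q * (entropySum f N (fun x => e x * x ^ p) - M * entropySum f N e) := by
    have h1 : (fun x => Real.sqrt N ^ q * (x ^ p - M) * e x) =
        fun x => Real.sqrt N ^ q * (e x * x ^ p + (-M) * e x) := by funext x; ring
    rw [h1, entropySum_mul_left, entropySum_add, entropySum_mul_left]
    ring
  have hcond : ∀ x : ℝ, (x ^ p * binSum p (β + t / Real.sqrt N) h N (fun _ => 1) ≤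
      binSum p (β + t / Real.sqrt N) h N (fun y => y ^ p)) ↔
      Real.sqrt N ^ q * (x ^ p - M) ≤
        entropySum f N (fun x => Real.sqrt N ^ q * (x ^ p - M) * e x) / entropySum f N e := by
    intro x
    rw [binSum_tilt p β h t M, binSum_tilt p β h t M, binSum_eq_entropySum p β h V,
      binSum_eq_entropySum p β h V, hnum, le_div_iff₀ hD]
    simp only [mul_one]
    set K := Real.exp (t * (Real.sqrt N * M)) * (2 ^ N * Real.exp (N * V)) with hK
    have hK0 : 0 < K := by positivity
    have h1 : x ^ p * (Real.exp (t * (Real.sqrt N * M)) * (2 ^ N * Real.exp (N * V) *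
        entropySum f N e)) = K * (x ^ p * entropySum f N e) := by rw [hK]; ring
    have h2 : Real.exp (t * (Real.sqrt N * M)) * (2 ^ N * Real.exp (N * V) *
        entropySum f N (fun x => e x * x ^ p)) = K * entropySum f N (fun x => e x * x ^ p) := by
      rw [hK]; ring
    change x ^ p * (Real.exp (t * (Real.sqrt N * M)) * (2 ^ N * Real.exp (N * V) *
        entropySum f N e)) ≤ Real.exp (t * (Real.sqrt N * M)) * (2 ^ N * Real.exp (N * V) *
        entropySum f N (fun x => e x * x ^ p)) ↔ _
    rw [h1, h2, mul_le_mul_iff_right₀ hK0, mul_assoc,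
      mul_le_mul_iff_right₀ (pow_pos hs q), sub_mul, sub_le_sub_iff_right]
  simp only [hcond]
  rw [binSum_eq_entropySum p β h V, binSum_eq_entropySum p β h V,
    mul_div_mul_left _ _ (by positivity)]

/-- The tilted mean of `√N ^ q (x ^ p - M)` comes only from maximizers with `m ^ p = M` and tends to
`c`. Under the untilted law, near such a maximizer the event becomes `L m y ≤ c`. Near any other, `x
^ p - M` keeps the sign opposite to `t`, so after magnification it tends to `-∞` for `t > 0` and to
`+∞` for `t < 0`. Asking that `L m y ≠ c` almost everywhere removes the discontinuity of the
indicator. -/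
theorem NondegenerateMaximizers.tendsto_cdf {p : ℕ} {β h : ℝ} {ms : Finset ℝ} (hp : p ≠ 0)
    (hms : NondegenerateMaximizers p β h ms) {T : (N : ℕ) → Config N → EReal}
    (hT : ∀ (N : ℕ) (x : Config N), IsMLE p N h x (T N x)) {q : ℕ} (hq : q ≠ 0) {t M : ℝ}
    (hM : ∀ m ∈ ms, m ^ p = M ∨ t * (m ^ p - M) < 0) {m₀ : ℝ} (h₀ : m₀ ∈ ms)
    (L : ℝ → ℝ → ℝ)
    (hL : ∀ m ∈ ms, m ^ p = M → ∀ y, ∀ u : ℕ → ℝ, Tendsto u atTop (𝓝 y) →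
      Tendsto (fun N : ℕ => Real.sqrt N ^ q * ((m + u N / Real.sqrt N) ^ p - M)) atTop
        (𝓝 (L m y)))
    (hLm : ∀ m ∈ ms, m ^ p = M → Measurable (L m))
    (hLb : ∀ m ∈ ms, m ^ p = M → ∃ C : ℝ, ∀ N : ℕ, ∀ x ∈ Icc (-1 : ℝ) 1,
      |Real.sqrt N ^ q * (x ^ p - M)| ≤ C * Real.exp (C * (Real.sqrt N * |x - m|)))
    {c : ℝ}
    (hc : ∑ m ∈ ms, lapWeight p β m * (∫ y, if m ^ p = M then
        L m y * Real.exp (t * (p * m ^ (p - 1) * y)) else 0 ∂(fluctuation p β m)) =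
      c * ∑ m ∈ ms, lapWeight p β m * (∫ y, if m ^ p = M then
        Real.exp (t * (p * m ^ (p - 1) * y)) else 0 ∂(fluctuation p β m)))
    (hden : 0 < ∑ m ∈ ms, lapWeight p β m * (∫ y, if m ^ p = M then
        Real.exp (t * (p * m ^ (p - 1) * y)) else 0 ∂(fluctuation p β m)))
    (hLc : ∀ m ∈ ms, m ^ p = M → ∀ᵐ y, L m y ≠ c) :
    Tendsto (fun N => (scaledErrorLaw p β h T N : Measure EReal).real (Iic (t : EReal))) atTop
      (𝓝 (∑ m ∈ ms, mixWeight p β h m * if m ^ p = M then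
        (fluctuation p β m).real {y | L m y ≤ c} else if 0 < t then 1 else 0)) := by
  have hIcc : ∀ m ∈ ms, m ∈ Icc (-1 : ℝ) 1 := fun m hm => Ioo_subset_Icc_self (hms.mem_Ioo hm)
  have hle : ∀ m ∈ ms, t * (m ^ p - M) ≤ 0 := fun m hm => by
    rcases hM m hm with h | h
    · simp [h]
    · exact h.le
  have hneg : ∀ m ∈ ms, m ^ p ≠ M → t * (m ^ p - M) < 0 := fun m hm hne =>
    (hM m hm).resolve_left hne
  set e : ℕ → ℝ → ℝ := fun N x => Real.exp (t * (Real.sqrt N * (x ^ p - M))) with he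
  set R : ℕ → ℝ → ℝ := fun N x => Real.sqrt N ^ q * (x ^ p - M) with hR
  set f : ℝ → ℝ := fun x => H p β h x - H p β h m₀ with hf
  have hsqrt : Tendsto (fun N : ℕ => Real.sqrt N) atTop atTop :=
    Real.tendsto_sqrt_atTop.comp tendsto_natCast_atTop_atTop
  have hpow : ∀ (m y : ℝ) (u : ℕ → ℝ), Tendsto u atTop (𝓝 y) →
      Tendsto (fun N : ℕ => (m + u N / Real.sqrt N) ^ p - M) atTop (𝓝 (m ^ p - M)) := by
    intro m y u hu
    have h1 : Tendsto (fun N : ℕ => m + u N / Real.sqrt N) atTop (𝓝 m) := by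
      simpa using (hu.div_atTop hsqrt).const_add m
    exact (h1.pow p).sub_const M
  have hD := hms.tendsto_entropySum h₀ e (fun m y => if m ^ p = M then
      Real.exp (t * (p * m ^ (p - 1) * y)) else 0)
    (fun m hm => exists_bound_tilt (hIcc m hm) (hle m hm)) (by
      intro m hm
      refine Eventually.of_forall fun y u hu => ?_
      by_cases h : m ^ p = M
      · rw [if_pos h]; exact tendsto_tilt_top h hu
      · rw [if_neg h]
        have h1 := tendsto_mul_tilt_of_neg 0 (hneg m hm h) hu
        simp only [pow_zero, one_mul] at h1
        exact h1)
  have hNum := hms.tendsto_entropySum h₀ (fun N x => R N x * e N x) (fun m y => if m ^ p = M then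
      L m y * Real.exp (t * (p * m ^ (p - 1) * y)) else 0)
    (by
      intro m hm
      by_cases h : m ^ p = M
      · exact exists_bound_mul_tilt (hIcc m hm) (hle m hm) (hLb m hm h)
      · exact exists_bound_of_neg q (hIcc m hm) (hneg m hm h)) (by
      intro m hm
      refine Eventually.of_forall fun y u hu => ?_
      by_cases h : m ^ p = M
      · rw [if_pos h]; exact (hL m hm h y u hu).mul (tendsto_tilt_top h hu)
      · rw [if_neg h]
        have h1 := (tendsto_mul_tilt_of_neg q (hneg m hm h) hu).mul (hpow m y u hu)
        rw [zero_mul] at h1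
        refine h1.congr fun N => ?_
        simp only [hR, he]; ring)
  rw [hc] at hNum
  set cN : ℕ → ℝ := fun N => entropySum f N (fun x => R N x * e N x) / entropySum f N (e N)
    with hcN
  have hcN_lim : Tendsto cN atTop (𝓝 c) := by
    have := hNum.div hD hden.ne'
    rwa [mul_div_cancel_right₀ _ hden.ne'] at this
  have hbound1 : ∀ ψ : ℕ → ℝ → ℝ, (∀ N x, |ψ N x| ≤ 1) → ∀ m ∈ ms, ∃ C : ℝ, ∀ N : ℕ,
      ∀ x ∈ Icc (-1 : ℝ) 1, |ψ N x| ≤ C * Real.exp (C * (Real.sqrt N * |x - m|)) := by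
    intro ψ hψ m _
    refine ⟨1, fun N x _ => (hψ N x).trans ?_⟩
    rw [one_mul, one_mul]
    exact Real.one_le_exp (by positivity)
  have hOne := hms.tendsto_entropySum h₀ (fun _ _ => 1) (fun _ _ => 1)
    (hbound1 _ (by simp)) (by
      intro m _
      exact Eventually.of_forall fun y u _ => tendsto_const_nhds)
  have hInd := hms.tendsto_entropySum h₀ (fun N x => if R N x ≤ cN N then 1 else 0)
    (fun m y => if m ^ p = M then {y | L m y ≤ c}.indicator 1 y else if 0 < t then 1 else 0)
    (hbound1 _ (by intro N x; split_ifs <;> simp)) (by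
      intro m hm
      by_cases h : m ^ p = M
      · filter_upwards [hLc m hm h] with y hy u hu
        rw [if_pos h]
        have h1 := hL m hm h y u hu
        rcases lt_or_gt_of_ne hy with h2 | h2
        · rw [indicator_of_mem (by exact h2.le), Pi.one_apply]
          refine tendsto_const_nhds.congr' ?_
          filter_upwards [h1.eventually_lt hcN_lim h2] with N hN
          exact (if_pos hN.le).symm
        · rw [indicator_of_notMem (by exact not_le.2 h2)]
          refine tendsto_const_nhds.congr' ?_
          filter_upwards [hcN_lim.eventually_lt h1 h2] with N hN
          exact (if_neg (not_le.2 hN)).symm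
      · refine Eventually.of_forall fun y u hu => ?_
        rw [if_neg h]
        have h2 := hneg m hm h
        have hpq : Tendsto (fun N : ℕ => Real.sqrt N ^ q) atTop atTop :=
          (tendsto_pow_atTop hq).comp hsqrt
        split_ifs with ht
        · have h3 : m ^ p - M < 0 := by
            by_contra! h4; exact absurd h2 (not_lt.2 (mul_nonneg ht.le h4))
          have h5 := hpq.atTop_mul_neg h3 (hpow m y u hu)
          refine tendsto_const_nhds.congr' ?_
          filter_upwards [h5.eventually_lt_atBot (c - 1),
            hcN_lim.eventually (lt_mem_nhds (by linarith : c - 1 < c))] with N hN1 hN2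
          exact (if_pos (hN1.trans hN2).le).symm
        · have h3 : 0 < m ^ p - M := by
            by_contra! h4
            exact absurd h2 (not_lt.2 (mul_nonneg_of_nonpos_of_nonpos (not_lt.1 ht) h4))
          have h5 := hpq.atTop_mul_pos h3 (hpow m y u hu)
          refine tendsto_const_nhds.congr' ?_
          filter_upwards [h5.eventually_gt_atTop (c + 1),
            hcN_lim.eventually (gt_mem_nhds (by linarith : c < c + 1))] with N hN1 hN2
          exact (if_neg (not_le.2 (hN2.trans hN1))).symm)
  have hsum1 : 0 < ∑ m ∈ ms, lapWeight p β m :=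
    Finset.sum_pos (fun m hm => hms.lapWeight_pos hm) hms.nonempty
  have hOne' : Tendsto (fun N => entropySum f N (fun _ => 1)) atTop
      (𝓝 (∑ m ∈ ms, lapWeight p β m)) := by
    simpa using hOne
  have hfinal := hInd.div hOne' hsum1.ne'
  have hval : (∑ m ∈ ms, lapWeight p β m * ∫ y, (if m ^ p = M then {y | L m y ≤ c}.indicator 1 y
      else if 0 < t then 1 else 0) ∂(fluctuation p β m)) / ∑ m ∈ ms, lapWeight p β m =
      ∑ m ∈ ms, mixWeight p β h m * if m ^ p = M then
        (fluctuation p β m).real {y | L m y ≤ c} else if 0 < t then 1 else 0 := by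
    rw [Finset.sum_div]
    refine Finset.sum_congr rfl fun m hm => ?_
    rw [hms.mixWeight_eq hm, mul_div_right_comm]
    congr 1
    by_cases h : m ^ p = M
    · simp only [h, if_true]
      exact integral_indicator_one (measurableSet_le (hLm m hm h) measurable_const)
    · simp only [h, if_false]
      simp
  rw [hval] at hfinal
  refine hfinal.congr' ?_
  filter_upwards [eventually_ge_atTop 2] with N hN
  exact (scaledErrorLaw_real_Iic_eq hp hN (hT N) q t M (H p β h m₀)).symm

/-! ### Gaussian computations -/

theorem integral_exp_mul_gaussianReal (v : NNReal) (a : ℝ) :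
    ∫ y, Real.exp (a * y) ∂(gaussianReal 0 v) = Real.exp (v * a ^ 2 / 2) := by
  have h := congrFun (mgf_fun_id_gaussianReal (μ := 0) (v := v)) a
  simpa [mgf] using h

theorem integral_mul_exp_mul_gaussianReal (v : NNReal) (a : ℝ) :
    ∫ y, y * Real.exp (a * y) ∂(gaussianReal 0 v) = v * a * Real.exp (v * a ^ 2 / 2) := by
  have h1 := hasDerivAt_mgf (X := fun y : ℝ => y) (μ := gaussianReal 0 v) (t := a)
    (by rw [integrableExpSet_fun_id_gaussianReal]; simp)
  rw [mgf_fun_id_gaussianReal] at h1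
  have h2 : HasDerivAt (fun t : ℝ => Real.exp (0 * t + v * t ^ 2 / 2))
      (v * a * Real.exp (v * a ^ 2 / 2)) a := by
    have h3 : HasDerivAt (fun t : ℝ => 0 * t + v * t ^ 2 / 2) (v * a) a := by
      have := (((hasDerivAt_pow 2 a).const_mul (v : ℝ)).div_const 2)
      refine (this.congr_deriv (by simp; ring)).congr_of_eventuallyEq ?_
      exact Eventually.of_forall fun t => by simp
    refine h3.exp.congr_deriv ?_
    simp [mul_comm]
  exact h1.unique h2

theorem ae_pow_ne {p : ℕ} (hp : p ≠ 0) (c : ℝ) : ∀ᵐ y : ℝ, y ^ p ≠ c := by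
  have hfin : {y : ℝ | y ^ p = c}.Finite := by
    rcases {y : ℝ | y ^ p = c}.eq_empty_or_nonempty with h | ⟨y₀, h₀⟩
    · simp [h]
    · refine (Set.toFinite {y₀, -y₀}).subset fun y hy => ?_
      have h1 : |y| ^ p = |y₀| ^ p := by
        rw [← abs_pow, ← abs_pow, show y ^ p = c from hy, show y₀ ^ p = c from h₀]
      exact abs_eq_abs.1 ((pow_left_inj₀ (abs_nonneg y) (abs_nonneg y₀) hp).1 h1)
  have := hfin.measure_zero volume
  rw [ae_iff]
  simpa using this

namespace NondegenerateMaximizers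

variable {p : ℕ} {β h : ℝ} {ms : Finset ℝ}

theorem limVar_eq (hms : NondegenerateMaximizers p β h ms) {m : ℝ} (hm : m ∈ ms) :
    limVar p β h m = -derivH2 p β m / (p * m ^ (p - 1)) ^ 2 := by
  unfold limVar
  rw [H2_eq_derivH2 p β h (hms.mem_Ioo hm), mul_pow, ← pow_mul,
    show (p - 1) * 2 = 2 * p - 2 by omega]

theorem limVar_pos (hp : p ≠ 0) (hms : NondegenerateMaximizers p β h ms) {m : ℝ} (hm : m ∈ ms)
    (h0 : m ≠ 0) : 0 < limVar p β h m := by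
  rw [hms.limVar_eq hm]
  have h1 := hms.derivH2_neg m hm
  have h2 : (p : ℝ) ≠ 0 := by exact_mod_cast hp
  have h3 : 0 < -derivH2 p β m := by linarith
  positivity

/-- With `l = p m^(p-1)`, the variable `l y` has variance `l² / (-H'') = 1 / σ²`; multiplying by
`σ²` gives variance `σ²`. -/
theorem fluctuation_real_le (hp : p ≠ 0) (hms : NondegenerateMaximizers p β h ms) {m : ℝ}
    (hm : m ∈ ms) (h0 : m ≠ 0) (t : ℝ) :
    (fluctuation p β m).real {y | p * m ^ (p - 1) * y ≤ t / limVar p β h m} =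
      (gaussianReal 0 (limVar p β h m).toNNReal).real (Iic t) := by
  have hs := hms.limVar_pos hp hm h0
  have hd := hms.derivH2_neg m hm
  have hd' : 0 < -derivH2 p β m := by linarith
  have hsl := hms.limVar_eq hm
  set s := limVar p β h m
  have h2 : (p : ℝ) ≠ 0 := by exact_mod_cast hp
  set l := (p : ℝ) * m ^ (p - 1) with hl
  have hl0 : l ≠ 0 := by rw [hl]; positivity
  have hmap : (fluctuation p β m).map (fun y => s * l * y) = gaussianReal 0 s.toNNReal := by
    unfold fluctuation
    rw [gaussianReal_map_const_mul, mul_zero]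
    congr 1
    ext
    push_cast
    rw [Real.coe_toNNReal _ (by positivity), Real.coe_toNNReal _ hs.le]
    rw [hsl]
    field_simp
  rw [← hmap, map_measureReal_apply (by fun_prop) measurableSet_Iic]
  congr 1
  ext y
  simp only [mem_ofPred_eq, mem_preimage, mem_Iic]
  rw [le_div_iff₀ hs]
  constructor <;> intro h' <;> linarith

/-- The limiting distribution function at `t` if the extremal value `M` of `m ^ p` is attained at
nonzero maximizers only. -/
theorem tendsto_cdf_of_ne_zero (hp : p ≠ 0) (hms : NondegenerateMaximizers p β h ms)
    {T : (N : ℕ) → Config N → EReal}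
    (hT : ∀ (N : ℕ) (x : Config N), IsMLE p N h x (T N x)) {t M s : ℝ}
    (hM : ∀ m ∈ ms, m ^ p = M ∨ t * (m ^ p - M) < 0) (hex : ∃ m ∈ ms, m ^ p = M)
    (htop : ∀ m ∈ ms, m ^ p = M → m ≠ 0 ∧ limVar p β h m = s) :
    Tendsto (fun N => (scaledErrorLaw p β h T N : Measure EReal).real (Iic (t : EReal))) atTop
      (𝓝 (∑ m ∈ ms, mixWeight p β h m * if m ^ p = M then
        (gaussianReal 0 s.toNNReal).real (Iic t) else if 0 < t then 1 else 0)) := by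
  obtain ⟨m₀, h₀, hm₀⟩ := hex
  have hs : 0 < s := by
    obtain ⟨h1, h2⟩ := htop m₀ h₀ hm₀
    exact h2 ▸ hms.limVar_pos hp h₀ h1
  have hp' : (p : ℝ) ≠ 0 := by exact_mod_cast hp
  have hIcc : ∀ m ∈ ms, m ∈ Icc (-1 : ℝ) 1 := fun m hm => Ioo_subset_Icc_self (hms.mem_Ioo hm)
  have key := hms.tendsto_cdf hp hT one_ne_zero hM h₀ (fun m y => p * m ^ (p - 1) * y)
    (by
      rintro m _ rfl y u hu
      simpa using tendsto_sqrt_mul_pow_sub p m hu)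
    (fun m _ _ => by fun_prop)
    (by
      rintro m hm rfl
      have h := exists_exp_bound (ι := {i : ℕ × ℝ // i.2 ∈ Icc (-1 : ℝ) 1})
        (g := fun i => |Real.sqrt i.1.1 ^ 1 * (i.1.2 ^ p - m ^ p)|)
        (w := fun i => Real.sqrt i.1.1 * |i.1.2 - m|) (A := p) (B := 1) (by positivity)
        (fun i => by positivity) ?_
      · obtain ⟨C, hC⟩ := h
        exact ⟨C, fun N x hx => hC ⟨(N, x), hx⟩⟩
      · rintro ⟨⟨N, x⟩, hx⟩
        simp only at hx ⊢
        rw [pow_one, abs_mul, abs_of_nonneg (Real.sqrt_nonneg _), one_mul]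
        have h1 := mul_le_mul_of_nonneg_left (abs_pow_sub_pow_le_of_mem_Icc p hx (hIcc m hm))
          (Real.sqrt_nonneg (N : ℝ))
        have h2 : Real.sqrt N * |x - m| ≤ Real.exp (Real.sqrt N * |x - m|) := by
          linarith [Real.add_one_le_exp (Real.sqrt N * |x - m|)]
        have h3 := mul_le_mul_of_nonneg_left h2 (Nat.cast_nonneg (α := ℝ) p)
        linarith)
    -- Tilting a centred Gaussian of variance `v` by `exp (t l y)` shifts the mean of `l y` to `t l²
    -- v`, which is `t / s`. A common `s` is needed so that all selected maximizers share this
    -- constant.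
    (c := t / s)
    (by
      rw [Finset.mul_sum]
      refine Finset.sum_congr rfl fun m hm => ?_
      by_cases h' : m ^ p = M
      · simp only [h', if_true]
        obtain ⟨h1, h2⟩ := htop m hm h'
        rw [mul_left_comm]
        congr 1
        have hd := hms.derivH2_neg m hm
        have hd' : 0 < -derivH2 p β m := by linarith
        set l := (p : ℝ) * m ^ (p - 1) with hl
        have hl0 : l ≠ 0 := by rw [hl]; positivity
        have e1 : ∀ y, Real.exp (t * (l * y)) = Real.exp (t * l * y) := fun y => by
          rw [mul_assoc t l y]
        have e2 : ∀ y, l * y * Real.exp (t * l * y) = l * (y * Real.exp (t * l * y)) := fun y => by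
          rw [mul_assoc]
        simp_rw [e1, e2]
        unfold fluctuation
        rw [integral_const_mul, integral_mul_exp_mul_gaussianReal, integral_exp_mul_gaussianReal,
          Real.coe_toNNReal _ (by positivity), ← h2, hms.limVar_eq hm]
        change _ = t / (-derivH2 p β m / l ^ 2) * _
        field_simp
      · simp [h'])
    (by
      refine Finset.sum_pos' (fun m hm => mul_nonneg (hms.lapWeight_pos hm).le ?_)
        ⟨m₀, h₀, mul_pos (hms.lapWeight_pos h₀) ?_⟩
      · split_ifs
        · exact integral_nonneg fun y => (Real.exp_pos _).le
        · simp
      · simp only [hm₀, if_true]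
        simp_rw [← mul_assoc]
        unfold fluctuation
        rw [integral_exp_mul_gaussianReal]
        exact Real.exp_pos _)
    (by
      intro m hm h'
      have h1 := (htop m hm h').1
      have hl0 : (p : ℝ) * m ^ (p - 1) ≠ 0 := by positivity
      filter_upwards [ae_pow_ne one_ne_zero (t / s / (p * m ^ (p - 1)))] with y hy hyc
      apply hy
      rw [pow_one, ← hyc]
      field_simp)
  convert key using 4 with m hm
  split_ifs with h'
  · obtain ⟨h1, h2⟩ := htop m hm h'
    rw [← h2, hms.fluctuation_real_le hp hm h1]
  · rfl
  · rfl

/-- The limiting distribution function at `t < 0` if `0` is a maximizer and the minimal value of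
`m ^ p` is `0`. -/
theorem tendsto_cdf_of_zero (hp : 3 ≤ p) (hms : NondegenerateMaximizers p β h ms)
    {T : (N : ℕ) → Config N → EReal}
    (hT : ∀ (N : ℕ) (x : Config N), IsMLE p N h x (T N x)) {t : ℝ} (ht : t < 0)
    (hM : ∀ m ∈ ms, m = 0 ∨ 0 < m ^ p) (h₀ : (0 : ℝ) ∈ ms) :
    Tendsto (fun N => (scaledErrorLaw p β h T N : Measure EReal).real (Iic (t : EReal))) atTop
      (𝓝 (mixWeight p β h 0 * gammaP p)) := by
  have hp0 : p ≠ 0 := by omega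
  have h0p : (0 : ℝ) ^ p = 0 := zero_pow hp0
  have hiff : ∀ m : ℝ, m ^ p = 0 ↔ m = 0 := fun m => pow_eq_zero_iff hp0
  have hfl : fluctuation p β 0 = gaussianReal 0 1 := by
    unfold fluctuation
    rw [derivH2_zero hp]
    norm_num
  set c : ℝ := ∫ w, w ^ p ∂(gaussianReal 0 1) with hc
  -- The second `hp0` fixes the magnification exponent `q = p`, the scale of `x ^ p` near `0`. As `p
  -- - 1 ≠ 0`, the limiting tilt at `0` is `1`, so `c` is the plain Gaussian moment and the limit
  -- does not depend on `t`.
  have key := hms.tendsto_cdf hp0 hT hp0 (t := t) (M := 0)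
    (fun m hm => (hM m hm).imp (fun h' => by rw [h', h0p])
      fun h' => by rw [sub_zero]; exact mul_neg_of_neg_of_pos ht h') h₀ (fun _ y => y ^ p)
    (by
      intro m _ hm y u hu
      rw [hiff] at hm
      subst hm
      refine (hu.pow p).congr' ?_
      filter_upwards [eventually_gt_atTop 0] with N hN
      have hs : 0 < Real.sqrt N := Real.sqrt_pos.2 (by exact_mod_cast hN)
      rw [zero_add, sub_zero, ← mul_pow, mul_div_cancel₀ _ hs.ne'])
    (fun m _ _ => by fun_prop)
    (by
      intro m _ hm
      rw [hiff] at hm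
      subst hm
      have h := exists_exp_bound (ι := ℕ × ℝ)
        (g := fun i => |Real.sqrt i.1 ^ p * (i.2 ^ p - 0)|)
        (w := fun i => Real.sqrt i.1 * |i.2 - 0|) (A := p.factorial) (B := 1) (by positivity)
        (fun i => by positivity) ?_
      · obtain ⟨C, hC⟩ := h
        exact ⟨C, fun N x _ => hC (N, x)⟩
      · rintro ⟨N, x⟩
        simp only [sub_zero, one_mul]
        rw [abs_mul, abs_pow, abs_pow, abs_of_nonneg (Real.sqrt_nonneg _), ← mul_pow]
        exact pow_le_factorial_mul_exp (by positivity) p)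
    (c := c)
    (by
      rw [Finset.mul_sum]
      refine Finset.sum_congr rfl fun m _ => ?_
      by_cases h' : m = 0
      · subst h'
        rw [hfl]
        simp [h0p, zero_pow (show p - 1 ≠ 0 by omega), ← hc, mul_comm]
      · simp [hp0, h'])
    (by
      refine Finset.sum_pos' (fun m hm => mul_nonneg (hms.lapWeight_pos hm).le ?_)
        ⟨0, h₀, mul_pos (hms.lapWeight_pos h₀) ?_⟩
      · split_ifs
        · exact integral_nonneg fun y => (Real.exp_pos _).le
        · simp
      · simp [h0p, zero_pow (show p - 1 ≠ 0 by omega)])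
    (fun m _ _ => ae_pow_ne hp0 c)
  convert key using 2
  rw [Finset.sum_eq_single_of_mem 0 h₀, if_pos h0p, hfl]
  · rfl
  · intro m _ hm
    rw [if_neg (by rwa [hiff]), if_neg (not_lt.2 ht.le), mul_zero]

end NondegenerateMaximizers

/-! ### Distribution functions of the limiting mixtures -/

theorem gaussianReal_real_Ici_neg (v : NNReal) (t : ℝ) :
    (gaussianReal 0 v).real (Ici (-t)) = (gaussianReal 0 v).real (Iic t) := by
  have h : (gaussianReal 0 v).map (fun x => -x) = gaussianReal 0 v := by
    rw [gaussianReal_map_neg, neg_zero]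
  conv_rhs => rw [← h, map_measureReal_apply (by fun_prop) measurableSet_Iic]
  congr 1
  ext x
  simp

theorem gaussianReal_real_Iio_neg (v : NNReal) (t : ℝ) :
    (gaussianReal 0 v).real (Iio (-t)) = 1 - (gaussianReal 0 v).real (Iic t) := by
  rw [← gaussianReal_real_Ici_neg, ← probReal_compl_eq_one_sub measurableSet_Ici, compl_Ici]

instance (v : ℝ) : IsProbabilityMeasure (normalE v) :=
  Measure.isProbabilityMeasure_map measurable_coe_real_ereal.aemeasurable

theorem measurable_coe_abs : Measurable fun z : ℝ => ((|z| : ℝ) : EReal) :=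
  measurable_coe_real_ereal.comp continuous_abs.measurable

theorem measurable_coe_neg_abs : Measurable fun z : ℝ => ((-|z| : ℝ) : EReal) :=
  measurable_coe_real_ereal.comp continuous_abs.neg.measurable

instance (v : ℝ) : IsProbabilityMeasure (halfNormalPos v) :=
  Measure.isProbabilityMeasure_map measurable_coe_abs.aemeasurable

instance (v : ℝ) : IsProbabilityMeasure (halfNormalNeg v) :=
  Measure.isProbabilityMeasure_map measurable_coe_neg_abs.aemeasurable

theorem normalE_real_Iic (v t : ℝ) :
    (normalE v).real (Iic (t : EReal)) = (gaussianReal 0 v.toNNReal).real (Iic t) := by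
  unfold normalE
  rw [map_measureReal_apply measurable_coe_real_ereal measurableSet_Iic]
  congr 1
  ext x; simp

theorem halfNormalPos_real_Iic_of_neg (v : ℝ) {t : ℝ} (ht : t < 0) :
    (halfNormalPos v).real (Iic (t : EReal)) = 0 := by
  unfold halfNormalPos
  rw [map_measureReal_apply measurable_coe_abs measurableSet_Iic]
  convert measureReal_empty
  ext x
  simp only [mem_preimage, mem_Iic, EReal.coe_le_coe_iff, mem_empty_iff_false, iff_false, not_le]
  exact ht.trans_le (abs_nonneg x)

theorem halfNormalPos_real_Iic_of_pos (v : ℝ) {t : ℝ} (ht : 0 < t) :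
    (halfNormalPos v).real (Iic (t : EReal)) =
      2 * (gaussianReal 0 v.toNNReal).real (Iic t) - 1 := by
  unfold halfNormalPos
  rw [map_measureReal_apply measurable_coe_abs measurableSet_Iic]
  have h1 : (fun z : ℝ => ((|z| : ℝ) : EReal)) ⁻¹' Iic (t : EReal) = Iic t \ Iio (-t) := by
    ext x
    simp only [mem_preimage, mem_Iic, EReal.coe_le_coe_iff, Set.mem_sdiff, mem_Iio, not_lt, abs_le]
    tauto
  rw [h1, measureReal_sdiff (fun x hx => by simp only [mem_Iio, mem_Iic] at *; linarith)
    measurableSet_Iio, gaussianReal_real_Iio_neg]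
  ring

theorem halfNormalNeg_real_Iic_of_pos (v : ℝ) {t : ℝ} (ht : 0 < t) :
    (halfNormalNeg v).real (Iic (t : EReal)) = 1 := by
  unfold halfNormalNeg
  rw [map_measureReal_apply measurable_coe_neg_abs measurableSet_Iic]
  convert probReal_univ
  · ext x
    simp only [mem_preimage, mem_Iic, EReal.coe_le_coe_iff, mem_univ, iff_true]
    linarith [abs_nonneg x]
  · infer_instance

theorem halfNormalNeg_real_Iic_of_neg (v : ℝ) {t : ℝ} (ht : t < 0) :
    (halfNormalNeg v).real (Iic (t : EReal)) =
      2 * (gaussianReal 0 v.toNNReal).real (Iic t) := by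
  unfold halfNormalNeg
  rw [map_measureReal_apply measurable_coe_neg_abs measurableSet_Iic]
  have h1 : (fun z : ℝ => ((-|z| : ℝ) : EReal)) ⁻¹' Iic (t : EReal) = Iic t ∪ Ici (-t) := by
    ext x
    simp only [mem_preimage, mem_Iic, EReal.coe_le_coe_iff, mem_union, mem_Ici]
    rw [neg_le, le_abs', neg_neg]
  rw [h1, measureReal_union _ measurableSet_Ici, gaussianReal_real_Ici_neg]
  · ring
  · rw [Set.disjoint_left]
    intro x hx hx'
    simp only [mem_Iic, mem_Ici] at hx hx'
    linarith

theorem dirac_real_Iic (a : EReal) (t : ℝ) :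
    (Measure.dirac a).real (Iic (t : EReal)) = if a ≤ t then 1 else 0 := by
  rw [Measure.real, Measure.dirac_apply' _ measurableSet_Iic, indicator_apply]
  simp only [mem_Iic, Pi.one_apply]
  split_ifs <;> simp

theorem mixture_real {a b c : ℝ} (ha : 0 ≤ a) (hb : 0 ≤ b) (hc : 0 ≤ c) (μ ν ρ : Measure EReal)
    [IsFiniteMeasure μ] [IsFiniteMeasure ν] [IsFiniteMeasure ρ] (s : Set EReal) :
    (mixture a μ b ν c ρ).real s = a * μ.real s + b * ν.real s + c * ρ.real s := by
  unfold mixture Measure.real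
  simp only [Measure.add_apply, Measure.smul_apply, smul_eq_mul]
  rw [ENNReal.toReal_add (by finiteness) (by finiteness),
    ENNReal.toReal_add (by finiteness) (by finiteness), ENNReal.toReal_mul, ENNReal.toReal_mul,
    ENNReal.toReal_mul, ENNReal.toReal_ofReal ha, ENNReal.toReal_ofReal hb,
    ENNReal.toReal_ofReal hc]

theorem isProbabilityMeasure_mixture {a b c : ℝ} (ha : 0 ≤ a) (hb : 0 ≤ b) (hc : 0 ≤ c)
    (habc : a + b + c = 1) (μ ν ρ : Measure EReal)
    [IsProbabilityMeasure μ] [IsProbabilityMeasure ν] [IsProbabilityMeasure ρ] :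
    IsProbabilityMeasure (mixture a μ b ν c ρ) := by
  refine ⟨?_⟩
  unfold mixture
  simp only [Measure.add_apply, Measure.smul_apply, smul_eq_mul, measure_univ, mul_one]
  rw [← ENNReal.ofReal_add ha hb, ← ENNReal.ofReal_add (by linarith) hc, habc, ENNReal.ofReal_one]

theorem convergesInLaw_of_tendsto_Iic {μ : ℕ → ProbabilityMeasure EReal} {ν : Measure EReal}
    [hν : IsProbabilityMeasure ν]
    (h : ∀ t : ℝ, t ≠ 0 → Tendsto (fun N => (μ N : Measure EReal).real (Iic (t : EReal))) atTop
      (𝓝 (ν.real (Iic (t : EReal))))) : ConvergesInLaw μ ν :=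
  ⟨⟨ν, hν⟩, rfl, tendsto_of_tendsto_Iic h⟩

theorem convergesInLaw_mixture {μ : ℕ → ProbabilityMeasure EReal} {a b c : ℝ} (ha : 0 ≤ a)
    (hb : 0 ≤ b) (hc : 0 ≤ c) (habc : a + b + c = 1) (ν₁ ν₂ ν₃ : Measure EReal)
    [IsProbabilityMeasure ν₁] [IsProbabilityMeasure ν₂] [IsProbabilityMeasure ν₃]
    (h : ∀ t : ℝ, t ≠ 0 → Tendsto (fun N => (μ N : Measure EReal).real (Iic (t : EReal))) atTop
      (𝓝 (a * ν₁.real (Iic (t : EReal)) + b * ν₂.real (Iic (t : EReal)) +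
        c * ν₃.real (Iic (t : EReal))))) :
    ConvergesInLaw μ (mixture a ν₁ b ν₂ c ν₃) := by
  have := isProbabilityMeasure_mixture ha hb hc habc ν₁ ν₂ ν₃
  refine convergesInLaw_of_tendsto_Iic fun t ht => ?_
  rw [mixture_real ha hb hc]
  exact h t ht

/-! ### The constant `γ_p` -/

theorem integrable_pow_gaussianReal (p : ℕ) (v : NNReal) :
    Integrable (fun z : ℝ => z ^ p) (gaussianReal 0 v) :=
  integrable_pow_of_mem_interior_integrableExpSet
    (by rw [integrableExpSet_fun_id_gaussianReal]; simp) p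

/-- A random variable cannot exceed its mean almost surely; positivity makes the escaping mass
genuine. -/
theorem gammaP_pos (p : ℕ) : 0 < gammaP p := by
  unfold gammaP
  exact ENNReal.toReal_pos (measure_le_integral_pos (integrable_pow_gaussianReal p 1)).ne'
    (measure_ne_top _ _)

theorem gammaP_le_one (p : ℕ) : gammaP p ≤ 1 := measureReal_le_one

theorem gammaP_odd {p : ℕ} (hodd : Odd p) : gammaP p = 1 / 2 := by
  have hsymm : (gaussianReal 0 1).map (fun x => -x) = gaussianReal 0 1 := by
    rw [gaussianReal_map_neg, neg_zero]
  have hint : ∫ w, w ^ p ∂(gaussianReal 0 1) = 0 := by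
    have h1 : ∫ w, w ^ p ∂(gaussianReal 0 1) = ∫ w, (-w) ^ p ∂(gaussianReal 0 1) := by
      conv_lhs => rw [← hsymm]
      exact integral_map (by fun_prop) (by fun_prop)
    simp_rw [hodd.neg_pow, integral_neg] at h1
    linarith
  have : NullSingletonClass (gaussianReal 0 1) := nullSingletonClass_gaussianReal one_ne_zero
  unfold gammaP
  rw [hint]
  have h2 : {z : ℝ | z ^ p ≤ 0} = Iic 0 := by
    ext z; exact hodd.pow_nonpos_iff (a := z)
  have h3 := gaussianReal_real_Iio_neg 1 0
  rw [neg_zero, measureReal_congr Iio_ae_eq_Iic] at h3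
  rw [h2]
  linarith

/-! ### Failure of consistency -/

/-- A limiting distribution function with the same positive value `w` at all `t < 0` leaves
asymptotic mass `w` below any bound; testing with `δ = w / 2` and `t = -|M| - 1` contradicts
tightness. -/
theorem not_isSqrtConsistent {p : ℕ} {β h : ℝ} {T : (N : ℕ) → Config N → EReal} {w : ℝ}
    (hw : 0 < w) (hlim : ∀ t : ℝ, t < 0 → Tendsto (fun N =>
      (scaledErrorLaw p β h T N : Measure EReal).real (Iic (t : EReal))) atTop (𝓝 w)) :
    ¬ IsSqrtConsistent p β h T := by
  intro hcons
  obtain ⟨M, hM⟩ := hcons (w / 2) (half_pos hw)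
  have ht : -|M| - 1 < 0 := by linarith [abs_nonneg M]
  obtain ⟨N, h1, h2⟩ := (hM.and ((hlim _ ht).eventually (lt_mem_nhds (half_lt_self hw)))).exists
  have h3 : Icc ((-M : ℝ) : EReal) (M : EReal) ⊆ (Iic ((-|M| - 1 : ℝ) : EReal))ᶜ := by
    intro x hx hx'
    have h4 := hx.1.trans hx'
    rw [EReal.coe_le_coe_iff] at h4
    linarith [le_abs_self M]
  have h5 := measureReal_mono (μ := (scaledErrorLaw p β h T N : Measure EReal)) h3
  rw [probReal_compl_eq_one_sub measurableSet_Iic] at h5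
  linarith

/-! ### Assembling the limit laws -/

theorem NondegenerateMaximizers.mixWeight_pos {p : ℕ} {β h : ℝ} {ms : Finset ℝ}
    (hms : NondegenerateMaximizers p β h ms) {m : ℝ} (hm : m ∈ ms) : 0 < mixWeight p β h m := by
  rw [hms.mixWeight_eq hm]
  exact div_pos (hms.lapWeight_pos hm)
    (Finset.sum_pos (fun m hm => hms.lapWeight_pos hm) hms.nonempty)

theorem nondegenerateMaximizers_pair {p : ℕ} {β h a b : ℝ} (hM : maximizers p β h = {a, b})
    (ha : derivH2 p β a < 0) (hb : derivH2 p β b < 0) :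
    NondegenerateMaximizers p β h {a, b} where
  mem_iff m := by simp [hM]
  derivH2_neg m hm := by
    simp only [Finset.mem_insert, Finset.mem_singleton] at hm
    rcases hm with rfl | rfl <;> assumption
  nonempty := by simp

section Pair

variable {p : ℕ} {β h lo hi : ℝ} {T : (N : ℕ) → Config N → EReal}

theorem sum_mixWeight_pair (hms : NondegenerateMaximizers p β h {lo, hi}) (hne : lo ≠ hi) :
    mixWeight p β h lo + mixWeight p β h hi = 1 := by
  have := hms.sum_mixWeight
  rwa [Finset.sum_pair hne] at this

theorem tendsto_cdf_pair_of_pos (hp : p ≠ 0) (hms : NondegenerateMaximizers p β h {lo, hi})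
    (hT : ∀ (N : ℕ) (x : Config N), IsMLE p N h x (T N x)) (hlt : lo ^ p < hi ^ p)
    (h0 : hi ≠ 0) {t : ℝ} (ht : 0 < t) :
    Tendsto (fun N => (scaledErrorLaw p β h T N : Measure EReal).real (Iic (t : EReal))) atTop
      (𝓝 (mixWeight p β h lo + mixWeight p β h hi *
        (gaussianReal 0 (limVar p β h hi).toNNReal).real (Iic t))) := by
  have hne : lo ≠ hi := by rintro rfl; exact lt_irrefl _ hlt
  have key := hms.tendsto_cdf_of_ne_zero hp hT (t := t) (M := hi ^ p) (s := limVar p β h hi)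
    (by
      intro m hm
      simp only [Finset.mem_insert, Finset.mem_singleton] at hm
      rcases hm with rfl | rfl
      · exact Or.inr (mul_neg_of_pos_of_neg ht (sub_neg.2 hlt))
      · exact Or.inl rfl)
    ⟨hi, by simp, rfl⟩
    (by
      intro m hm hm'
      simp only [Finset.mem_insert, Finset.mem_singleton] at hm
      rcases hm with rfl | rfl
      · exact absurd hm' hlt.ne
      · exact ⟨h0, rfl⟩)
  rw [Finset.sum_pair hne] at key
  simpa [hlt.ne, ht] using key

theorem tendsto_cdf_pair_of_neg (hp : p ≠ 0) (hms : NondegenerateMaximizers p β h {lo, hi})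
    (hT : ∀ (N : ℕ) (x : Config N), IsMLE p N h x (T N x)) (hlt : lo ^ p < hi ^ p)
    (h0 : lo ≠ 0) {t : ℝ} (ht : t < 0) :
    Tendsto (fun N => (scaledErrorLaw p β h T N : Measure EReal).real (Iic (t : EReal))) atTop
      (𝓝 (mixWeight p β h lo *
        (gaussianReal 0 (limVar p β h lo).toNNReal).real (Iic t))) := by
  have hne : lo ≠ hi := by rintro rfl; exact lt_irrefl _ hlt
  have key := hms.tendsto_cdf_of_ne_zero hp hT (t := t) (M := lo ^ p) (s := limVar p β h lo)
    (by
      intro m hm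
      simp only [Finset.mem_insert, Finset.mem_singleton] at hm
      rcases hm with rfl | rfl
      · exact Or.inl rfl
      · exact Or.inr (mul_neg_of_neg_of_pos ht (sub_pos.2 hlt)))
    ⟨lo, by simp, rfl⟩
    (by
      intro m hm hm'
      simp only [Finset.mem_insert, Finset.mem_singleton] at hm
      rcases hm with rfl | rfl
      · exact ⟨h0, rfl⟩
      · exact absurd hm' hlt.ne')
  rw [Finset.sum_pair hne] at key
  simpa [hlt.ne', not_lt.2 ht.le] using key

/-- Negative `t` selects `lo` and positive `t` selects `hi`. At `0` the distribution function jumps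
from half the weight of `lo` to the weight of `lo` plus half that of `hi`, hence the atom of mass `1
/ 2`. -/
theorem convergesInLaw_pair (hp : p ≠ 0) (hms : NondegenerateMaximizers p β h {lo, hi})
    (hT : ∀ (N : ℕ) (x : Config N), IsMLE p N h x (T N x)) (hlt : lo ^ p < hi ^ p)
    (hlo : lo ≠ 0) (hhi : hi ≠ 0) :
    ConvergesInLaw (scaledErrorLaw p β h T)
      (mixture (mixWeight p β h lo / 2) (halfNormalNeg (limVar p β h lo))
        (mixWeight p β h hi / 2) (halfNormalPos (limVar p β h hi))
        (1 / 2) (Measure.dirac 0)) := by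
  have hne : lo ≠ hi := by rintro rfl; exact lt_irrefl _ hlt
  have hsum := sum_mixWeight_pair hms hne
  have h1 := hms.mixWeight_pos (m := lo) (by simp)
  have h2 := hms.mixWeight_pos (m := hi) (by simp)
  refine convergesInLaw_mixture (by linarith) (by linarith) (by norm_num) (by linarith) _ _ _
    fun t ht => ?_
  rcases lt_or_gt_of_ne ht with ht | ht
  · convert tendsto_cdf_pair_of_neg hp hms hT hlt hlo ht using 2
    rw [halfNormalNeg_real_Iic_of_neg _ ht, halfNormalPos_real_Iic_of_neg _ ht, dirac_real_Iic,
      if_neg (by exact_mod_cast not_le.2 ht)]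
    ring
  · convert tendsto_cdf_pair_of_pos hp hms hT hlt hhi ht using 2
    rw [halfNormalNeg_real_Iic_of_pos _ ht, halfNormalPos_real_Iic_of_pos _ ht, dirac_real_Iic,
      if_pos (by exact_mod_cast ht.le)]
    linear_combination - (1 / 2 : ℝ) * hsum

theorem convergesInLaw_pair_zero (hp : 3 ≤ p) (hms : NondegenerateMaximizers p β h {0, hi})
    (hT : ∀ (N : ℕ) (x : Config N), IsMLE p N h x (T N x)) (hodd : Odd p) (hhi : 0 < hi) :
    ConvergesInLaw (scaledErrorLaw p β h T)
      (mixture (mixWeight p β h 0 / 2) (Measure.dirac ⊥)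
        (mixWeight p β h hi / 2) (halfNormalPos (limVar p β h hi))
        (1 / 2) (Measure.dirac 0)) := by
  have hp0 : p ≠ 0 := by omega
  have hpow : 0 < hi ^ p := by positivity
  have hsum := sum_mixWeight_pair hms hhi.ne
  have h1 := hms.mixWeight_pos (m := 0) (by simp)
  have h2 := hms.mixWeight_pos (m := hi) (by simp)
  refine convergesInLaw_mixture (by linarith) (by linarith) (by norm_num) (by linarith) _ _ _
    fun t ht => ?_
  rcases lt_or_gt_of_ne ht with ht | ht
  · convert hms.tendsto_cdf_of_zero hp hT ht (by simp [hpow]) (by simp) using 2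
    rw [halfNormalPos_real_Iic_of_neg _ ht, dirac_real_Iic, dirac_real_Iic, if_pos bot_le,
      if_neg (by exact_mod_cast not_le.2 ht), gammaP_odd hodd]
    ring
  · convert tendsto_cdf_pair_of_pos hp0 hms hT (by rwa [zero_pow hp0]) hhi.ne' ht using 2
    rw [halfNormalPos_real_Iic_of_pos _ ht, dirac_real_Iic, dirac_real_Iic, if_pos bot_le,
      if_pos (by exact_mod_cast ht.le)]
    linear_combination - (1 / 2 : ℝ) * hsum

end Pair

section Symmetric

variable {p : ℕ} {β m : ℝ} {T : (N : ℕ) → Config N → EReal}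

theorem limVar_neg (heven : Even p) {h : ℝ} (hm : m ∈ Ioo (-1 : ℝ) 1) :
    limVar p β h (-m) = limVar p β h m := by
  unfold limVar
  have h1 : Even (2 * p - 2) := ⟨p - 1, by omega⟩
  rw [H2_eq_derivH2 p β h hm, H2_eq_derivH2 p β h ⟨by linarith [hm.2], by linarith [hm.1]⟩,
    derivH2_neg heven, h1.neg_pow]

/-- Both maximizers have the same `m ^ p` and the same variance, so each is selected for every `t`
and the limit is one full Gaussian. -/
theorem convergesInLaw_symmetric (hp : p ≠ 0) (heven : Even p) (hm : 0 < m)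
    (hms : NondegenerateMaximizers p β 0 {-m, m})
    (hT : ∀ (N : ℕ) (x : Config N), IsMLE p N 0 x (T N x)) :
    ConvergesInLaw (scaledErrorLaw p β 0 T) (normalE (limVar p β 0 m)) := by
  have hne : -m ≠ m := by linarith
  have hI := hms.mem_Ioo (m := m) (by simp)
  refine convergesInLaw_of_tendsto_Iic fun t _ => ?_
  have key := hms.tendsto_cdf_of_ne_zero hp hT (t := t) (M := m ^ p) (s := limVar p β 0 m)
    (by
      intro x hx
      simp only [Finset.mem_insert, Finset.mem_singleton] at hx
      rcases hx with rfl | rfl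
      · exact Or.inl (heven.neg_pow m)
      · exact Or.inl rfl)
    ⟨m, by simp, rfl⟩
    (by
      intro x hx _
      simp only [Finset.mem_insert, Finset.mem_singleton] at hx
      rcases hx with rfl | rfl
      · exact ⟨by linarith, limVar_neg heven hI⟩
      · exact ⟨hm.ne', rfl⟩)
  rw [Finset.sum_pair hne, heven.neg_pow, if_pos rfl, ← add_mul, sum_mixWeight_pair hms hne,
    one_mul] at key
  rwa [normalE_real_Iic]

theorem nondegenerateMaximizers_triple (hp : 3 ≤ p) (heven : Even p)
    (hM : maximizers p β 0 = {-m, 0, m}) (hd : derivH2 p β m < 0) :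
    NondegenerateMaximizers p β 0 {-m, 0, m} where
  mem_iff x := by simp [hM]
  derivH2_neg x hx := by
    simp only [Finset.mem_insert, Finset.mem_singleton] at hx
    rcases hx with rfl | rfl | rfl
    · rwa [derivH2_neg heven]
    · rw [derivH2_zero hp]; norm_num
    · exact hd
  nonempty := by simp

/-- Negative `t` selects `0` and sends mass to `-∞`; positive `t` selects both of `±m`, whose equal
weights `w` give `2 w Φ(t)`, the positive half-normal with weight `w` up to a constant. -/
theorem convergesInLaw_triple (hp : 3 ≤ p) (heven : Even p) (hm : 0 < m)
    (hms : NondegenerateMaximizers p β 0 {-m, 0, m})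
    (hT : ∀ (N : ℕ) (x : Config N), IsMLE p N 0 x (T N x)) :
    ConvergesInLaw (scaledErrorLaw p β 0 T)
      (mixture (mixWeight p β 0 0 * gammaP p) (Measure.dirac ⊥)
        (mixWeight p β 0 (-m)) (halfNormalPos (limVar p β 0 m))
        (1 - mixWeight p β 0 (-m) - mixWeight p β 0 0 * gammaP p) (Measure.dirac 0)) := by
  have hp0 : p ≠ 0 := by omega
  have hpow : 0 < m ^ p := by positivity
  have hI := hms.mem_Ioo (m := m) (by simp)
  have hn1 : -m ∉ ({0, m} : Finset ℝ) := by
    simp only [Finset.mem_insert, Finset.mem_singleton, not_or]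
    constructor <;> linarith
  have hsum := hms.sum_mixWeight
  rw [Finset.sum_insert hn1, Finset.sum_pair hm.ne] at hsum
  have h0 := hms.mixWeight_pos (m := 0) (by simp)
  have h1 := hms.mixWeight_pos (m := m) (by simp)
  have h2 := hms.mixWeight_pos (m := -m) (by simp)
  have hg0 := gammaP_pos p
  have hg1 := mul_le_of_le_one_right h0.le (gammaP_le_one p)
  have heq : mixWeight p β 0 (-m) = mixWeight p β 0 m := by
    rw [hms.mixWeight_eq (by simp), hms.mixWeight_eq (by simp)]
    unfold lapWeight
    rw [neg_sq, derivH2_neg heven]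
  refine convergesInLaw_mixture (by positivity) h2.le (by linarith) (by ring) _ _ _
    fun t ht => ?_
  rcases lt_or_gt_of_ne ht with ht | ht
  · convert hms.tendsto_cdf_of_zero hp hT ht (by simp [hpow, heven.neg_pow]) (by simp) using 2
    rw [halfNormalPos_real_Iic_of_neg _ ht, dirac_real_Iic, dirac_real_Iic, if_pos bot_le,
      if_neg (by exact_mod_cast not_le.2 ht)]
    ring
  · have key := hms.tendsto_cdf_of_ne_zero hp0 hT (t := t) (M := m ^ p) (s := limVar p β 0 m)
      (by
        intro x hx
        simp only [Finset.mem_insert, Finset.mem_singleton] at hx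
        rcases hx with rfl | rfl | rfl
        · exact Or.inl (heven.neg_pow m)
        · refine Or.inr (mul_neg_of_pos_of_neg ht ?_)
          rw [zero_pow hp0]; linarith
        · exact Or.inl rfl)
      ⟨m, by simp, rfl⟩
      (by
        intro x hx hx'
        simp only [Finset.mem_insert, Finset.mem_singleton] at hx
        rcases hx with rfl | rfl | rfl
        · exact ⟨by linarith, limVar_neg heven hI⟩
        · rw [zero_pow hp0] at hx'; exact absurd hx' hpow.ne
        · exact ⟨hm.ne', rfl⟩)
    rw [Finset.sum_insert hn1, Finset.sum_pair hm.ne, heven.neg_pow, zero_pow hp0,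
      if_pos rfl, if_neg hpow.ne, if_pos ht] at key
    convert key using 2
    rw [halfNormalPos_real_Iic_of_pos _ ht, dirac_real_Iic, dirac_real_Iic, if_pos bot_le,
      if_pos (by exact_mod_cast ht.le)]
    linear_combination
      ((gaussianReal 0 (limVar p β 0 m).toNNReal).real (Iic t) - 1) * heq - hsum

end Symmetric

theorem maximizers_nondegenerate {p : ℕ} (hp : 3 ≤ p) {β h : ℝ} (hβ : 0 ≤ β)
    (hcrit : IsCritical p β h) :
    ∃ ms : Finset ℝ, (ms.card = 2 ∨ ms.card = 3) ∧ NondegenerateMaximizers p β h ms := by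
  rcases Nat.even_or_odd p with heven | hodd
  · rcases lt_trichotomy h 0 with hh | rfl | hh
    · obtain ⟨a, b, -, hlt, hM, ha, hb⟩ := maximizers_even_neg hp heven hh hcrit
      exact ⟨{a, b}, Or.inl (Finset.card_pair hlt.ne), nondegenerateMaximizers_pair hM ha hb⟩
    · obtain ⟨m, hm, hd, h1, h2⟩ := maximizers_even_zero hp heven hcrit
      have hne : -m ≠ m := by linarith
      by_cases h0 : (0 : ℝ) ∈ maximizers p β 0
      · refine ⟨{-m, 0, m}, Or.inr ?_, nondegenerateMaximizers_triple hp heven (h2 h0) hd⟩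
        rw [Finset.card_insert_of_notMem, Finset.card_pair hm.ne]
        simp only [Finset.mem_insert, Finset.mem_singleton, not_or]
        constructor <;> linarith
      · exact ⟨{-m, m}, Or.inl (Finset.card_pair hne),
          nondegenerateMaximizers_pair (h1 h0) (by rwa [derivH2_neg heven]) hd⟩
    · obtain ⟨a, b, -, hlt, hM, ha, hb⟩ := maximizers_even_pos hp heven hh hcrit
      exact ⟨{a, b}, Or.inl (Finset.card_pair hlt.ne), nondegenerateMaximizers_pair hM ha hb⟩
  · obtain ⟨a, b, hlt, hM, ha, hb, -⟩ := maximizers_odd hp hodd hβ hcrit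
    exact ⟨{a, b}, Or.inl (Finset.card_pair hlt.ne), nondegenerateMaximizers_pair hM ha hb⟩

end CurieWeiss

end

/-! ### The limit theorem at critical points -/

open CurieWeiss in
theorem theorem2p7 (p : ℕ) (hp : 3 ≤ p) (β h : ℝ) (hβ : 0 ≤ β)
    (hcrit : CurieWeiss.IsCritical p β h)
    (betaHat : (N : ℕ) → CurieWeiss.Config N → EReal)
    (hmle : ∀ (N : ℕ) (x : CurieWeiss.Config N), CurieWeiss.IsMLE p N h x (betaHat N x)) :
    -- the maximizers and all quantities built from them are well behaved
    ((CurieWeiss.maximizers p β h).ncard = 2 ∨ (CurieWeiss.maximizers p β h).ncard = 3) ∧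
    (∀ m ∈ CurieWeiss.maximizers p β h, m ∈ Set.Ioo (-1 : ℝ) 1 ∧ CurieWeiss.H2 p β h m < 0) ∧
    -- odd `p`
    (Odd p → ∃ m₁ m₂ : ℝ, m₁ < m₂ ∧ CurieWeiss.maximizers p β h = {m₁, m₂} ∧
      ((β, h) ≠ (CurieWeiss.betaTilde p, 0) →
        0 < CurieWeiss.limVar p β h m₁ ∧ 0 < CurieWeiss.limVar p β h m₂ ∧
        CurieWeiss.ConvergesInLaw (CurieWeiss.scaledErrorLaw p β h betaHat)
          (CurieWeiss.mixture
            (CurieWeiss.mixWeight p β h m₁ / 2)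
            (CurieWeiss.halfNormalNeg (CurieWeiss.limVar p β h m₁))
            ((1 - CurieWeiss.mixWeight p β h m₁) / 2)
            (CurieWeiss.halfNormalPos (CurieWeiss.limVar p β h m₂))
            (1 / 2) (MeasureTheory.Measure.dirac 0))) ∧
      ((β, h) = (CurieWeiss.betaTilde p, 0) →
        0 < CurieWeiss.limVar p β h m₂ ∧
        CurieWeiss.ConvergesInLaw (CurieWeiss.scaledErrorLaw p β h betaHat)
          (CurieWeiss.mixture
            (CurieWeiss.mixWeight p β h m₁ / 2) (MeasureTheory.Measure.dirac ⊥)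
            ((1 - CurieWeiss.mixWeight p β h m₁) / 2)
            (CurieWeiss.halfNormalPos (CurieWeiss.limVar p β h m₂))
            (1 / 2) (MeasureTheory.Measure.dirac 0)))) ∧
    -- even `p`
    (Even p →
      (0 < h → ∃ m₁ m₂ : ℝ, m₁ < m₂ ∧ CurieWeiss.maximizers p β h = {m₁, m₂} ∧
        0 < CurieWeiss.limVar p β h m₁ ∧ 0 < CurieWeiss.limVar p β h m₂ ∧
        CurieWeiss.ConvergesInLaw (CurieWeiss.scaledErrorLaw p β h betaHat)
          (CurieWeiss.mixture
            (CurieWeiss.mixWeight p β h m₁ / 2)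
            (CurieWeiss.halfNormalNeg (CurieWeiss.limVar p β h m₁))
            ((1 - CurieWeiss.mixWeight p β h m₁) / 2)
            (CurieWeiss.halfNormalPos (CurieWeiss.limVar p β h m₂))
            (1 / 2) (MeasureTheory.Measure.dirac 0))) ∧
      (h < 0 → ∃ m₁ m₂ : ℝ, m₁ < m₂ ∧ CurieWeiss.maximizers p β h = {m₁, m₂} ∧
        0 < CurieWeiss.limVar p β h m₁ ∧ 0 < CurieWeiss.limVar p β h m₂ ∧
        CurieWeiss.ConvergesInLaw (CurieWeiss.scaledErrorLaw p β h betaHat)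
          (CurieWeiss.mixture
            (CurieWeiss.mixWeight p β h m₁ / 2)
            (CurieWeiss.halfNormalPos (CurieWeiss.limVar p β h m₁))
            ((1 - CurieWeiss.mixWeight p β h m₁) / 2)
            (CurieWeiss.halfNormalNeg (CurieWeiss.limVar p β h m₂))
            (1 / 2) (MeasureTheory.Measure.dirac 0))) ∧
      (h = 0 → CurieWeiss.betaTilde p < β →
        ∃ m : ℝ, 0 < m ∧ CurieWeiss.maximizers p β h = {-m, m} ∧
        0 < CurieWeiss.limVar p β h m ∧
        CurieWeiss.ConvergesInLaw (CurieWeiss.scaledErrorLaw p β h betaHat)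
          (CurieWeiss.normalE (CurieWeiss.limVar p β h m))) ∧
      (h = 0 → β = CurieWeiss.betaTilde p →
        ∃ m : ℝ, 0 < m ∧ CurieWeiss.maximizers p β h = {-m, 0, m} ∧
        0 < CurieWeiss.limVar p β h m ∧
        CurieWeiss.ConvergesInLaw (CurieWeiss.scaledErrorLaw p β h betaHat)
          (CurieWeiss.mixture
            (CurieWeiss.mixWeight p β h 0 * CurieWeiss.gammaP p)
            (MeasureTheory.Measure.dirac ⊥)
            (CurieWeiss.mixWeight p β h (-m))
            (CurieWeiss.halfNormalPos (CurieWeiss.limVar p β h m))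
            (1 - CurieWeiss.mixWeight p β h (-m)
              - CurieWeiss.mixWeight p β h 0 * CurieWeiss.gammaP p)
            (MeasureTheory.Measure.dirac 0)))) ∧
    -- failure of `√N`-consistency at the threshold
    ((β, h) = (CurieWeiss.betaTilde p, 0) →
      ¬ CurieWeiss.IsSqrtConsistent p β h betaHat) := by
  
  have hp0 : p ≠ 0 := by omega
  obtain ⟨ms, hcard, hms⟩ := maximizers_nondegenerate hp hβ hcrit
  refine ⟨?_, ?_, ?_, ?_, ?_⟩
  · rw [hms.coe_eq, Set.ncard_coe_finset]
    exact hcard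
  · intro m hm
    have hm' := (hms.mem_iff m).2 hm
    rw [H2_eq_derivH2 p β h (hms.mem_Ioo hm')]
    exact ⟨hms.mem_Ioo hm', hms.derivH2_neg m hm'⟩
  · intro hodd
    obtain ⟨m₁, m₂, hlt, hM, hd₁, hd₂, hne, heq⟩ := maximizers_odd hp hodd hβ hcrit
    have hms := nondegenerateMaximizers_pair hM hd₁ hd₂
    have hw : (1 - mixWeight p β h m₁) / 2 = mixWeight p β h m₂ / 2 := by
      rw [← sum_mixWeight_pair hms hlt.ne, add_sub_cancel_left]
    refine ⟨m₁, m₂, hlt, hM, fun hbh => ?_, fun hbh => ?_⟩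
    · obtain ⟨h1, h2⟩ := hne hbh
      refine ⟨hms.limVar_pos hp0 (by simp) h1, hms.limVar_pos hp0 (by simp) h2, ?_⟩
      rw [hw]
      exact convergesInLaw_pair hp0 hms hmle (hodd.strictMono_pow hlt) h1 h2
    · obtain rfl := heq hbh
      refine ⟨hms.limVar_pos hp0 (by simp) hlt.ne', ?_⟩
      rw [hw]
      exact convergesInLaw_pair_zero hp hms hmle hodd hlt
  · intro heven
    refine ⟨fun hh => ?_, fun hh => ?_, ?_, ?_⟩
    · obtain ⟨m₁, m₂, hpos, hlt, hM, hd₁, hd₂⟩ := maximizers_even_pos hp heven hh hcrit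
      have hms := nondegenerateMaximizers_pair hM hd₁ hd₂
      have h2 : m₂ ≠ 0 := by linarith
      refine ⟨m₁, m₂, hlt, hM, hms.limVar_pos hp0 (by simp) hpos.ne',
        hms.limVar_pos hp0 (by simp) h2, ?_⟩
      rw [show 1 - mixWeight p β h m₁ = mixWeight p β h m₂ by
        rw [← sum_mixWeight_pair hms hlt.ne, add_sub_cancel_left]]
      exact convergesInLaw_pair hp0 hms hmle (pow_lt_pow_left₀ hlt hpos.le hp0) hpos.ne' h2
    · obtain ⟨m₁, m₂, hneg, hlt, hM, hd₁, hd₂⟩ := maximizers_even_neg hp heven hh hcrit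
      have hms := nondegenerateMaximizers_pair hM hd₁ hd₂
      -- On the negative axis an even power reverses the order, so the larger maximizer `m₂` plays
      -- the role of `lo` and the components swap.
      have hms' := nondegenerateMaximizers_pair (hM.trans (Set.pair_comm _ _)) hd₂ hd₁
      have h1 : m₁ ≠ 0 := by linarith
      refine ⟨m₁, m₂, hlt, hM, hms.limVar_pos hp0 (by simp) h1,
        hms.limVar_pos hp0 (by simp) hneg.ne, ?_⟩
      rw [show 1 - mixWeight p β h m₁ = mixWeight p β h m₂ by
        rw [← sum_mixWeight_pair hms hlt.ne, add_sub_cancel_left]]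
      have hpow : m₂ ^ p < m₁ ^ p := by
        rw [← heven.neg_pow m₁, ← heven.neg_pow m₂]
        exact pow_lt_pow_left₀ (by linarith) (by linarith) hp0
      have key := convergesInLaw_pair hp0 hms' hmle hpow hneg.ne h1
      unfold mixture at key ⊢
      rwa [add_comm (ENNReal.ofReal (mixWeight p β h m₁ / 2) • _)]
    · rintro rfl hlt
      obtain ⟨m, hm, hd, hM, -⟩ := maximizers_even_zero hp heven hcrit
      have hM' := hM (zero_notMem_maximizers hp0 hβ hlt)
      have hms := nondegenerateMaximizers_pair hM' (by rwa [derivH2_neg heven]) hd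
      exact ⟨m, hm, hM', hms.limVar_pos hp0 (by simp) hm.ne',
        convergesInLaw_symmetric hp0 heven hm hms hmle⟩
    · rintro rfl hbt
      obtain ⟨m, hm, hd, -, hM⟩ := maximizers_even_zero hp heven hcrit
      have hM' := hM (hbt ▸ zero_mem_maximizers_betaTilde hp0)
      have hms := nondegenerateMaximizers_triple hp heven hM' hd
      exact ⟨m, hm, hM', hms.limVar_pos hp0 (by simp) hm.ne',
        convergesInLaw_triple hp heven hm hms hmle⟩
  · intro hbh
    have hbt : β = CurieWeiss.betaTilde p := (Prod.ext_iff.1 hbh).1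
    have hh : h = 0 := (Prod.ext_iff.1 hbh).2
    subst hh
    have h0 : (0 : ℝ) ∈ ms := by
      rw [hms.mem_iff]
      have := zero_mem_maximizers_betaTilde (p := p) hp0
      rwa [← hbt] at this
    -- For either parity `0` minimizes `m ^ p` among the maximizers at the threshold, so negative
    -- `t` selects it; for odd `p` this is because the other maximizer is positive.
    have hM : ∀ m ∈ ms, m = 0 ∨ 0 < m ^ p := by
      intro m hm
      rcases Nat.even_or_odd p with heven | hodd
      · exact (eq_or_ne m 0).imp_right fun h => heven.pow_pos h
      · obtain ⟨m₁, m₂, hlt, hM, -, -, -, heq⟩ := maximizers_odd hp hodd hβ hcrit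
        obtain rfl := heq hbh
        have hm' : m = 0 ∨ m = m₂ := by simpa [hM] using (hms.mem_iff m).1 hm
        rcases hm' with rfl | rfl
        · exact Or.inl rfl
        · exact Or.inr (pow_pos hlt p)
    exact not_isSqrtConsistent (mul_pos (hms.mixWeight_pos h0) (gammaP_pos p))
      fun t ht => hms.tendsto_cdf_of_zero hp hmle ht hM h0
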